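/- **Setting.** Let $O=(X,Z,A,Y)\sim P$ with covariates $X\in\mathbb R^d$, a real instrument $Z$ whose conditional distribution given $X$ is continuous (no atoms), a binary exposure $A\in\{0,1\}$ and a real outcome $Y$ with $E(Y^2)<\infty$. Let $A^z,\ Y^{z,a},\ Y^a$ be the counterfactuals and $Y^z=Y^{z,A^z}$. Assume consistency ($A^Z=A$ and $Y^{Z,A}=Y^A=Y$ a.s.), unconfoundedness ($Z\perp (A^z,Y^z)\mid X$ for every $z$), exclusion (a.s. $Y^{z,a}=Y^a$ for all $z,a$) and monotonicity (a.s. $A^{z'}\ge A^{z}$ for all $z'>z$). For $\delta\in\mathbb R$ let $Q_\delta(\cdot\mid X)$ be the exponential tilt of the conditional law $\Pi(\cdot\mid X)$ of $Z$, $dQ_\delta(z\mid X)\propto e^{\delta z}\,d\Pi(z\mid X)$, let $Z_\delta=Q_\delta^{-1}(\Pi(Z\mid X)\mid X)$ (distribution and quantile functions), and let $\psi(\delta)=E(Y^1-Y^0\mid A^{Z_\delta}>A)$ for $\delta>0$ and $\psi(\delta)=E(Y^1-Y^0\mid A^{Z_\delta}<A)$ for $\delta<0$. Put $\alpha_\delta(X)=E(e^{\delta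 Z}\mid X)$ and $\gamma^T_\delta(X)=E(Te^{\delta Z}\mid X)/\alpha_\delta(X)$ for $T\in\{Y,A\}$. For values $\eta=(\alpha,\gamma^Y,\gamma^A)$ of the nuisance functions and $p\in\mathbb R$ let $$\xi(T;\delta)=T\frac{e^{\delta Z}}{\alpha_\delta(X)}+\gamma^T_\delta(X)\Big(1-\frac{e^{\delta Z}}{\alpha_\delta(X)}\Big),\quad \Theta(T;\delta,0)=\xi(T;\delta)-\xi(T;0),\quad \varphi_\delta(O;\eta,p)=\frac{\Theta(Y;\delta,0)-p\,\Theta(A;\delta,0)}{E(\gamma^A_\delta(X)-A)},$$ where the denominator is always formed with the true $\gamma^A_\delta$. Write $\varphi_\delta=\varphi_\delta(\cdot;\eta_0,\psi(\delta))$ at the true nuisance functions $\eta_0$, and $\sigma^2(\delta)=E(\varphi_\delta^2)$. Let $\mathcal D\subset\mathbb R$ be compact and suppose that for every $\delta\in\mathcal D$: relevance holds, $\iint E(A\mid Z=u,X=x)\,dQ_\delta(u\mid x)\,dP(x)\ne E(A)$ (so $0\notin\mathcal D$); $\sigma(\delta)>0$; and $E\{(1+Y^2)e^{2\delta Z}\mid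 X\}\le C_\delta\,\alpha_\delta(X)^2$ a.s. for some constant $C_\delta$ (as is the case when $Y$ and $Z$ are bounded). Let $O_1,\dots,O_n$ be iid copies of $O$, with empirical mean $\mathbb P_n$, let $\widehat\eta=(\widehat\alpha,\widehat\gamma^Y,\widehat\gamma^A)$ be estimated from a separate sample independent of $O_1,\dots,O_n$, with $\widehat\alpha_0\equiv 1$ (the known value $\alpha_0=1$), and let $$\widehat\psi_{IF}(\delta)=\frac{\mathbb P_n\widehat\Theta(Y;\delta,0)}{\mathbb P_n\widehat\Theta(A;\delta,0)},$$ with $\widehat\Theta$ equal to $\Theta$ formed with $\widehat\eta$. Let $\widehat\sigma(\delta)$ be any estimator of $\sigma(\delta)$. Let $\|\cdot\|$ be the $L^2(P)$ norm over a fresh $X$ (with $\widehat\eta$ held fixed), and suppose that $\|1-\alpha_\delta/\widehat\alpha_\delta\|+\|\widehat\gamma^Y_\delta-\gamma^Y_\delta\|+\|\widehat\gamma^A_\delta-\gamma^A_\delta\|=o_P(1)$ for each $\delta\in\mathcal D$. **Theorem.** Assume in addition: 1. $\varphi_\delta$ is Lipschitz in $\delta\in\mathcal D$, at the true and at the estimated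 nuisance functions: for each fixed $p\in\mathbb R$ there is $L\in L^2(P)$ with $|\varphi_\delta(o;\eta,p)-\varphi_{\delta'}(o;\eta,p)|\le L(o)|\delta-\delta'|$ for all $\delta,\delta'\in\mathcal D$, for $\eta=\eta_0$ and $P$-almost all $o$, and for $\eta=\widehat\eta$ (for every $n$) and almost all values of the separate sample and of $o$; 2. $\sup_{\delta\in\mathcal D}|\widehat\sigma(\delta)/\sigma(\delta)-1|=o_P(1)$; 3. $\sup_{\delta\in\mathcal D}\|\widehat\gamma^Y_\delta-\gamma^Y_\delta\|\,\|1-\alpha_\delta/\widehat\alpha_\delta\|=o_P(n^{-1/2})$; 4. $\sup_{\delta\in\mathcal D}\|\widehat\gamma^A_\delta-\gamma^A_\delta\|\,\|1-\alpha_\delta/\widehat\alpha_\delta\|=o_P(n^{-1/2})$. Then $$\sup_{\delta\in\mathcal D}\left|\frac{\sqrt n\{\widehat\psi_{IF}(\delta)-\psi(\delta)\}}{\widehat\sigma(\delta)}-\sqrt n(\mathbb P_n-P)\frac{\varphi_\delta}{\sigma(\delta)}\right|=o_P(1).$$ -/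

import Mathlib

open MeasureTheory ProbabilityTheory Filter Topology
open scoped ENNReal

noncomputable section

/-- The range of one observation `o = (x, z, a, y)`: covariates in `ℝ ^ d`, a real instrument,
a binary exposure and a real outcome. -/
abbrev Obs (d : ℕ) : Type := (Fin d → ℝ) × ℝ × Bool × ℝ

/-- The exposure as a number in `{0, 1}`. -/
def num (a : Bool) : ℝ := if a then 1 else 0

/-- Observed variables and counterfactuals on a population space `Ω₀`: `Apot z` is `A ^ z`,
`Yza z a` is `Y ^ (z, a)`, and `Ya a` is `Y ^ a`. -/
structure IVModel (d : ℕ) (Ω₀ : Type*) [MeasurableSpace Ω₀] where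
  X : Ω₀ → (Fin d → ℝ)
  Z : Ω₀ → ℝ
  A : Ω₀ → Bool
  Y : Ω₀ → ℝ
  Apot : ℝ → Ω₀ → Bool
  Yza : ℝ → Bool → Ω₀ → ℝ
  Ya : Bool → Ω₀ → ℝ
  measurable_X : Measurable X
  measurable_Z : Measurable Z
  measurable_A : Measurable A
  measurable_Y : Measurable Y
  measurable_Apot : Measurable (Function.uncurry Apot)
  measurable_Yza : ∀ z a, Measurable (Yza z a)
  measurable_Ya : ∀ a, Measurable (Ya a)

namespace IVModel

variable {d : ℕ} {Ω₀ : Type*} [MeasurableSpace Ω₀]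

/-- The counterfactual outcome `Y ^ z`, with the instrument set to `z`. -/
def Yz (M : IVModel d Ω₀) (z : ℝ) (ω : Ω₀) : ℝ := M.Yza z (M.Apot z ω) ω

/-- The observed data of one unit. -/
def obs (M : IVModel d Ω₀) (ω : Ω₀) : Obs d := (M.X ω, M.Z ω, M.A ω, M.Y ω)

/-- The distribution of one observation. -/
def law (M : IVModel d Ω₀) (P₀ : Measure Ω₀) : Measure (Obs d) := P₀.map M.obs

/-- The distribution of the covariates. -/
def lawX (M : IVModel d Ω₀) (P₀ : Measure Ω₀) : Measure (Fin d → ℝ) := P₀.map M.X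

variable (M : IVModel d Ω₀) (P₀ : Measure Ω₀) [IsProbabilityMeasure P₀]

/-- The regular conditional distribution of `(Z, A, Y)` given `X = x`. -/
def condLaw (x : Fin d → ℝ) : Measure (ℝ × Bool × ℝ) :=
  condDistrib (fun ω => (M.Z ω, M.A ω, M.Y ω)) M.X P₀ x

/-- The conditional distribution of the instrument given `X = x`. -/
def instrLaw (x : Fin d → ℝ) : Measure ℝ := (M.condLaw P₀ x).map Prod.fst

/-- The exponentially tilted instrument distribution given `X = x`, with density proportional
to `exp (δ z)` relative to the conditional distribution of the instrument. -/
def tiltLaw (δ : ℝ) (x : Fin d → ℝ) : Measure ℝ := (M.instrLaw P₀ x).tilted fun z => δ * z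

/-- The conditional distribution function `Π (z | x)`. -/
def instrCDF (z : ℝ) (x : Fin d → ℝ) : ℝ := (M.instrLaw P₀ x).real (Set.Iic z)

/-- The tilted conditional distribution function `Q_δ (z | x)`. -/
def tiltCDF (δ z : ℝ) (x : Fin d → ℝ) : ℝ := (M.tiltLaw P₀ δ x).real (Set.Iic z)

/-- The quantile function of `Q_δ (· | x)`. -/
def tiltQuantile (δ p : ℝ) (x : Fin d → ℝ) : ℝ := sInf {z : ℝ | p ≤ M.tiltCDF P₀ δ z x}

/-- The modified instrument `Z_δ = Q_δ⁻¹ (Π (Z | X) | X)`. -/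
def Ztilt (δ : ℝ) (ω : Ω₀) : ℝ :=
  M.tiltQuantile P₀ δ (M.instrCDF P₀ (M.Z ω) (M.X ω)) (M.X ω)

/-- The counterfactual exposure `A ^ Z_δ`. -/
def Atilt (δ : ℝ) (ω : Ω₀) : Bool := M.Apot (M.Ztilt P₀ δ ω) ω

/-- The `δ`-tilted local average treatment effect: `E (Y¹ - Y⁰ | A ^ Z_δ > A)` for `δ > 0`, and
`E (Y¹ - Y⁰ | A ^ Z_δ < A)` for `δ < 0`. -/
def tiltedLATE (δ : ℝ) : ℝ :=
  if 0 < δ then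
    ∫ ω, (M.Ya true ω - M.Ya false ω) ∂(ProbabilityTheory.cond P₀ {ω | M.A ω < M.Atilt P₀ δ ω})
  else
    ∫ ω, (M.Ya true ω - M.Ya false ω) ∂(ProbabilityTheory.cond P₀ {ω | M.Atilt P₀ δ ω < M.A ω})

/-- The regression function `E (A | Z = z, X = x)`. -/
def treatReg (x : Fin d → ℝ) (z : ℝ) : ℝ :=
  ∫ a, num a ∂(condDistrib M.A (fun ω => (M.X ω, M.Z ω)) P₀ (x, z))

/-- The core instrumental variable conditions, with monotonicity. -/
structure CausalAssumptions [StandardBorelSpace Ω₀] : Prop where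
  consistency : ∀ᵐ ω ∂P₀, M.Apot (M.Z ω) ω = M.A ω ∧ M.Yza (M.Z ω) (M.A ω) ω = M.Y ω ∧
    M.Ya (M.A ω) ω = M.Y ω
  unconfoundedness : ∀ z : ℝ, CondIndepFun (MeasurableSpace.comap M.X inferInstance)
    M.measurable_X.comap_le M.Z (fun ω => (M.Apot z ω, M.Yz z ω)) P₀
  exclusion : ∀ᵐ ω ∂P₀, ∀ z a, M.Yza z a ω = M.Ya a ω
  monotonicity : ∀ᵐ ω ∂P₀, ∀ z z' : ℝ, z < z' → M.Apot z ω ≤ M.Apot z' ω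

/-- Relevance of the intervention with tilt `δ`. -/
def Relevance (δ : ℝ) : Prop :=
  ∫ x, ∫ z, M.treatReg P₀ x z ∂(M.tiltLaw P₀ δ x) ∂(M.lawX P₀) ≠ ∫ ω, num (M.A ω) ∂P₀

end IVModel

/-- Values of the nuisance functions `α_δ (x)`, `γ_δ ^ Y (x)`, `γ_δ ^ A (x)`, either the true ones
or estimates; the arguments are `δ` and `x`. -/
structure Nuisance (d : ℕ) where
  α : ℝ → (Fin d → ℝ) → ℝ
  γY : ℝ → (Fin d → ℝ) → ℝ
  γA : ℝ → (Fin d → ℝ) → ℝ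

namespace Nuisance

variable {d : ℕ}

/-- `ξ (Y; δ)`. -/
def xiY (η : Nuisance d) (δ : ℝ) (o : Obs d) : ℝ :=
  o.2.2.2 * (Real.exp (δ * o.2.1) / η.α δ o.1) +
    η.γY δ o.1 * (1 - Real.exp (δ * o.2.1) / η.α δ o.1)

/-- `ξ (A; δ)`. -/
def xiA (η : Nuisance d) (δ : ℝ) (o : Obs d) : ℝ :=
  num o.2.2.1 * (Real.exp (δ * o.2.1) / η.α δ o.1) +
    η.γA δ o.1 * (1 - Real.exp (δ * o.2.1) / η.α δ o.1)

/-- `Θ (Y; δ, 0) = ξ (Y; δ) - ξ (Y; 0)`. -/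
def ThetaY (η : Nuisance d) (δ : ℝ) (o : Obs d) : ℝ := η.xiY δ o - η.xiY 0 o

/-- `Θ (A; δ, 0) = ξ (A; δ) - ξ (A; 0)`. -/
def ThetaA (η : Nuisance d) (δ : ℝ) (o : Obs d) : ℝ := η.xiA δ o - η.xiA 0 o

end Nuisance

namespace IVModel

variable {d : ℕ} {Ω₀ : Type*} [MeasurableSpace Ω₀]
  (M : IVModel d Ω₀) (P₀ : Measure Ω₀) [IsProbabilityMeasure P₀]

/-- The true nuisance functions: `α_δ (x) = E (exp (δ Z) | X = x)`,
`γ_δ ^ Y (x) = E (Y exp (δ Z) | X = x) / α_δ (x)`, and the same with `A` in place of `Y`. -/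
def nuisance : Nuisance d where
  α := fun δ x => ∫ w, Real.exp (δ * w.1) ∂(M.condLaw P₀ x)
  γY := fun δ x => (∫ w, w.2.2 * Real.exp (δ * w.1) ∂(M.condLaw P₀ x)) /
    ∫ w, Real.exp (δ * w.1) ∂(M.condLaw P₀ x)
  γA := fun δ x => (∫ w, num w.2.1 * Real.exp (δ * w.1) ∂(M.condLaw P₀ x)) /
    ∫ w, Real.exp (δ * w.1) ∂(M.condLaw P₀ x)

/-- The normalizing constant `E (γ_δ ^ A (X) - A)`. -/
def denom (δ : ℝ) : ℝ := ∫ ω, ((M.nuisance P₀).γA δ (M.X ω) - num (M.A ω)) ∂P₀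

/-- The influence function `φ_δ (o; η, p)` as a function of the observation, of nuisance values
`η` and of a value `p` for the parameter; the normalizing constant is the population one. -/
def phi (δ : ℝ) (η : Nuisance d) (p : ℝ) (o : Obs d) : ℝ :=
  (η.ThetaY δ o - p * η.ThetaA δ o) / M.denom P₀ δ

/-- The efficient influence function of the tilted effect: true nuisances, true parameter. -/
def eif (δ : ℝ) (o : Obs d) : ℝ := M.phi P₀ δ (M.nuisance P₀) (M.tiltedLATE P₀ δ) o

/-- `σ (δ)`, where `σ (δ) ^ 2 = E (φ_δ ^ 2)`. -/
def sigma (δ : ℝ) : ℝ := Real.sqrt (∫ o, M.eif P₀ δ o ^ 2 ∂(M.law P₀))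

/-- `‖1 - α_δ / α̂_δ‖` in `L²`. -/
def errα (η : Nuisance d) (δ : ℝ) : ℝ≥0∞ :=
  eLpNorm (fun x => 1 - (M.nuisance P₀).α δ x / η.α δ x) 2 (M.lawX P₀)

/-- `‖γ̂_δ ^ Y - γ_δ ^ Y‖` in `L²`. -/
def errY (η : Nuisance d) (δ : ℝ) : ℝ≥0∞ :=
  eLpNorm (fun x => η.γY δ x - (M.nuisance P₀).γY δ x) 2 (M.lawX P₀)

/-- `‖γ̂_δ ^ A - γ_δ ^ A‖` in `L²`. -/
def errA (η : Nuisance d) (δ : ℝ) : ℝ≥0∞ :=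
  eLpNorm (fun x => η.γA δ x - (M.nuisance P₀).γA δ x) 2 (M.lawX P₀)

end IVModel

/-- The empirical mean `ℙ_n f` over the first `n` observations. -/
def empMean {d : ℕ} {Ω : Type*} (O : ℕ → Ω → Obs d) (n : ℕ) (ω : Ω) (f : Obs d → ℝ) : ℝ :=
  (n : ℝ)⁻¹ * ∑ i ∈ Finset.range n, f (O i ω)

/-- The influence-function-based estimator `ℙ_n Θ̂ (Y; δ, 0) / ℙ_n Θ̂ (A; δ, 0)`, computed with
nuisance values `η`. -/
def psiIF {d : ℕ} {Ω : Type*} (O : ℕ → Ω → Obs d) (n : ℕ) (ω : Ω) (η : Nuisance d) (δ : ℝ) : ℝ :=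
  empMean O n ω (η.ThetaY δ) / empMean O n ω (η.ThetaA δ)

/-- `R n = o_P (r n)` for nonnegative quantities `R n`. On non-measurable events `μ` is the outer
measure, so a supremum over an uncountable set needs no measurability. -/
def IsLittleOP {Ω : Type*} [MeasurableSpace Ω] (μ : Measure Ω) (R : ℕ → Ω → ℝ≥0∞) (r : ℕ → ℝ) :
    Prop :=
  ∀ ε : ℝ, 0 < ε → Tendsto (fun n => μ {ω | ENNReal.ofReal (ε * r n) < R n ω}) atTop (𝓝 0)

end

/-!
The argument has three parts: the identification of `ψ(δ)` by observable moments, the second-order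
bias of the plug-in contrast at a fixed tilt, and the passage from a fixed tilt to all tilts in `D`.

**Identification.** Unconfoundedness speaks of one fixed value of the instrument at a time, whereas
`ψ(δ)` involves the exposure at the random value `Z_δ`. Since the exposure of a unit is monotone in
the instrument, it is locally constant except at one switching point, so that it can be followed
along countable grids, on which fixed values suffice; an atomless conditional law hits the switching
point with probability zero. Hence `Z` may be exchanged for a fresh draw from its conditional law
(`lintegral_own_eq_fresh`). As the quantile transform carries the conditional law of `Z` to its tilt
(`map_eq_tilted`), exposure and outcome under `Z_δ` have the law of `(A, Y)` reweighted by
`e^{δZ} / α_δ(X)` (`IVModel.CausalAssumptions.map_tilt_eq`). Tilting moves the law of `Z` in one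
direction, so that by monotonicity all exposures that change do so in the same direction, and `ψ(δ)`
is the quotient of the two reweighted contrasts (`IVModel.CausalAssumptions.tiltedLATE_eq`), whose
denominator relevance keeps away from zero (`IVModel.TiltMoment.denom_ne_zero`). This is the
quotient of the means of `Θ(Y; δ, 0)` and `Θ(A; δ, 0)`.

**Bias at a fixed tilt.** The error of the estimated contrast is the sum of a part that is linear in
the errors of `γ` and `α`, and centered given the covariates, and a part that is bilinear in them
(`contrast_sub_eq`). Given the separate sample, the empirical process of the linear part has a
variance of the order of the squared errors, and the bilinear part is bounded in `L¹` by the product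
of the errors; with consistency and the product rates, `√n` times the empirical mean of the error
vanishes in probability (`vanishing_contrast`).

**Uniformity.** An empirical process over functions that are Lipschitz in one real parameter, with a
square-integrable constant, has Lipschitz increments in `L²`. On the line no chaining is needed: the
oscillation over an interval is at most the sum of the increments between consecutive points, whose
`L²` norm is of the order of the length of the interval (`exists_increment_majorant`). Cutting
`D` into `N` cells, the oscillations exceed a given level with probability of order `N · N⁻²`, so
that convergence in probability at each point is uniform (`tendsto_measure_exists_lt_abs`). The same
bound makes the processes at the true nuisance functions uniformly tight
(`exists_measure_empProc_le`). The Lipschitz condition on `φ_δ` at `p = 0`, and on the difference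
between `p = 0` and `p = 1`, is one on the contrasts of `Y` and of `A`, both divided by
`E(γ^A_δ(X) - A)`; so the plug-in errors of both vanish uniformly (`vanishing_contrast_uniform`).

It remains to expand a quotient. On the compact set `D` the normalizing constant, `ψ` and `σ` are
continuous (`IVModel.continuousOn_denom`, `continuousOn_integral_of_lipschitz`,
`continuousOn_integral_sq_of_lipschitz`), hence `E(γ^A_δ(X) - A)` and `σ` are bounded away from
zero and `ψ` is bounded, and the expansion holds deterministically on the event that all the
errors above are small and the two limiting processes are bounded (`vanishing_studentized`).
-/

noncomputable section

/-! ### Oscillation of processes with Lipschitz increments in `L²` -/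

theorem eLpNorm_two_sq {α : Type*} [MeasurableSpace α] (ν : Measure α) (f : α → ℝ) :
    eLpNorm f 2 ν ^ 2 = ∫⁻ x, ‖f x‖ₑ ^ 2 ∂ν := by
  have h := eLpNorm_nnreal_pow_eq_lintegral (μ := ν) (f := f) (p := 2) (by norm_num)
  simpa using h

/-- Chebyshev's inequality with the `L²` norm. -/
theorem measure_lt_abs_le {α : Type*} [MeasurableSpace α] {ν : Measure α} {f : α → ℝ}
    (hf : AEStronglyMeasurable f ν) {t : ℝ} (ht : 0 < t) :
    ν {x | t < |f x|} ≤ (eLpNorm f 2 ν / ENNReal.ofReal t) ^ 2 := by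
  have h := meas_ge_le_mul_pow_eLpNorm_enorm (p := 2) ν (by norm_num) (by norm_num) hf
    (ε := ENNReal.ofReal t) (by simpa using ht) (by simp)
  refine (measure_mono ?_).trans (h.trans_eq ?_)
  · intro x hx
    simp only [Set.mem_ofPred_eq] at hx ⊢
    rw [Real.enorm_eq_ofReal_abs]
    exact ENNReal.ofReal_le_ofReal hx.le
  · simp [ENNReal.div_eq_inv_mul, mul_pow]

/-- On a finite set of reals, the sum of the increments between consecutive points dominates every
increment. Its `L²` norm telescopes, so it is of the order of the length of the interval, whatever
the number of points: in one dimension this replaces chaining. -/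
theorem exists_increment_majorant {Ω : Type*} [MeasurableSpace Ω] {μ : Measure Ω}
    {X : ℝ → Ω → ℝ} {K : ℝ≥0∞} {D : Set ℝ} {a : ℝ} (ha : ∀ δ ∈ D, a ≤ δ)
    (hmeas : ∀ δ ∈ D, AEStronglyMeasurable (X δ) μ)
    (hK : ∀ δ ∈ D, ∀ δ' ∈ D,
      eLpNorm (fun ω => X δ ω - X δ' ω) 2 μ ≤ K * ENNReal.ofReal |δ - δ'|)
    (F : Finset ℝ) : (hF : ∀ δ ∈ F, δ ∈ D) → F.Nonempty → ∃ m ∈ F, (∀ δ ∈ F, δ ≤ m) ∧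
      ∃ V : Ω → ℝ, AEStronglyMeasurable V μ ∧ (∀ ω, 0 ≤ V ω) ∧
        (∀ ω, ∀ δ ∈ F, ∀ δ' ∈ F, |X δ ω - X δ' ω| ≤ V ω) ∧
        eLpNorm V 2 μ ≤ K * ENNReal.ofReal (m - a) := by
  induction F using Finset.induction_on_max with
  | empty => intro _ h; exact absurd h (by simp)
  | insert m F hlt ih =>
    intro hF _
    have hmD : m ∈ D := hF m (by simp)
    refine ⟨m, by simp, ?_, ?_⟩
    · intro δ hδ
      rcases Finset.mem_insert.1 hδ with rfl | h
      · exact le_rfl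
      · exact (hlt δ h).le
    rcases F.eq_empty_or_nonempty with rfl | hne
    · refine ⟨fun _ => 0, aestronglyMeasurable_const, by simp, ?_, by simp⟩
      intro ω δ hδ δ' hδ'
      simp only [insert_empty_eq, Finset.mem_singleton] at hδ hδ'
      simp [hδ, hδ']
    · obtain ⟨p, hpF, hp, V, hVm, hV0, hV, hVn⟩ := ih (fun δ h => hF δ (by simp [h])) hne
      have hpD : p ∈ D := hF p (by simp [hpF])
      have hmp : AEStronglyMeasurable (fun ω => |X m ω - X p ω|) μ :=
        ((hmeas m hmD).sub (hmeas p hpD)).norm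
      refine ⟨fun ω => V ω + |X m ω - X p ω|, hVm.add hmp,
        fun ω => add_nonneg (hV0 ω) (abs_nonneg _), ?_, ?_⟩
      · intro ω δ hδ δ' hδ'
        have key : ∀ δ ∈ F, |X m ω - X δ ω| ≤ V ω + |X m ω - X p ω| := by
          intro δ h
          have h1 := hV ω p hpF δ h
          have h2 := abs_sub_le (X m ω) (X p ω) (X δ ω)
          linarith
        rcases Finset.mem_insert.1 hδ with rfl | h <;> rcases Finset.mem_insert.1 hδ' with h' | h'
        · rw [h']; simpa using add_nonneg (hV0 ω) (abs_nonneg _)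
        · exact key δ' h'
        · rw [h', abs_sub_comm]; exact key δ h
        · exact (hV ω δ h δ' h').trans (by simp)
      · refine (eLpNorm_add_le hVm hmp (by norm_num)).trans ?_
        have h1 : eLpNorm (fun ω => |X m ω - X p ω|) 2 μ ≤ K * ENNReal.ofReal (m - p) := by
          have := hK m hmD p hpD
          rw [abs_of_nonneg (by linarith [hlt p hpF])] at this
          refine le_trans (le_of_eq ?_) this
          exact eLpNorm_norm (fun ω => X m ω - X p ω)
        refine (add_le_add hVn h1).trans_eq ?_
        rw [← mul_add, ← ENNReal.ofReal_add (by linarith [ha p hpD]) (by linarith [hlt p hpF])]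
        congr 2; ring

/-- The oscillation over a bounded set is of the order of its diameter, in probability. The finite
bounds pass to a countable dense subset by monotone convergence, and to `D` by continuity. -/
theorem measure_exists_lt_abs_sub_le {Ω : Type*} [MeasurableSpace Ω] {μ : Measure Ω}
    {X : ℝ → Ω → ℝ} {K : ℝ≥0∞} {D : Set ℝ} {a b : ℝ} (hD : D ⊆ Set.Icc a b)
    (hmeas : ∀ δ ∈ D, AEStronglyMeasurable (X δ) μ)
    (hK : ∀ δ ∈ D, ∀ δ' ∈ D,
      eLpNorm (fun ω => X δ ω - X δ' ω) 2 μ ≤ K * ENNReal.ofReal |δ - δ'|)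
    (hcont : ∀ᵐ ω ∂μ, ContinuousOn (fun δ => X δ ω) D) {δ₀ : ℝ} (hδ₀ : δ₀ ∈ D)
    {t : ℝ} (ht : 0 < t) :
    μ {ω | ∃ δ ∈ D, t < |X δ ω - X δ₀ ω|} ≤
      (K * ENNReal.ofReal (b - a) / ENNReal.ofReal t) ^ 2 := by
  obtain ⟨s, hsD, hsc, hsd⟩ :=
    (TopologicalSpace.IsSeparable.of_separableSpace D).exists_countable_dense_subset
  have hsne : s.Nonempty := by
    rw [← closure_nonempty_iff]; exact ⟨δ₀, hsd hδ₀⟩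
  obtain ⟨u, rfl⟩ := hsc.exists_eq_range hsne
  set E : ℕ → Set Ω := fun m => {ω | ∃ i < m, t < |X (u i) ω - X δ₀ ω|} with hE
  have hmono : Monotone E := by
    intro m n hmn ω ⟨i, hi, h⟩
    exact ⟨i, hi.trans_le hmn, h⟩
  have hEn : ∀ m, μ (E m) ≤ (K * ENNReal.ofReal (b - a) / ENNReal.ofReal t) ^ 2 := by
    intro m
    classical
    set F : Finset ℝ := insert δ₀ ((Finset.range m).image u)
    have hFD : ∀ δ ∈ F, δ ∈ D := by
      intro δ hδ
      rcases Finset.mem_insert.1 hδ with rfl | h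
      · exact hδ₀
      · obtain ⟨i, -, rfl⟩ := Finset.mem_image.1 h
        exact hsD ⟨i, rfl⟩
    obtain ⟨p, hpF, -, V, hVm, hV0, hV, hVn⟩ :=
      exists_increment_majorant (fun δ h => (hD h).1) hmeas hK F hFD ⟨δ₀, by simp [F]⟩
    calc μ (E m) ≤ μ {ω | t < |V ω|} := by
          refine measure_mono ?_
          rintro ω ⟨i, hi, h⟩
          refine h.trans_le ((hV ω (u i) ?_ δ₀ (by simp [F])).trans (le_abs_self _))
          exact Finset.mem_insert_of_mem (Finset.mem_image_of_mem u (by simpa using hi))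
      _ ≤ _ := measure_lt_abs_le hVm ht
      _ ≤ _ := by
          gcongr
          refine hVn.trans ?_
          gcongr
          exact (hD (hFD p hpF)).2
  have hU : μ (⋃ m, E m) ≤ (K * ENNReal.ofReal (b - a) / ENNReal.ofReal t) ^ 2 := by
    rw [hmono.measure_iUnion]
    exact iSup_le hEn
  refine (measure_mono_ae ?_).trans hU
  filter_upwards [hcont] with ω hω
  rintro ⟨δ, hδ, hlt⟩
  -- the strict inequality persists at a nearby point of the countable dense set
  have hc : ContinuousWithinAt (fun δ => |X δ ω - X δ₀ ω|) D δ :=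
    ((hω δ hδ).sub continuousWithinAt_const).abs
  have hev := (hc.mono hsD).eventually (lt_mem_nhds hlt)
  have : (𝓝[Set.range u] δ).NeBot := mem_closure_iff_nhdsWithin_neBot.1 (hsd hδ)
  obtain ⟨δ', h1, ⟨i, rfl⟩⟩ := (hev.and self_mem_nhdsWithin).exists
  exact Set.mem_iUnion.2 ⟨i + 1, i, Nat.lt_succ_self i, h1⟩

/-- A process with Lipschitz increments in `L²` that vanishes in probability at every point of a
bounded set vanishes uniformly in probability. -/
theorem tendsto_measure_exists_lt_abs {Ω : Type*} [MeasurableSpace Ω] {μ : Measure Ω}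
    {X : ℕ → ℝ → Ω → ℝ} {K : ℝ≥0∞} (hKtop : K ≠ ∞) {D : Set ℝ} {a b : ℝ} (hab : a < b)
    (hD : D ⊆ Set.Icc a b)
    (hmeas : ∀ n, ∀ δ ∈ D, AEStronglyMeasurable (X n δ) μ)
    (hK : ∀ n, ∀ δ ∈ D, ∀ δ' ∈ D,
      eLpNorm (fun ω => X n δ ω - X n δ' ω) 2 μ ≤ K * ENNReal.ofReal |δ - δ'|)
    (hcont : ∀ n, ∀ᵐ ω ∂μ, ContinuousOn (fun δ => X n δ ω) D)
    (hpt : ∀ δ ∈ D, ∀ t : ℝ, 0 < t → Tendsto (fun n => μ {ω | t < |X n δ ω|}) atTop (𝓝 0))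
    {t : ℝ} (ht : 0 < t) :
    Tendsto (fun n => μ {ω | ∃ δ ∈ D, t < |X n δ ω|}) atTop (𝓝 0) := by
  classical
  rw [ENNReal.tendsto_nhds_zero]
  intro ε hε
  set c : ℝ≥0∞ := (K * ENNReal.ofReal (b - a) / ENNReal.ofReal (t / 2)) ^ 2 with hc
  have hctop : c ≠ ∞ := by
    refine ENNReal.pow_ne_top (ENNReal.div_ne_top (ENNReal.mul_ne_top hKtop (by simp)) ?_)
    simpa using ht
  -- the number `N` of cells makes the total contribution `c / N` of the oscillations small
  obtain ⟨N, hN0, hN⟩ : ∃ N : ℕ, 0 < N ∧ c / N ≤ ε / 2 := by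
    have h1 : Tendsto (fun N : ℕ => c / N) atTop (𝓝 0) := by
      simpa using ENNReal.Tendsto.const_div (a := c) ENNReal.tendsto_nat_nhds_top (Or.inr hctop)
    have h2 := (ENNReal.tendsto_nhds_zero.1 h1 (ε / 2) (by simpa using hε.ne'))
    obtain ⟨N, h, h'⟩ := (h2.and (eventually_gt_atTop 0)).exists
    exact ⟨N, h', h⟩
  have hNpos : (0 : ℝ) < N := by exact_mod_cast hN0
  set h : ℝ := (b - a) / N with hh
  have hhpos : 0 < h := div_pos (by linarith) hNpos
  set C : ℕ → Set ℝ := fun j => D ∩ Set.Icc (a + j * h) (a + (j + 1) * h) with hC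
  have hcover : ∀ δ ∈ D, ∃ j ∈ Finset.range N, δ ∈ C j := by
    intro δ hδ
    have hδ1 := (hD hδ).1
    have hδ2 := (hD hδ).2
    by_cases hlast : δ = b
    · refine ⟨N - 1, by simp; omega, hδ, ?_⟩
      have hcast : ((N - 1 : ℕ) : ℝ) = N - 1 := by
        rw [Nat.cast_sub hN0]; simp
      have hNh : N * h = b - a := by rw [hh]; field_simp
      rw [hcast]
      constructor <;> nlinarith
    · have hlt : δ < b := lt_of_le_of_ne hδ2 hlast
      refine ⟨⌊(δ - a) / h⌋₊, ?_, hδ, ?_, ?_⟩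
      · rw [Finset.mem_range, Nat.floor_lt (div_nonneg (by linarith) hhpos.le), div_lt_iff₀ hhpos]
        rw [hh]; field_simp; linarith
      · have := Nat.floor_le (div_nonneg (sub_nonneg.2 hδ1) hhpos.le)
        rw [le_div_iff₀ hhpos] at this
        linarith
      · have := Nat.lt_floor_add_one ((δ - a) / h)
        rw [div_lt_iff₀ hhpos] at this
        linarith
  set J := (Finset.range N).filter fun j => (C j).Nonempty with hJ
  have hJne : ∀ j ∈ J, (C j).Nonempty := fun j hj => (Finset.mem_filter.1 hj).2
  choose! p hp using hJne
  have hbound : ∀ n, μ {ω | ∃ δ ∈ D, t < |X n δ ω|} ≤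
      ∑ j ∈ J, μ {ω | t / 2 < |X n (p j) ω|} + ε / 2 := by
    intro n
    have hsub : {ω | ∃ δ ∈ D, t < |X n δ ω|} ⊆
        (⋃ j ∈ J, {ω | t / 2 < |X n (p j) ω|}) ∪
          ⋃ j ∈ J, {ω | ∃ δ ∈ C j, t / 2 < |X n δ ω - X n (p j) ω|} := by
      rintro ω ⟨δ, hδ, hlt⟩
      obtain ⟨j, hj, hjC⟩ := hcover δ hδ
      have hjJ : j ∈ J := Finset.mem_filter.2 ⟨hj, δ, hjC⟩
      by_cases hcase : t / 2 < |X n (p j) ω|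
      · exact Or.inl (Set.mem_biUnion hjJ hcase)
      · refine Or.inr (Set.mem_biUnion hjJ ⟨δ, hjC, ?_⟩)
        have := abs_sub_abs_le_abs_sub (X n δ ω) (X n (p j) ω)
        linarith
    refine (measure_mono hsub).trans ((measure_union_le _ _).trans ?_)
    refine add_le_add (measure_biUnion_finset_le _ _) ?_
    refine (measure_biUnion_finset_le _ _).trans ?_
    have hcell : ∀ j ∈ J, μ {ω | ∃ δ ∈ C j, t / 2 < |X n δ ω - X n (p j) ω|} ≤ c / N ^ 2 := by
      intro j hj
      have hCD : C j ⊆ D := Set.inter_subset_left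
      refine (measure_exists_lt_abs_sub_le (a := a + j * h) (b := a + (j + 1) * h) (K := K)
        Set.inter_subset_right (fun δ hδ => hmeas n δ (hCD hδ))
        (fun δ hδ δ' hδ' => hK n δ (hCD hδ) δ' (hCD hδ'))
        ((hcont n).mono fun ω hω => hω.mono hCD) (hp j hj) (half_pos ht)).trans_eq ?_
      have : a + (j + 1) * h - (a + j * h) = (b - a) / N := by rw [hh]; ring
      rw [this, hc, ENNReal.ofReal_div_of_pos hNpos, ENNReal.ofReal_natCast]
      simp only [div_eq_mul_inv, mul_pow, ENNReal.inv_pow]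
      ring
    refine (Finset.sum_le_sum hcell).trans ?_
    rw [Finset.sum_const, nsmul_eq_mul]
    have hcard : (J.card : ℝ≥0∞) ≤ N := by
      exact_mod_cast (Finset.card_filter_le _ _).trans (by simp)
    calc (J.card : ℝ≥0∞) * (c / N ^ 2) ≤ N * (c / N ^ 2) := by gcongr
      _ = c / N := by
          have h1 : (N : ℝ≥0∞) ≠ 0 := by simpa using hN0.ne'
          have h2 : (N : ℝ≥0∞) ≠ ∞ := ENNReal.natCast_ne_top N
          rw [sq, ← mul_div_assoc, ENNReal.mul_div_mul_left _ _ h1 h2]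
      _ ≤ ε / 2 := hN
  have hsum : Tendsto (fun n => ∑ j ∈ J, μ {ω | t / 2 < |X n (p j) ω|}) atTop (𝓝 0) := by
    rw [show (0 : ℝ≥0∞) = ∑ j ∈ J, 0 by simp]
    exact tendsto_finsetSum _ fun j hj => hpt (p j) (hp j hj).1 _ (half_pos ht)
  filter_upwards [ENNReal.tendsto_nhds_zero.1 hsum (ε / 2) (by simpa using hε.ne')] with n hn
  exact (hbound n).trans ((add_le_add hn le_rfl).trans_eq (ENNReal.add_halves ε))

/-! ### The empirical process -/

/-- The empirical process `√n (ℙ_n - P) f`. -/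
def empProc {d : ℕ} {Ω : Type*} (P : Measure (Obs d)) (O : ℕ → Ω → Obs d) (n : ℕ) (ω : Ω)
    (f : Obs d → ℝ) : ℝ :=
  Real.sqrt n * (empMean O n ω f - ∫ o, f o ∂P)

theorem empMean_sub {d : ℕ} {Ω : Type*} (O : ℕ → Ω → Obs d) (n : ℕ) (ω : Ω) (f g : Obs d → ℝ) :
    empMean O n ω (fun o => f o - g o) = empMean O n ω f - empMean O n ω g := by
  simp only [empMean, Finset.sum_sub_distrib, mul_sub]

theorem empMean_add {d : ℕ} {Ω : Type*} (O : ℕ → Ω → Obs d) (n : ℕ) (ω : Ω) (f g : Obs d → ℝ) :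
    empMean O n ω (fun o => f o + g o) = empMean O n ω f + empMean O n ω g := by
  simp only [empMean, Finset.sum_add_distrib, mul_add]

theorem empMean_const_mul {d : ℕ} {Ω : Type*} (O : ℕ → Ω → Obs d) (n : ℕ) (ω : Ω) (c : ℝ)
    (f : Obs d → ℝ) : empMean O n ω (fun o => c * f o) = c * empMean O n ω f := by
  simp only [empMean, ← Finset.mul_sum]; ring

theorem empProc_sub {d : ℕ} {Ω : Type*} {P : Measure (Obs d)} (O : ℕ → Ω → Obs d) (n : ℕ) (ω : Ω)
    {f g : Obs d → ℝ} (hf : Integrable f P) (hg : Integrable g P) :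
    empProc P O n ω (fun o => f o - g o) = empProc P O n ω f - empProc P O n ω g := by
  simp only [empProc, empMean_sub, integral_sub hf hg]; ring

theorem abs_empMean_sub_le {d : ℕ} {Ω : Type*} (O : ℕ → Ω → Obs d) (n : ℕ) (ω : Ω)
    {f g L : Obs d → ℝ} {c : ℝ} (h : ∀ i < n, |f (O i ω) - g (O i ω)| ≤ L (O i ω) * c) :
    |empMean O n ω f - empMean O n ω g| ≤ empMean O n ω L * c := by
  rw [← empMean_sub, empMean, empMean, abs_mul, abs_of_nonneg (by positivity), mul_assoc,
    Finset.sum_mul]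
  gcongr
  refine (Finset.abs_sum_le_sum_abs _ _).trans (Finset.sum_le_sum fun i hi => ?_)
  exact h i (Finset.mem_range.1 hi)

theorem empMean_eq_fin {d : ℕ} {Ω : Type*} (O : ℕ → Ω → Obs d) (n : ℕ) (ω : Ω) (f : Obs d → ℝ) :
    empMean O n ω f = (n : ℝ)⁻¹ * ∑ i : Fin n, f (O i ω) := by
  rw [empMean, Finset.sum_range]

/-- A property of almost all pairs of a separate sample and a fresh observation holds almost surely
at every observation of the main sample. -/
theorem ae_forall_sample {d : ℕ} {Ω : Type*} [MeasurableSpace Ω] {μ : Measure Ω}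
    [IsProbabilityMeasure μ] {P : Measure (Obs d)} {O : ℕ → Ω → Obs d}
    (hOmeas : ∀ i, Measurable (O i)) (hOlaw : ∀ i, μ.map (O i) = P) (n : ℕ)
    {T' : Type*} [MeasurableSpace T'] {S' : Ω → T'}
    (hS : Measurable S') (hSO : IndepFun S' (fun ω (i : Fin n) => O i ω) μ)
    {p : T' × Obs d → Prop} (hp : ∀ᵐ so ∂((μ.map S').prod P), p so) :
    ∀ᵐ ω ∂μ, ∀ i < n, p (S' ω, O i ω) := by
  rw [ae_all_iff]
  intro i
  by_cases hi : i < n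
  swap
  · exact ae_of_all _ fun ω h => absurd h hi
  have hind : IndepFun S' (O i) μ :=
    hSO.comp (φ := id) (ψ := fun w : Fin n → Obs d => w ⟨i, hi⟩) measurable_id
      (measurable_pi_apply _)
  have h1 := (indepFun_iff_map_prod_eq_prod_map_map hS.aemeasurable
    (hOmeas i).aemeasurable).1 hind
  rw [hOlaw i] at h1
  rw [← h1] at hp
  exact (ae_of_ae_map (hS.prodMk (hOmeas i)).aemeasurable hp).mono fun ω h _ => h

section Sample

variable {d : ℕ} {Ω : Type*} [MeasurableSpace Ω] {μ : Measure Ω} [IsProbabilityMeasure μ]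
  {P : Measure (Obs d)} [IsProbabilityMeasure P] {O : ℕ → Ω → Obs d}

/-- The second moment of the empirical process at a fixed function is its variance. -/
theorem lintegral_empProc_sq_le (hOmeas : ∀ i, Measurable (O i)) (hOindep : iIndepFun O μ)
    (hOlaw : ∀ i, μ.map (O i) = P) (n : ℕ) {g : Obs d → ℝ} (hg : Measurable g) :
    ∫⁻ ω, ‖empProc P O n ω g‖ₑ ^ 2 ∂μ ≤ ∫⁻ o, ‖g o‖ₑ ^ 2 ∂P := by
  by_cases hL2 : MemLp g 2 P
  swap
  · have : ∫⁻ o, ‖g o‖ₑ ^ 2 ∂P = ∞ := by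
      rw [← eLpNorm_two_sq]
      have : eLpNorm g 2 P = ∞ := by
        by_contra h
        exact hL2 ⟨hg.aestronglyMeasurable, lt_top_iff_ne_top.2 h⟩
      simp [this]
    simp [this]
  rcases Nat.eq_zero_or_pos n with rfl | hn
  · simp [empProc]
  have hnpos : (0 : ℝ) < n := by exact_mod_cast hn
  have hgi : ∀ i, MemLp (fun ω => g (O i ω)) 2 μ := fun i => by
    have : MemLp g 2 (μ.map (O i)) := by rw [hOlaw]; exact hL2
    exact this.comp_of_map (hOmeas i).aemeasurable
  have hint : ∀ i, ∫ ω, g (O i ω) ∂μ = ∫ o, g o ∂P := fun i => by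
    rw [← hOlaw i, integral_map (hOmeas i).aemeasurable hg.aestronglyMeasurable]
  have hvar : ∀ i, Var[fun ω => g (O i ω); μ] = Var[g; P] := fun i => by
    rw [← hOlaw i, variance_map (by rw [hOlaw]; exact hg.aemeasurable) (hOmeas i).aemeasurable]
    rfl
  set Sg : Ω → ℝ := ∑ i ∈ Finset.range n, fun ω => g (O i ω) with hSg
  have hSgmem : MemLp Sg 2 μ := memLp_finsetSum' _ fun i _ => hgi i
  have hSint : ∫ ω, Sg ω ∂μ = n * ∫ o, g o ∂P := by
    simp only [hSg, Finset.sum_apply]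
    rw [integral_finsetSum _ fun i _ => (hgi i).integrable (by norm_num)]
    simp [hint]
  have hSvar : Var[Sg; μ] = n * Var[g; P] := by
    rw [hSg, IndepFun.variance_sum (fun i _ => hgi i)]
    · simp [hvar]
    · intro i _ j _ hij
      exact (hOindep.indepFun hij).comp hg hg
  have hrep : ∀ ω, ‖empProc P O n ω g‖ₑ ^ 2 =
      ENNReal.ofReal (n : ℝ)⁻¹ * ENNReal.ofReal ((Sg ω - ∫ x, Sg x ∂μ) ^ 2) := by
    intro ω
    have hs : empProc P O n ω g = Real.sqrt n * ((n : ℝ)⁻¹ * (Sg ω - ∫ x, Sg x ∂μ)) := by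
      rw [hSint]
      simp only [empProc, empMean, hSg, Finset.sum_apply]
      field_simp
    rw [Real.enorm_eq_ofReal_abs, ← ENNReal.ofReal_pow (abs_nonneg _), sq_abs, hs,
      ← ENNReal.ofReal_mul (by positivity), mul_pow, Real.sq_sqrt hnpos.le]
    congr 1
    field_simp
  simp only [hrep]
  rw [lintegral_const_mul' _ _ (by simp), ← evariance_eq_lintegral_ofReal,
    ← ofReal_variance hSgmem, hSvar, ← ENNReal.ofReal_mul (by positivity),
    inv_mul_cancel_left₀ hnpos.ne', ← eLpNorm_two_sq, ofReal_variance hL2,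
    evariance_eq_lintegral_ofReal]
  have hv : ENNReal.ofReal Var[g; P] ≤ eLpNorm g 2 P ^ 2 := by
    refine (ENNReal.ofReal_le_ofReal
      (variance_le_expectation_sq hg.aestronglyMeasurable)).trans_eq ?_
    rw [eLpNorm_two_sq, ofReal_integral_eq_lintegral_ofReal]
    · refine lintegral_congr fun o => ?_
      rw [Real.enorm_eq_ofReal_abs, ← ENNReal.ofReal_pow (abs_nonneg _), sq_abs]; rfl
    · exact hL2.integrable_sq
    · exact ae_of_all _ fun o => sq_nonneg _
  rwa [ofReal_variance hL2, evariance_eq_lintegral_ofReal] at hv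

/-- Integration over `W` with the independent variable `S` held fixed. -/
theorem lintegral_indep_eq {T E : Type*} [MeasurableSpace T] [MeasurableSpace E] {S : Ω → T}
    {W : Ω → E} (hS : Measurable S) (hW : Measurable W) (hSW : IndepFun S W μ)
    {F : T × E → ℝ≥0∞} (hF : Measurable F) :
    ∫⁻ ω, F (S ω, W ω) ∂μ = ∫⁻ s, ∫⁻ ω, F (s, W ω) ∂μ ∂(μ.map S) := by
  have h1 := (indepFun_iff_map_prod_eq_prod_map_map hS.aemeasurable hW.aemeasurable).1 hSW
  have : IsProbabilityMeasure (μ.map W) := Measure.isProbabilityMeasure_map hW.aemeasurable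
  rw [← lintegral_map (f := F) (g := fun ω => (S ω, W ω)) hF (hS.prodMk hW), h1,
    lintegral_prod _ hF.aemeasurable]
  refine lintegral_congr fun s => ?_
  exact lintegral_map (f := fun e => F (s, e)) (hF.comp measurable_prodMk_left) hW

/-- Markov's inequality given an independent variable `S`. -/
theorem measure_le_indep_le {T E : Type*} [MeasurableSpace T] [MeasurableSpace E] {S : Ω → T}
    {W : Ω → E} (hS : Measurable S) (hW : Measurable W) (hSW : IndepFun S W μ)
    {F : T × E → ℝ≥0∞} (hF : Measurable F) {c : T → ℝ≥0∞}
    (hc : ∀ s, ∫⁻ ω, F (s, W ω) ∂μ ≤ c s) {t : ℝ≥0∞} (ht : t ≠ 0) (ht' : t ≠ ∞) (κ : ℝ≥0∞) :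
    μ {ω | t ≤ F (S ω, W ω)} ≤ μ {ω | κ < c (S ω)} + κ / t := by
  have : IsProbabilityMeasure (μ.map S) := Measure.isProbabilityMeasure_map hS.aemeasurable
  have hFm : Measurable fun s => ∫⁻ ω, F (s, W ω) ∂μ := by
    have : ∀ s, ∫⁻ ω, F (s, W ω) ∂μ = ∫⁻ e, F (s, e) ∂(μ.map W) := fun s =>
      (lintegral_map (hF.comp measurable_prodMk_left) hW).symm
    simp only [this]
    have : IsProbabilityMeasure (μ.map W) := Measure.isProbabilityMeasure_map hW.aemeasurable
    exact hF.lintegral_prod_right'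
  set B : Set T := {s | κ < ∫⁻ ω, F (s, W ω) ∂μ} with hB
  have hBm : MeasurableSet B := measurableSet_lt measurable_const hFm
  have hset : MeasurableSet {p : T × E | t ≤ F p} := measurableSet_le measurable_const hF
  have h1 := lintegral_indep_eq hS hW hSW
    (F := Set.indicator {p : T × E | t ≤ F p} 1) (measurable_one.indicator hset)
  have h2 : ∫⁻ ω, Set.indicator {p : T × E | t ≤ F p} 1 (S ω, W ω) ∂μ
      = μ {ω | t ≤ F (S ω, W ω)} := by
    exact lintegral_indicator_one (hset.preimage (hS.prodMk hW))
  rw [← h2, h1]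
  have h3 : ∀ s, ∫⁻ ω, Set.indicator {p : T × E | t ≤ F p} 1 (s, W ω) ∂μ ≤
      B.indicator 1 s + κ / t := by
    intro s
    have h4 : ∫⁻ ω, Set.indicator {p : T × E | t ≤ F p} 1 (s, W ω) ∂μ =
        μ {ω | t ≤ F (s, W ω)} := by
      exact lintegral_indicator_one (hset.preimage (measurable_const.prodMk hW))
    rw [h4]
    by_cases hs : s ∈ B
    · simp only [Set.indicator_of_mem hs, Pi.one_apply]
      exact prob_le_one.trans le_self_add
    · simp only [Set.indicator_of_notMem hs, zero_add]
      refine (meas_ge_le_lintegral_div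
        (hF.comp (measurable_const.prodMk hW)).aemeasurable ht ht').trans ?_
      gcongr
      exact not_lt.1 hs
  refine (lintegral_mono h3).trans ?_
  rw [lintegral_add_right _ measurable_const, lintegral_indicator_one hBm, lintegral_const,
    measure_univ, mul_one, Measure.map_apply hS hBm]
  gcongr
  intro ω hω
  exact lt_of_lt_of_le hω (hc _)

end Sample

section Uniform

variable {d : ℕ} {Ω : Type*} [MeasurableSpace Ω] {μ : Measure Ω} [IsProbabilityMeasure μ]
  {P : Measure (Obs d)} [IsProbabilityMeasure P] {O : ℕ → Ω → Obs d}
  {T : ℕ → Type*} [∀ n, MeasurableSpace (T n)] {S : (n : ℕ) → Ω → T n}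

/-- If the conditional mean of a nonnegative variable given `S n` is at most `c n`, and `c n`
vanishes in probability, then so does the variable. -/
theorem tendsto_measure_indep {E : ℕ → Type*} [∀ n, MeasurableSpace (E n)]
    {W : (n : ℕ) → Ω → E n} (hS : ∀ n, Measurable (S n)) (hW : ∀ n, Measurable (W n))
    (hSW : ∀ n, IndepFun (S n) (W n) μ) {F : (n : ℕ) → T n × E n → ℝ≥0∞}
    (hF : ∀ n, Measurable (F n)) {c : (n : ℕ) → T n → ℝ≥0∞}
    (hc : ∀ n s, ∫⁻ ω, F n (s, W n ω) ∂μ ≤ c n s)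
    (hc0 : ∀ κ : ℝ≥0∞, 0 < κ → Tendsto (fun n => μ {ω | κ < c n (S n ω)}) atTop (𝓝 0))
    {t : ℝ≥0∞} (ht : t ≠ 0) (ht' : t ≠ ∞) :
    Tendsto (fun n => μ {ω | t ≤ F n (S n ω, W n ω)}) atTop (𝓝 0) := by
  rw [ENNReal.tendsto_nhds_zero]
  intro ε hε
  rcases eq_or_ne ε ∞ with rfl | hεt
  · simp
  have hκ : 0 < ε / 2 * t := ENNReal.mul_pos (by simpa using hε.ne') ht
  filter_upwards [ENNReal.tendsto_nhds_zero.1 (hc0 _ hκ) (ε / 2) (by simpa using hε.ne')]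
    with n hn
  refine (measure_le_indep_le (hS n) (hW n) (hSW n) (hF n) (hc n) ht ht' (ε / 2 * t)).trans ?_
  rw [ENNReal.mul_div_cancel_right ht ht']
  exact (add_le_add hn le_rfl).trans_eq (ENNReal.add_halves ε)

theorem measurable_empProc_param {T' : Type*} [MeasurableSpace T'] (n : ℕ) {g : T' × Obs d → ℝ}
    (hg : Measurable g) : Measurable fun p : T' × (Fin n → Obs d) =>
      Real.sqrt n * ((n : ℝ)⁻¹ * ∑ i, g (p.1, p.2 i) - ∫ o, g (p.1, o) ∂P) := by
  have h1 : Measurable fun s : T' => ∫ o, g (s, o) ∂P :=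
    (hg.stronglyMeasurable.integral_prod_right' (ν := P)).measurable
  have h2 : Measurable fun p : T' × (Fin n → Obs d) => ∑ i, g (p.1, p.2 i) :=
    Finset.measurable_sum _ fun i _ =>
      hg.comp (measurable_fst.prodMk ((measurable_pi_apply i).comp measurable_snd))
  exact ((h2.const_mul _).sub (h1.comp measurable_fst)).const_mul _

theorem measurable_sample (hOmeas : ∀ i, Measurable (O i)) (n : ℕ) :
    Measurable fun ω (i : Fin n) => O i ω :=
  measurable_pi_lambda _ fun i => hOmeas i

/-- The second moment of the empirical process at a function depending on an independent sample: the
variance bound is applied with that sample held fixed. -/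
theorem lintegral_empProc_indep_sq_le (hOmeas : ∀ i, Measurable (O i)) (hOindep : iIndepFun O μ)
    (hOlaw : ∀ i, μ.map (O i) = P) (n : ℕ) {T' : Type*} [MeasurableSpace T'] {S' : Ω → T'}
    (hS : Measurable S') (hSO : IndepFun S' (fun ω (i : Fin n) => O i ω) μ) {g : T' × Obs d → ℝ}
    (hg : Measurable g) :
    ∫⁻ ω, ‖empProc P O n ω (fun o => g (S' ω, o))‖ₑ ^ 2 ∂μ ≤
      ∫⁻ p, ‖g p‖ₑ ^ 2 ∂((μ.map S').prod P) := by
  have hm := ((measurable_empProc_param (P := P) n hg).enorm.pow_const 2)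
  have h := lintegral_indep_eq hS (measurable_sample hOmeas n) hSO hm
  simp only [empProc, empMean_eq_fin]
  rw [h, lintegral_prod _ (hg.enorm.pow_const 2).aemeasurable]
  refine lintegral_mono fun s => ?_
  have := lintegral_empProc_sq_le hOmeas hOindep hOlaw n
    (g := fun o => g (s, o)) (hg.comp measurable_prodMk_left)
  simpa only [empProc, empMean_eq_fin] using this

/-- Uniformity over the tilt for classes that are Lipschitz in the tilt and depend on the
separate sample: pointwise convergence in probability of the empirical process suffices. -/
theorem tendsto_empProc_uniform (hOmeas : ∀ i, Measurable (O i)) (hOindep : iIndepFun O μ)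
    (hOlaw : ∀ i, μ.map (O i) = P) (hS : ∀ n, Measurable (S n))
    (hSO : ∀ n, IndepFun (S n) (fun ω (i : Fin n) => O i ω) μ)
    {D : Set ℝ} {a b : ℝ} (hab : a < b) (hD : D ⊆ Set.Icc a b)
    {h : (n : ℕ) → T n → ℝ → Obs d → ℝ}
    (hmeas : ∀ n, ∀ δ ∈ D, Measurable fun p : T n × Obs d => h n p.1 δ p.2)
    {L : Obs d → ℝ} (hL : MemLp L 2 P)
    (hLip : ∀ n, ∀ᵐ so ∂((μ.map (S n)).prod P), ∀ δ ∈ D, ∀ δ' ∈ D,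
      |h n so.1 δ so.2 - h n so.1 δ' so.2| ≤ L so.2 * |δ - δ'|)
    (hint : ∀ n, ∀ᵐ s ∂(μ.map (S n)), ∀ δ ∈ D, Integrable (h n s δ) P)
    (hpt : ∀ δ ∈ D, ∀ t : ℝ, 0 < t →
      Tendsto (fun n => μ {ω | t < |empProc P O n ω (h n (S n ω) δ)|}) atTop (𝓝 0))
    {t : ℝ} (ht : 0 < t) :
    Tendsto (fun n => μ {ω | ∃ δ ∈ D, t < |empProc P O n ω (h n (S n ω) δ)|}) atTop (𝓝 0) := by
  have hprob : ∀ n, IsProbabilityMeasure (μ.map (S n)) := fun n =>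
    Measure.isProbabilityMeasure_map (hS n).aemeasurable
  refine tendsto_measure_exists_lt_abs (X := fun n δ ω => empProc P O n ω (h n (S n ω) δ))
    (K := eLpNorm L 2 P) hL.2.ne hab hD ?_ ?_ ?_ hpt ht
  · intro n δ hδ
    have := (measurable_empProc_param (P := P) n (hmeas n δ hδ)).comp
      ((hS n).prodMk (measurable_sample hOmeas n))
    simp only [empProc, empMean_eq_fin]
    exact this.aestronglyMeasurable
  · intro n δ hδ δ' hδ'
    rw [← ENNReal.pow_le_pow_left_iff (n := 2) (by norm_num), eLpNorm_two_sq]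
    have hae : ∀ᵐ ω ∂μ, empProc P O n ω (h n (S n ω) δ) - empProc P O n ω (h n (S n ω) δ') =
        empProc P O n ω (fun o => h n (S n ω) δ o - h n (S n ω) δ' o) := by
      filter_upwards [ae_of_ae_map (hS n).aemeasurable (hint n)] with ω hω
      rw [empProc_sub _ _ _ (hω δ hδ) (hω δ' hδ')]
    calc ∫⁻ ω, ‖empProc P O n ω (h n (S n ω) δ) - empProc P O n ω (h n (S n ω) δ')‖ₑ ^ 2 ∂μ
        = ∫⁻ ω, ‖empProc P O n ω (fun o => h n (S n ω) δ o - h n (S n ω) δ' o)‖ₑ ^ 2 ∂μ :=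
          lintegral_congr_ae (hae.mono fun ω hω => by simp only [hω])
      _ ≤ ∫⁻ p, ‖h n p.1 δ p.2 - h n p.1 δ' p.2‖ₑ ^ 2 ∂((μ.map (S n)).prod P) :=
          lintegral_empProc_indep_sq_le hOmeas hOindep hOlaw n (hS n) (hSO n)
            (g := fun p => h n p.1 δ p.2 - h n p.1 δ' p.2) ((hmeas n δ hδ).sub (hmeas n δ' hδ'))
      _ ≤ ∫⁻ p, ‖L p.2‖ₑ ^ 2 * ENNReal.ofReal |δ - δ'| ^ 2 ∂((μ.map (S n)).prod P) := by
          refine lintegral_mono_ae ?_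
          filter_upwards [hLip n] with p hp
          rw [← mul_pow]
          gcongr
          rw [Real.enorm_eq_ofReal_abs, Real.enorm_eq_ofReal_abs,
            ← ENNReal.ofReal_mul (abs_nonneg _)]
          refine ENNReal.ofReal_le_ofReal ((hp δ hδ δ' hδ').trans ?_)
          gcongr
          exact le_abs_self _
      _ = (eLpNorm L 2 P * ENNReal.ofReal |δ - δ'|) ^ 2 := by
          rw [lintegral_mul_const' _ _ (by simp), mul_pow, eLpNorm_two_sq]
          congr 1
          have hLe : AEMeasurable (fun o => ‖L o‖ₑ ^ 2) P := hL.1.enorm.pow_const 2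
          rw [lintegral_prod _ (hLe.comp_snd)]
          simp
  · intro n
    have hLint : Integrable L P := hL.integrable (by norm_num)
    filter_upwards [ae_forall_sample hOmeas hOlaw n (hS n) (hSO n) (hLip n),
      ae_of_ae_map (hS n).aemeasurable (hint n),
      ae_of_ae_map (hS n).aemeasurable (Measure.ae_ae_of_ae_prod (hLip n))] with ω h1 h2 h3
    set c : ℝ := Real.sqrt n * (empMean O n ω (fun o => |L o|) + ∫ o, |L o| ∂P)
    have hc : 0 ≤ c := by
      have : 0 ≤ empMean O n ω (fun o => |L o|) := by
        unfold empMean; positivity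
      positivity
    refine (LipschitzOnWith.of_dist_le_mul (K := c.toNNReal) ?_).continuousOn
    intro δ hδ δ' hδ'
    rw [Real.dist_eq, Real.dist_eq, Real.coe_toNNReal c hc, empProc, empProc, ← mul_sub, abs_mul,
      abs_of_nonneg (Real.sqrt_nonneg _), mul_assoc]
    gcongr
    have hlip1 := abs_empMean_sub_le O n ω (f := h n (S n ω) δ) (g := h n (S n ω) δ')
      (L := fun o => |L o|) (c := |δ - δ'|) fun i hi =>
        (h1 i hi δ hδ δ' hδ').trans (by gcongr; exact le_abs_self _)
    have hlip2 : |∫ o, h n (S n ω) δ o ∂P - ∫ o, h n (S n ω) δ' o ∂P| ≤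
        (∫ o, |L o| ∂P) * |δ - δ'| := by
      rw [← integral_sub (h2 δ hδ) (h2 δ' hδ'), ← integral_mul_const]
      refine norm_integral_le_of_norm_le
        (f := fun o => h n (S n ω) δ o - h n (S n ω) δ' o) (hLint.abs.mul_const |δ - δ'|) ?_
      filter_upwards [h3] with o ho
      exact (ho δ hδ δ' hδ').trans (by gcongr; exact le_abs_self _)
    rw [add_mul]
    have : ∀ x y z w : ℝ, x - y - (z - w) = (x - z) - (y - w) := by intros; ring
    rw [this]
    exact (abs_sub _ _).trans (add_le_add hlip1 hlip2)

end Uniform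

/-! ### Moment bounds under an exponential tilt -/

section TiltedMoments

variable {W : Type*} [MeasurableSpace W] {ν : Measure W}
  {e t s : W → ℝ} {C : ℝ}

theorem enorm_sq_eq_ofReal (r : ℝ) : ‖r‖ₑ ^ 2 = ENNReal.ofReal (r ^ 2) := by
  rw [Real.enorm_eq_ofReal_abs, ← ENNReal.ofReal_pow (abs_nonneg _), sq_abs]

/-- The moment condition excludes the junk value `∫ e = 0` of a non-integrable weight. -/
theorem integrable_and_integral_pos_of_tilt [IsProbabilityMeasure ν] (he : Measurable e)
    (hpos : ∀ w, 0 < e w) (hs : ∀ w, 1 ≤ s w)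
    (hm : ∫⁻ w, ENNReal.ofReal (s w * e w ^ 2) ∂ν ≤ ENNReal.ofReal (C * (∫ w, e w ∂ν) ^ 2)) :
    Integrable e ν ∧ 0 < ∫ w, e w ∂ν := by
  have hL2 : MemLp e 2 ν := by
    refine ⟨he.aestronglyMeasurable, ?_⟩
    have h1 : eLpNorm e 2 ν ^ 2 < ∞ := by
      rw [eLpNorm_two_sq]
      refine lt_of_le_of_lt (lintegral_mono fun w => ?_) (hm.trans_lt ENNReal.ofReal_lt_top)
      rw [enorm_sq_eq_ofReal]
      exact ENNReal.ofReal_le_ofReal (le_mul_of_one_le_left (sq_nonneg _) (hs w))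
    by_contra h
    rw [not_lt, top_le_iff] at h
    simp [h] at h1
  have hi : Integrable e ν := hL2.integrable (by norm_num)
  refine ⟨hi, ?_⟩
  rw [integral_pos_iff_support_of_nonneg (fun w => (hpos w).le) hi]
  have : Function.support e = Set.univ := by
    ext w; simp [(hpos w).ne']
  simp [this]

theorem lintegral_tilt_sq_le {r : W → ℝ} (hr : ∀ w, r w ^ 2 ≤ s w)
    (hA : 0 < ∫ w, e w ∂ν)
    (hm : ∫⁻ w, ENNReal.ofReal (s w * e w ^ 2) ∂ν ≤ ENNReal.ofReal (C * (∫ w, e w ∂ν) ^ 2)) :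
    ∫⁻ w, ‖r w * (e w / ∫ w, e w ∂ν)‖ₑ ^ 2 ∂ν ≤ ENNReal.ofReal C := by
  set A := ∫ w, e w ∂ν
  calc ∫⁻ w, ‖r w * (e w / A)‖ₑ ^ 2 ∂ν
      ≤ ∫⁻ w, ENNReal.ofReal (A ^ 2)⁻¹ * ENNReal.ofReal (s w * e w ^ 2) ∂ν := by
        refine lintegral_mono fun w => ?_
        rw [enorm_sq_eq_ofReal, ← ENNReal.ofReal_mul (by positivity)]
        refine ENNReal.ofReal_le_ofReal ?_
        have := mul_le_mul_of_nonneg_right (hr w) (sq_nonneg (e w))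
        calc (r w * (e w / A)) ^ 2 = (A ^ 2)⁻¹ * (r w ^ 2 * e w ^ 2) := by ring
          _ ≤ _ := by gcongr
    _ = ENNReal.ofReal (A ^ 2)⁻¹ * ∫⁻ w, ENNReal.ofReal (s w * e w ^ 2) ∂ν :=
        lintegral_const_mul' _ _ (by simp)
    _ ≤ ENNReal.ofReal (A ^ 2)⁻¹ * ENNReal.ofReal (C * A ^ 2) := by gcongr
    _ = ENNReal.ofReal C := by
        rw [← ENNReal.ofReal_mul (by positivity)]
        congr 1; field_simp

theorem memLp_two_of_lintegral {r : W → ℝ} (hr : Measurable r) {c : ℝ≥0∞} (hc : c ≠ ∞)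
    (h : ∫⁻ w, ‖r w‖ₑ ^ 2 ∂ν ≤ c) : MemLp r 2 ν := by
  refine ⟨hr.aestronglyMeasurable, ?_⟩
  rw [← eLpNorm_two_sq] at h
  by_contra h'
  rw [not_lt, top_le_iff] at h'
  simp [h'] at h
  exact hc h

theorem sq_integral_le_of_lintegral [IsProbabilityMeasure ν] {r : W → ℝ} (hr : Measurable r)
    (hC : 0 ≤ C) (h : ∫⁻ w, ‖r w‖ₑ ^ 2 ∂ν ≤ ENNReal.ofReal C) : (∫ w, r w ∂ν) ^ 2 ≤ C := by
  have hmem := memLp_two_of_lintegral hr ENNReal.ofReal_ne_top h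
  have h1 := variance_nonneg r ν
  rw [variance_eq_sub hmem] at h1
  have h2 : ∫ w, r w ^ 2 ∂ν ≤ C := by
    rw [← ENNReal.ofReal_le_ofReal_iff hC, ofReal_integral_eq_lintegral_ofReal hmem.integrable_sq
      (ae_of_all _ fun _ => sq_nonneg _)]
    simpa only [enorm_sq_eq_ofReal] using h
  have h3 : ∫ w, (r ^ 2) w ∂ν = ∫ w, r w ^ 2 ∂ν := rfl
  linarith

theorem enorm_sub_sq_le (x y : ℝ) : ‖x - y‖ₑ ^ 2 ≤ 2 * ‖x‖ₑ ^ 2 + 2 * ‖y‖ₑ ^ 2 := by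
  simp only [enorm_sq_eq_ofReal]
  rw [show (2 : ℝ≥0∞) = ENNReal.ofReal 2 by simp, ← ENNReal.ofReal_mul (by norm_num),
    ← ENNReal.ofReal_mul (by norm_num), ← ENNReal.ofReal_add (by positivity) (by positivity)]
  refine ENNReal.ofReal_le_ofReal ?_
  nlinarith [sq_nonneg (x + y)]

/-- What the conditional moment condition yields about one conditional law `ν`: the weight `e`,
normalized, is integrable with mean one, its product with `t` has second moment at most `C`, the
weighted regression `γ` is bounded, and `(t - γ) e` and `1 - e` have bounded second moments. -/
structure TiltBounds (ν : Measure W) (e t : W → ℝ) (C : ℝ) : Prop where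
  pos : 0 < ∫ w, e w ∂ν
  integrable_weight : Integrable (fun w => e w / ∫ w, e w ∂ν) ν
  integral_weight : ∫ w, e w / (∫ w, e w ∂ν) ∂ν = 1
  integrable_mul : Integrable (fun w => t w * (e w / ∫ w, e w ∂ν)) ν
  integral_mul : ∫ w, t w * (e w / ∫ w, e w ∂ν) ∂ν = (∫ w, t w * e w ∂ν) / ∫ w, e w ∂ν
  sq_mul : ∫⁻ w, ‖t w * (e w / ∫ w, e w ∂ν)‖ₑ ^ 2 ∂ν ≤ ENNReal.ofReal C
  sq_reg : ((∫ w, t w * e w ∂ν) / ∫ w, e w ∂ν) ^ 2 ≤ C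
  sq_resid : ∫⁻ w, ‖(t w - (∫ w, t w * e w ∂ν) / ∫ w, e w ∂ν) * (e w / ∫ w, e w ∂ν)‖ₑ ^ 2 ∂ν ≤
    ENNReal.ofReal (2 * C + 2 * C * C)
  sq_one_sub : ∫⁻ w, ‖1 - e w / ∫ w, e w ∂ν‖ₑ ^ 2 ∂ν ≤ ENNReal.ofReal (2 + 2 * C)

theorem tiltBounds [IsProbabilityMeasure ν] (he : Measurable e) (hpos : ∀ w, 0 < e w)
    (hs : ∀ w, 1 ≤ s w) (ht : Measurable t) (hts : ∀ w, t w ^ 2 ≤ s w) (hC : 0 ≤ C)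
    (hm : ∫⁻ w, ENNReal.ofReal (s w * e w ^ 2) ∂ν ≤ ENNReal.ofReal (C * (∫ w, e w ∂ν) ^ 2)) :
    TiltBounds ν e t C := by
  obtain ⟨hi, hA⟩ := integrable_and_integral_pos_of_tilt he hpos hs hm
  have h1 := lintegral_tilt_sq_le (r := fun _ => 1) (by simpa using hs) hA hm
  have h2 := lintegral_tilt_sq_le hts hA hm
  simp only [one_mul] at h1
  set A := ∫ w, e w ∂ν with hAdef
  set g := (∫ w, t w * e w ∂ν) / A with hg
  have hwm : Measurable fun w => e w / A := he.div_const _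
  have hmm : Measurable fun w => t w * (e w / A) := ht.mul hwm
  have hmul : ∫ w, t w * (e w / A) ∂ν = g := by
    simp only [← mul_div_assoc, integral_div, hg]
  have hg2 : g ^ 2 ≤ C := by
    rw [← hmul]; exact sq_integral_le_of_lintegral hmm hC h2
  refine ⟨hA, hi.div_const _, ?_, (memLp_two_of_lintegral hmm ENNReal.ofReal_ne_top h2).integrable
    (by norm_num), hmul, h2, hg2, ?_, ?_⟩
  · rw [integral_div, div_self hA.ne']
  · calc ∫⁻ w, ‖(t w - g) * (e w / A)‖ₑ ^ 2 ∂ν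
        ≤ ∫⁻ w, (2 * ‖t w * (e w / A)‖ₑ ^ 2 + 2 * ‖g * (e w / A)‖ₑ ^ 2) ∂ν := by
          refine lintegral_mono fun w => ?_
          rw [sub_mul]
          exact enorm_sub_sq_le _ _
      _ = 2 * ∫⁻ w, ‖t w * (e w / A)‖ₑ ^ 2 ∂ν + 2 * (‖g‖ₑ ^ 2 * ∫⁻ w, ‖e w / A‖ₑ ^ 2 ∂ν) := by
          rw [lintegral_add_left ((hmm.enorm.pow_const 2).const_mul _),
            lintegral_const_mul' _ _ (by simp), lintegral_const_mul' _ _ (by simp)]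
          simp only [enorm_mul, mul_pow]
          rw [lintegral_const_mul' _ (fun w => ‖e w / A‖ₑ ^ 2) (by simp)]
      _ ≤ 2 * ENNReal.ofReal C + 2 * (ENNReal.ofReal C * ENNReal.ofReal C) := by
          gcongr
          rw [enorm_sq_eq_ofReal]
          exact ENNReal.ofReal_le_ofReal hg2
      _ = _ := by
          rw [show (2 : ℝ≥0∞) = ENNReal.ofReal 2 by simp, ← ENNReal.ofReal_mul hC,
            ← ENNReal.ofReal_mul (by norm_num), ← ENNReal.ofReal_mul (by norm_num),
            ← ENNReal.ofReal_add (by positivity) (by positivity)]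
          congr 1; ring
  · calc ∫⁻ w, ‖1 - e w / A‖ₑ ^ 2 ∂ν
        ≤ ∫⁻ w, (2 * ‖(1 : ℝ)‖ₑ ^ 2 + 2 * ‖e w / A‖ₑ ^ 2) ∂ν :=
          lintegral_mono fun w => enorm_sub_sq_le _ _
      _ = 2 + 2 * ∫⁻ w, ‖e w / A‖ₑ ^ 2 ∂ν := by
          rw [lintegral_add_left measurable_const,
            lintegral_const_mul' _ (fun w => ‖e w / A‖ₑ ^ 2) (by simp)]
          simp
      _ ≤ 2 + 2 * ENNReal.ofReal C := by gcongr
      _ = _ := by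
          rw [show (2 : ℝ≥0∞) = ENNReal.ofReal 2 by simp, ← ENNReal.ofReal_mul (by norm_num),
            ← ENNReal.ofReal_add (by positivity) (by positivity)]

theorem TiltBounds.integral_resid (h : TiltBounds ν e t C) :
    ∫ w, (t w - (∫ w, t w * e w ∂ν) / ∫ w, e w ∂ν) * (e w / ∫ w, e w ∂ν) ∂ν = 0 := by
  simp only [sub_mul]
  rw [integral_sub h.integrable_mul (h.integrable_weight.const_mul _), h.integral_mul,
    integral_const_mul, h.integral_weight, mul_one, sub_self]

theorem TiltBounds.integrable_resid (h : TiltBounds ν e t C) :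
    Integrable (fun w => (t w - (∫ w, t w * e w ∂ν) / ∫ w, e w ∂ν) * (e w / ∫ w, e w ∂ν)) ν := by
  simp only [sub_mul]
  exact h.integrable_mul.sub (h.integrable_weight.const_mul _)

end TiltedMoments

theorem measurable_integral_kernel {𝒳 W : Type*} [MeasurableSpace 𝒳] [MeasurableSpace W]
    {κ : Kernel 𝒳 W} {e : W → ℝ} (he : Measurable e) : Measurable fun x => ∫ w, e w ∂(κ x) :=
  (StronglyMeasurable.integral_kernel (κ := κ) he.stronglyMeasurable).measurable

theorem lintegral_mul_le_eLpNorm_two {𝒳 : Type*} [MeasurableSpace 𝒳] {ρ : Measure 𝒳}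
    {u v : 𝒳 → ℝ} (hu : Measurable u) (hv : Measurable v) :
    ∫⁻ x, ‖u x * v x‖ₑ ∂ρ ≤ eLpNorm u 2 ρ * eLpNorm v 2 ρ := by
  have h := ENNReal.lintegral_mul_le_Lp_mul_Lq ρ (p := 2) (q := 2)
    Real.HolderConjugate.two_two hu.enorm.aemeasurable hv.enorm.aemeasurable
  simp only [enorm_mul]
  refine h.trans_eq ?_
  simp [eLpNorm_eq_lintegral_rpow_enorm_toReal]

section KernelTilt

variable {𝒳 W : Type*} [MeasurableSpace 𝒳] [MeasurableSpace W] {ρ : Measure 𝒳}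
  {κ : Kernel 𝒳 W} {e t : W → ℝ} {C : ℝ}

variable (κ e) in
/-- The normalized weight `e / E (e | X)`. -/
def tiltWeight (p : 𝒳 × W) : ℝ := e p.2 / ∫ w, e w ∂(κ p.1)

variable (κ e t) in
/-- The weighted regression function `E (t e | X) / E (e | X)`. -/
def tiltReg (x : 𝒳) : ℝ := (∫ w, t w * e w ∂(κ x)) / ∫ w, e w ∂(κ x)

variable (κ e t) in
/-- The part of the error `ξ̂ - ξ` that is linear in the errors `u` of the regression and `v` of
the density; it is centered given the covariates. -/
def linErr (u v : 𝒳 → ℝ) (p : 𝒳 × W) : ℝ :=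
  u p.1 * (1 - tiltWeight κ e p) - (t p.2 - tiltReg κ e t p.1) * tiltWeight κ e p * v p.1

variable (κ e) in
/-- The part of the error `ξ̂ - ξ` that is bilinear in the errors `u`, `v`. -/
def prodErr (u v : 𝒳 → ℝ) (p : 𝒳 × W) : ℝ := u p.1 * v p.1 * tiltWeight κ e p

theorem measurable_tiltWeight (he : Measurable e) : Measurable (tiltWeight κ e) :=
  (he.comp measurable_snd).div ((measurable_integral_kernel he).comp measurable_fst)

theorem measurable_tiltReg (he : Measurable e) (ht : Measurable t) :
    Measurable (tiltReg κ e t) :=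
  (measurable_integral_kernel (ht.mul he)).div (measurable_integral_kernel he)

theorem measurable_linErr (he : Measurable e) (ht : Measurable t) {u v : 𝒳 → ℝ}
    (hu : Measurable u) (hv : Measurable v) : Measurable (linErr κ e t u v) :=
  ((hu.comp measurable_fst).mul (measurable_const.sub (measurable_tiltWeight he))).sub
    ((((ht.comp measurable_snd).sub ((measurable_tiltReg he ht).comp measurable_fst)).mul
      (measurable_tiltWeight he)).mul (hv.comp measurable_fst))

theorem measurable_prodErr (he : Measurable e) {u v : 𝒳 → ℝ}
    (hu : Measurable u) (hv : Measurable v) : Measurable (prodErr κ e u v) :=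
  ((hu.comp measurable_fst).mul (hv.comp measurable_fst)).mul (measurable_tiltWeight he)

variable [IsProbabilityMeasure ρ] [IsMarkovKernel κ]

/-- The linear part of the error is small in `L²` when both nuisance errors are. -/
theorem lintegral_linErr_sq_le (he : Measurable e) (ht : Measurable t)
    (hB : ∀ᵐ x ∂ρ, TiltBounds (κ x) e t C) {u v : 𝒳 → ℝ}
    (hu : Measurable u) (hv : Measurable v) :
    ∫⁻ p, ‖linErr κ e t u v p‖ₑ ^ 2 ∂(ρ ⊗ₘ κ) ≤
      2 * ENNReal.ofReal (2 + 2 * C) * eLpNorm u 2 ρ ^ 2 +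
        2 * ENNReal.ofReal (2 * C + 2 * C * C) * eLpNorm v 2 ρ ^ 2 := by
  rw [Measure.lintegral_compProd ((measurable_linErr he ht hu hv).enorm.pow_const 2)]
  have hx : ∀ᵐ x ∂ρ, ∫⁻ w, ‖linErr κ e t u v (x, w)‖ₑ ^ 2 ∂(κ x) ≤
      2 * ENNReal.ofReal (2 + 2 * C) * ‖u x‖ₑ ^ 2 +
        2 * ENNReal.ofReal (2 * C + 2 * C * C) * ‖v x‖ₑ ^ 2 := by
    filter_upwards [hB] with x hx
    have hm : Measurable fun w => 1 - tiltWeight κ e (x, w) :=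
      measurable_const.sub ((measurable_tiltWeight he).comp measurable_prodMk_left)
    calc ∫⁻ w, ‖linErr κ e t u v (x, w)‖ₑ ^ 2 ∂(κ x)
        ≤ ∫⁻ w, (2 * ‖u x‖ₑ ^ 2 * ‖1 - tiltWeight κ e (x, w)‖ₑ ^ 2 + 2 * ‖v x‖ₑ ^ 2 *
            ‖(t w - tiltReg κ e t x) * tiltWeight κ e (x, w)‖ₑ ^ 2) ∂(κ x) := by
          refine lintegral_mono fun w => ?_
          refine (enorm_sub_sq_le _ _).trans_eq ?_
          simp only [enorm_mul, mul_pow]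
          ring
      _ = 2 * ‖u x‖ₑ ^ 2 * ∫⁻ w, ‖1 - tiltWeight κ e (x, w)‖ₑ ^ 2 ∂(κ x) + 2 * ‖v x‖ₑ ^ 2 *
            ∫⁻ w, ‖(t w - tiltReg κ e t x) * tiltWeight κ e (x, w)‖ₑ ^ 2 ∂(κ x) := by
          rw [lintegral_add_left ((hm.enorm.pow_const 2).const_mul _),
            lintegral_const_mul' _ _ (by finiteness), lintegral_const_mul' _ _ (by finiteness)]
      _ ≤ 2 * ‖u x‖ₑ ^ 2 * ENNReal.ofReal (2 + 2 * C) +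
            2 * ‖v x‖ₑ ^ 2 * ENNReal.ofReal (2 * C + 2 * C * C) :=
          add_le_add (mul_le_mul_right hx.sq_one_sub _) (mul_le_mul_right hx.sq_resid _)
      _ = _ := by ring
  refine (lintegral_mono_ae hx).trans_eq ?_
  rw [lintegral_add_left ((hu.enorm.pow_const 2).const_mul _),
    lintegral_const_mul' _ _ (by finiteness), lintegral_const_mul' _ _ (by finiteness),
    eLpNorm_two_sq, eLpNorm_two_sq]

/-- Given the covariates the linear part of the error is centered, because `e / E (e | X)` has
conditional mean one and the weighted residual of the regression has conditional mean zero. -/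
theorem integral_linErr_fiber {x : 𝒳} (hx : TiltBounds (κ x) e t C) (u v : 𝒳 → ℝ) :
    Integrable (fun w => linErr κ e t u v (x, w)) (κ x) ∧
      ∫ w, linErr κ e t u v (x, w) ∂(κ x) = 0 := by
  have h1 : Integrable (fun w => u x * (1 - tiltWeight κ e (x, w))) (κ x) :=
    ((integrable_const 1).sub hx.integrable_weight).const_mul _
  have h2 : Integrable
      (fun w => (t w - tiltReg κ e t x) * tiltWeight κ e (x, w) * v x) (κ x) :=
    hx.integrable_resid.mul_const _
  refine ⟨h1.sub h2, ?_⟩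
  have h3 : ∫ w, (t w - tiltReg κ e t x) * tiltWeight κ e (x, w) ∂(κ x) = 0 :=
    hx.integral_resid
  have h4 : ∫ w, (1 - tiltWeight κ e (x, w)) ∂(κ x) = 0 := by
    have h5 := integral_sub (integrable_const (1 : ℝ)) hx.integrable_weight
    refine h5.trans ?_
    have : ∫ w, tiltWeight κ e (x, w) ∂(κ x) = 1 := hx.integral_weight
    rw [integral_const, probReal_univ, one_smul, sub_eq_zero]
    exact this.symm
  simp only [linErr]
  rw [integral_sub h1 h2, integral_const_mul, integral_mul_const, h3, h4]
  simp

theorem integral_linErr (hB : ∀ᵐ x ∂ρ, TiltBounds (κ x) e t C) {u v : 𝒳 → ℝ}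
    (hi : Integrable (linErr κ e t u v) (ρ ⊗ₘ κ)) :
    ∫ p, linErr κ e t u v p ∂(ρ ⊗ₘ κ) = 0 := by
  rw [Measure.integral_compProd hi]
  rw [integral_eq_zero_of_ae]
  filter_upwards [hB] with x hx
  exact (integral_linErr_fiber hx u v).2

/-- The bilinear part of the error is bounded in `L¹` by the product of the errors: the weight has
conditional mean one, so it drops out. -/
theorem lintegral_prodErr_le (he : Measurable e) (hpos : ∀ w, 0 < e w)
    (hB : ∀ᵐ x ∂ρ, TiltBounds (κ x) e t C) {u v : 𝒳 → ℝ}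
    (hu : Measurable u) (hv : Measurable v) :
    ∫⁻ p, ‖prodErr κ e u v p‖ₑ ∂(ρ ⊗ₘ κ) ≤ eLpNorm u 2 ρ * eLpNorm v 2 ρ := by
  rw [Measure.lintegral_compProd (measurable_prodErr he hu hv).enorm]
  refine le_trans (le_of_eq (lintegral_congr_ae ?_)) (lintegral_mul_le_eLpNorm_two hu hv)
  filter_upwards [hB] with x hx
  simp only [prodErr, enorm_mul (_ * _)]
  rw [lintegral_const_mul' _ _ (by finiteness)]
  have h0 : ∀ w, 0 ≤ tiltWeight κ e (x, w) := fun w => div_nonneg (hpos w).le hx.pos.le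
  have h1 : ∫⁻ w, ‖tiltWeight κ e (x, w)‖ₑ ∂(κ x) = ENNReal.ofReal 1 := by
    rw [← hx.integral_weight, ofReal_integral_eq_lintegral_ofReal hx.integrable_weight
      (ae_of_all _ h0)]
    refine lintegral_congr fun w => ?_
    rw [Real.enorm_eq_ofReal (h0 w)]; rfl
  rw [h1]; simp

/-- The bias is of second order: only the bilinear part of the error contributes to it. -/
theorem ofReal_abs_integral_err_le
    (hB : ∀ᵐ x ∂ρ, TiltBounds (κ x) e t C) {u v : 𝒳 → ℝ}
    (hu : Measurable u) (hv : Measurable v) :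
    ENNReal.ofReal |∫ p, (linErr κ e t u v p + prodErr κ e u v p) ∂(ρ ⊗ₘ κ)| ≤
      eLpNorm u 2 ρ * eLpNorm v 2 ρ := by
  -- the integral of a non-integrable error is zero by convention, and the bound is trivial
  by_cases hi : Integrable (fun p => linErr κ e t u v p + prodErr κ e u v p) (ρ ⊗ₘ κ)
  swap
  · rw [integral_undef hi]; simp
  have h1 : ∫ p, (linErr κ e t u v p + prodErr κ e u v p) ∂(ρ ⊗ₘ κ) = ∫ x, u x * v x ∂ρ := by
    rw [Measure.integral_compProd hi]
    refine integral_congr_ae ?_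
    filter_upwards [hB] with x hx
    have h2 : Integrable (fun w => prodErr κ e u v (x, w)) (κ x) :=
      hx.integrable_weight.const_mul (u x * v x)
    obtain ⟨h3, h4⟩ := integral_linErr_fiber hx u v
    have h5 : ∫ w, tiltWeight κ e (x, w) ∂(κ x) = 1 := hx.integral_weight
    rw [integral_add h3 h2, h4]
    simp only [prodErr]
    rw [integral_const_mul, h5]; ring
  rw [h1, ← Real.enorm_eq_ofReal_abs]
  exact (enorm_integral_le_lintegral_enorm _).trans (lintegral_mul_le_eLpNorm_two hu hv)

end KernelTilt

/-! ### Uniform convergence in probability and tightness -/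

/-- A sequence of events whose outer probability tends to zero. -/
def Vanishing {Ω : Type*} [MeasurableSpace Ω] (μ : Measure Ω) (A : ℕ → Set Ω) : Prop :=
  Tendsto (fun n => μ (A n)) atTop (𝓝 0)

namespace Vanishing

variable {Ω : Type*} [MeasurableSpace Ω] {μ : Measure Ω} {A B : ℕ → Set Ω}

theorem mono_ae (hB : Vanishing μ B) (h : ∀ᶠ n in atTop, ∀ᵐ ω ∂μ, ω ∈ A n → ω ∈ B n) :
    Vanishing μ A :=
  tendsto_of_tendsto_of_tendsto_of_le_of_le' tendsto_const_nhds hB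
    (Eventually.of_forall fun _ => zero_le) (h.mono fun _ hn => measure_mono_ae hn)

theorem mono (hB : Vanishing μ B) (h : ∀ n, A n ⊆ B n) : Vanishing μ A :=
  hB.mono_ae (Eventually.of_forall fun n => ae_of_all _ (h n))

theorem union (hA : Vanishing μ A) (hB : Vanishing μ B) : Vanishing μ fun n => A n ∪ B n := by
  have h : Tendsto (fun n => μ (A n) + μ (B n)) atTop (𝓝 0) := by simpa using Tendsto.add hA hB
  exact tendsto_of_tendsto_of_tendsto_of_le_of_le tendsto_const_nhds h
    (fun _ => zero_le) fun n => measure_union_le _ _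

end Vanishing

section Uniform

variable {d : ℕ} {Ω : Type*} [MeasurableSpace Ω] {μ : Measure Ω} [IsProbabilityMeasure μ]
  {P : Measure (Obs d)} [IsProbabilityMeasure P] {O : ℕ → Ω → Obs d}
  {T : ℕ → Type*} [∀ n, MeasurableSpace (T n)] {S : (n : ℕ) → Ω → T n}

/-- Uniformity over the tilt for scaled empirical means of an error class. The functions `h δ`
need not be integrable, so the empirical process is centered at increments from a fixed tilt. -/
theorem vanishing_empMean_uniform (hOmeas : ∀ i, Measurable (O i)) (hOindep : iIndepFun O μ)
    (hOlaw : ∀ i, μ.map (O i) = P) (hS : ∀ n, Measurable (S n))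
    (hSO : ∀ n, IndepFun (S n) (fun ω (i : Fin n) => O i ω) μ)
    {D : Set ℝ} {a b : ℝ} (hab : a < b) (hD : D ⊆ Set.Icc a b)
    {h : (n : ℕ) → T n → ℝ → Obs d → ℝ}
    (hmeas : ∀ n, ∀ δ ∈ D, Measurable fun p : T n × Obs d => h n p.1 δ p.2)
    {L : Obs d → ℝ} (hL : MemLp L 2 P)
    (hLip : ∀ n, ∀ᵐ so ∂((μ.map (S n)).prod P), ∀ δ ∈ D, ∀ δ' ∈ D,
      |h n so.1 δ so.2 - h n so.1 δ' so.2| ≤ L so.2 * |δ - δ'|)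
    {δ₀ : ℝ} (hδ₀ : δ₀ ∈ D)
    (hpt : ∀ δ ∈ D, ∀ t : ℝ, 0 < t →
      Vanishing μ fun n => {ω | t < |Real.sqrt n * empMean O n ω (h n (S n ω) δ)|})
    (hbias : ∀ t : ℝ, 0 < t → Vanishing μ fun n => {ω | ¬ ∀ δ ∈ D,
      Real.sqrt n * |∫ o, (h n (S n ω) δ o - h n (S n ω) δ₀ o) ∂P| ≤ t})
    {t : ℝ} (ht : 0 < t) :
    Vanishing μ fun n => {ω | ∃ δ ∈ D, t < |Real.sqrt n * empMean O n ω (h n (S n ω) δ)|} := by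
  have hprob : ∀ n, IsProbabilityMeasure (μ.map (S n)) := fun n =>
    Measure.isProbabilityMeasure_map (hS n).aemeasurable
  set k : (n : ℕ) → T n → ℝ → Obs d → ℝ := fun n s δ o => h n s δ o - h n s δ₀ o with hk
  have hrep : ∀ n ω δ, empProc P O n ω (k n (S n ω) δ) =
      Real.sqrt n * empMean O n ω (h n (S n ω) δ) - Real.sqrt n * empMean O n ω (h n (S n ω) δ₀) -
        Real.sqrt n * ∫ o, (h n (S n ω) δ o - h n (S n ω) δ₀ o) ∂P := by
    intro n ω δ
    simp only [empProc, hk, empMean_sub]; ring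
  have habs : ∀ (n : ℕ) ω δ c, Real.sqrt n * |∫ o, (h n (S n ω) δ o - h n (S n ω) δ₀ o) ∂P| ≤ c →
      |Real.sqrt n * ∫ o, (h n (S n ω) δ o - h n (S n ω) δ₀ o) ∂P| ≤ c := by
    intro n ω δ c hc
    rwa [abs_mul, abs_of_nonneg (Real.sqrt_nonneg _)]
  have hunif : ∀ t : ℝ, 0 < t →
      Vanishing μ fun n => {ω | ∃ δ ∈ D, t < |empProc P O n ω (k n (S n ω) δ)|} := by
    intro t ht
    refine tendsto_empProc_uniform hOmeas hOindep hOlaw hS hSO hab hD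
      (fun n δ hδ => (hmeas n δ hδ).sub (hmeas n δ₀ hδ₀)) hL ?_ ?_ ?_ ht
    · intro n
      filter_upwards [hLip n] with so hso δ hδ δ' hδ'
      simpa [hk] using hso δ hδ δ' hδ'
    · intro n
      filter_upwards [Measure.ae_ae_of_ae_prod (hLip n)] with s hs δ hδ
      refine Integrable.mono' ((hL.integrable (by norm_num)).mul_const |δ - δ₀|)
        (((hmeas n δ hδ).comp measurable_prodMk_left).sub
          ((hmeas n δ₀ hδ₀).comp measurable_prodMk_left)).aestronglyMeasurable ?_
      filter_upwards [hs] with o ho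
      exact ho δ hδ δ₀ hδ₀
    · intro δ hδ t ht
      refine (((hpt δ hδ (t / 3) (by linarith)).union (hpt δ₀ hδ₀ (t / 3) (by linarith))).union
        (hbias (t / 3) (by linarith))).mono fun n ω hω => ?_
      by_contra hcon
      simp only [Set.mem_union, Set.mem_ofPred_eq, not_or, not_lt, not_not] at hcon hω
      obtain ⟨⟨h1, h2⟩, h3⟩ := hcon
      rw [hrep] at hω
      have h4 := habs n ω δ _ (h3 δ hδ)
      have h5 := abs_sub (Real.sqrt n * empMean O n ω (h n (S n ω) δ) -
        Real.sqrt n * empMean O n ω (h n (S n ω) δ₀))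
        (Real.sqrt n * ∫ o, (h n (S n ω) δ o - h n (S n ω) δ₀ o) ∂P)
      have h6 := abs_sub (Real.sqrt n * empMean O n ω (h n (S n ω) δ))
        (Real.sqrt n * empMean O n ω (h n (S n ω) δ₀))
      linarith
  refine (((hunif (t / 3) (by linarith)).union (hpt δ₀ hδ₀ (t / 3) (by linarith))).union
        (hbias (t / 3) (by linarith))).mono fun n ω hω => ?_
  by_contra hcon
  simp only [Set.mem_union, Set.mem_ofPred_eq, not_or, not_lt, not_not, not_exists, not_and]
    at hcon hω
  obtain ⟨⟨h1, h2⟩, h3⟩ := hcon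
  obtain ⟨δ, hδ, hlt⟩ := hω
  have h4 := habs n ω δ _ (h3 δ hδ)
  have h5 := h1 δ hδ
  have h6 : Real.sqrt n * empMean O n ω (h n (S n ω) δ) = empProc P O n ω (k n (S n ω) δ) +
      Real.sqrt n * empMean O n ω (h n (S n ω) δ₀) +
      Real.sqrt n * ∫ o, (h n (S n ω) δ o - h n (S n ω) δ₀ o) ∂P := by
    rw [hrep]; ring
  rw [h6] at hlt
  have h7 := abs_add_le (empProc P O n ω (k n (S n ω) δ) +
      Real.sqrt n * empMean O n ω (h n (S n ω) δ₀))
      (Real.sqrt n * ∫ o, (h n (S n ω) δ o - h n (S n ω) δ₀ o) ∂P)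
  have h8 := abs_add_le (empProc P O n ω (k n (S n ω) δ))
      (Real.sqrt n * empMean O n ω (h n (S n ω) δ₀))
  linarith

/-- The empirical process over a fixed Lipschitz class is uniformly bounded in probability. -/
theorem exists_measure_empProc_le (hOmeas : ∀ i, Measurable (O i)) (hOindep : iIndepFun O μ)
    (hOlaw : ∀ i, μ.map (O i) = P) {D : Set ℝ} {a b : ℝ} (hD : D ⊆ Set.Icc a b)
    {f : ℝ → Obs d → ℝ} (hmeas : ∀ δ ∈ D, Measurable (f δ)) (hf : ∀ δ ∈ D, MemLp (f δ) 2 P)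
    {L : Obs d → ℝ} (hL : MemLp L 2 P)
    (hLip : ∀ᵐ o ∂P, ∀ δ ∈ D, ∀ δ' ∈ D, |f δ o - f δ' o| ≤ L o * |δ - δ'|)
    {ε : ℝ≥0∞} (hε : 0 < ε) :
    ∃ B : ℝ, 0 < B ∧ ∀ n, μ {ω | ∃ δ ∈ D, B < |empProc P O n ω (f δ)|} ≤ ε := by
  rcases D.eq_empty_or_nonempty with rfl | ⟨δ₀, hδ₀⟩
  · exact ⟨1, one_pos, fun n => by simp⟩
  have hint : ∀ δ ∈ D, Integrable (f δ) P := fun δ hδ => (hf δ hδ).integrable (by norm_num)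
  have hmeasE : ∀ n, ∀ δ ∈ D, AEStronglyMeasurable (fun ω => empProc P O n ω (f δ)) μ := by
    intro n δ hδ
    have : Measurable fun ω => empProc P O n ω (f δ) := by
      unfold empProc empMean
      exact (((Finset.measurable_sum _ fun i _ => (hmeas δ hδ).comp (hOmeas i)).const_mul
        _).sub_const _).const_mul _
    exact this.aestronglyMeasurable
  set c : ℝ≥0∞ := (eLpNorm L 2 P * ENNReal.ofReal (b - a)) ^ 2 + eLpNorm (f δ₀) 2 P ^ 2 with hc
  have hctop : c ≠ ∞ := by
    have h1 := hL.2.ne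
    have h2 := (hf δ₀ hδ₀).2.ne
    finiteness
  have hbound : ∀ n, ∀ s : ℝ, 0 < s →
      μ {ω | ∃ δ ∈ D, 2 * s < |empProc P O n ω (f δ)|} ≤ c / ENNReal.ofReal s ^ 2 := by
    intro n s hs
    have h1 := measure_exists_lt_abs_sub_le (X := fun δ ω => empProc P O n ω (f δ)) (μ := μ)
      (K := eLpNorm L 2 P) hD (hmeasE n) ?_ ?_ hδ₀ hs
    · have h2 := measure_lt_abs_le (hmeasE n δ₀ hδ₀) hs
      have h3 : eLpNorm (fun ω => empProc P O n ω (f δ₀)) 2 μ ^ 2 ≤ eLpNorm (f δ₀) 2 P ^ 2 := by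
        rw [eLpNorm_two_sq, eLpNorm_two_sq]
        exact lintegral_empProc_sq_le hOmeas hOindep hOlaw n (hmeas δ₀ hδ₀)
      calc μ {ω | ∃ δ ∈ D, 2 * s < |empProc P O n ω (f δ)|}
          ≤ μ ({ω | ∃ δ ∈ D, s < |empProc P O n ω (f δ) - empProc P O n ω (f δ₀)|} ∪
              {ω | s < |empProc P O n ω (f δ₀)|}) := by
            refine measure_mono ?_
            rintro ω ⟨δ, hδ, hlt⟩
            by_cases hcase : s < |empProc P O n ω (f δ₀)|
            · exact Or.inr hcase
            · refine Or.inl ⟨δ, hδ, ?_⟩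
              have := abs_sub_abs_le_abs_sub (empProc P O n ω (f δ)) (empProc P O n ω (f δ₀))
              linarith
        _ ≤ _ := measure_union_le _ _
        _ ≤ _ := add_le_add h1 h2
        _ ≤ c / ENNReal.ofReal s ^ 2 := by
            simp only [div_eq_mul_inv, mul_pow, ← ENNReal.inv_pow, hc]
            rw [add_mul]
            gcongr
    · intro δ hδ δ' hδ'
      rw [← ENNReal.pow_le_pow_left_iff (n := 2) (by norm_num), eLpNorm_two_sq]
      simp only [← empProc_sub O n _ (hint δ hδ) (hint δ' hδ')]
      refine (lintegral_empProc_sq_le hOmeas hOindep hOlaw n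
        ((hmeas δ hδ).sub (hmeas δ' hδ'))).trans ?_
      rw [mul_pow, eLpNorm_two_sq, ← lintegral_mul_const' _ _ (by simp)]
      refine lintegral_mono_ae ?_
      filter_upwards [hLip] with o ho
      rw [← mul_pow]
      gcongr
      rw [Real.enorm_eq_ofReal_abs, Real.enorm_eq_ofReal_abs, ← ENNReal.ofReal_mul (abs_nonneg _)]
      refine ENNReal.ofReal_le_ofReal ((ho δ hδ δ' hδ').trans ?_)
      gcongr
      exact le_abs_self _
    · have h1 : ∀ i, ∀ᵐ ω ∂μ, ∀ δ ∈ D, ∀ δ' ∈ D,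
          |f δ (O i ω) - f δ' (O i ω)| ≤ L (O i ω) * |δ - δ'| := fun i => by
        have := hLip
        rw [← hOlaw i] at this
        exact ae_of_ae_map (hOmeas i).aemeasurable this
      have hcontI : ContinuousOn (fun δ => ∫ o, f δ o ∂P) D := by
        refine (LipschitzOnWith.of_dist_le_mul (K := (∫ o, |L o| ∂P).toNNReal) ?_).continuousOn
        intro δ hδ δ' hδ'
        rw [Real.dist_eq, Real.dist_eq, Real.coe_toNNReal _ (by positivity),
          ← integral_sub (hint δ hδ) (hint δ' hδ'), ← integral_mul_const]
        refine norm_integral_le_of_norm_le (f := fun o => f δ o - f δ' o)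
          ((hL.integrable (by norm_num)).abs.mul_const |δ - δ'|) ?_
        filter_upwards [hLip] with o ho
        exact (ho δ hδ δ' hδ').trans (by gcongr; exact le_abs_self _)
      filter_upwards [ae_all_iff.2 h1] with ω hω
      unfold empProc empMean
      refine ((continuousOn_const.mul (continuousOn_finsetSum _ fun i _ => ?_)).sub
        hcontI).const_smul (Real.sqrt n)
      refine (LipschitzOnWith.of_dist_le_mul (K := |L (O i ω)|.toNNReal) ?_).continuousOn
      intro δ hδ δ' hδ'
      rw [Real.dist_eq, Real.dist_eq, Real.coe_toNNReal _ (abs_nonneg _)]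
      exact (hω i δ hδ δ' hδ').trans (by gcongr; exact le_abs_self _)
  -- choose `s` with `c / s ^ 2 ≤ ε`
  have hlim : Tendsto (fun s : ℝ => c / ENNReal.ofReal s ^ 2) atTop (𝓝 0) := by
    have h1 : Tendsto (fun s : ℝ => ENNReal.ofReal (s ^ 2)) atTop (𝓝 ∞) :=
      ENNReal.tendsto_ofReal_atTop.comp (tendsto_pow_atTop (by norm_num))
    have h2 := ENNReal.Tendsto.const_div (a := c) h1 (Or.inr hctop)
    rw [ENNReal.div_top] at h2
    refine h2.congr' ?_
    filter_upwards [eventually_ge_atTop 0] with s hs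
    rw [ENNReal.ofReal_pow hs]
  obtain ⟨s, hs, hs0⟩ :=
    ((ENNReal.tendsto_nhds_zero.1 hlim ε hε).and (eventually_gt_atTop 0)).exists
  exact ⟨2 * s, by positivity, fun n => (hbound n s hs0).trans hs⟩

end Uniform

/-! ### The plug-in contrast at a fixed tilt -/

/-- The weight `exp (δ z)`. -/
def expTilt (δ : ℝ) (w : ℝ × Bool × ℝ) : ℝ := Real.exp (δ * w.1)

theorem measurable_expTilt (δ : ℝ) : Measurable (expTilt δ) :=
  Real.measurable_exp.comp (measurable_fst.const_mul δ)

theorem expTilt_pos (δ : ℝ) (w : ℝ × Bool × ℝ) : 0 < expTilt δ w := Real.exp_pos _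

/-- `Θ (t; δ, 0)` for a variable `t` that is a function of `(Z, A, Y)`, formed with the nuisance
values `α`, `γ`. -/
def contrast {d : ℕ} (t : ℝ × Bool × ℝ → ℝ) (α γ : ℝ → (Fin d → ℝ) → ℝ) (δ : ℝ) (o : Obs d) : ℝ :=
  (t o.2 * (Real.exp (δ * o.2.1) / α δ o.1) +
    γ δ o.1 * (1 - Real.exp (δ * o.2.1) / α δ o.1)) -
  (t o.2 * (Real.exp (0 * o.2.1) / α 0 o.1) +
    γ 0 o.1 * (1 - Real.exp (0 * o.2.1) / α 0 o.1))

section Contrast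

variable {d : ℕ} {κ : Kernel (Fin d → ℝ) (ℝ × Bool × ℝ)} {t : ℝ × Bool × ℝ → ℝ}

variable (κ) in
/-- `E (exp (δ Z) | X)`. -/
def trueα (δ : ℝ) (x : Fin d → ℝ) : ℝ := ∫ w, expTilt δ w ∂(κ x)

variable (κ t) in
/-- `E (t exp (δ Z) | X) / E (exp (δ Z) | X)`. -/
def trueγ (δ : ℝ) (x : Fin d → ℝ) : ℝ := tiltReg κ (expTilt δ) t x

theorem trueα_zero [IsMarkovKernel κ] (x : Fin d → ℝ) : trueα κ 0 x = 1 := by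
  simp [trueα, expTilt]

theorem contrast_eq {α γ : ℝ → (Fin d → ℝ) → ℝ} (hα : ∀ x, α 0 x = 1) (δ : ℝ) (o : Obs d) :
    contrast t α γ δ o = t o.2 * (expTilt δ o.2 / α δ o.1) +
      γ δ o.1 * (1 - expTilt δ o.2 / α δ o.1) - t o.2 := by
  simp [contrast, hα, expTilt]

/-- The error of the plug-in contrast, split into its linear and bilinear parts. A vanishing
`α̂` is allowed: then `1 / α̂ = 0` and the relative error is `1`. -/
theorem contrast_sub_eq [IsMarkovKernel κ] {α γ : ℝ → (Fin d → ℝ) → ℝ} (hα : ∀ x, α 0 x = 1)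
    {δ : ℝ} {o : Obs d} (hpos : 0 < trueα κ δ o.1) :
    contrast t α γ δ o - contrast t (trueα κ) (trueγ κ t) δ o =
      linErr κ (expTilt δ) t (fun x => γ δ x - trueγ κ t δ x)
          (fun x => 1 - trueα κ δ x / α δ x) o +
        prodErr κ (expTilt δ) (fun x => γ δ x - trueγ κ t δ x)
          (fun x => 1 - trueα κ δ x / α δ x) o := by
  rw [contrast_eq hα, contrast_eq trueα_zero]
  have h1 : expTilt δ o.2 / α δ o.1 =
      expTilt δ o.2 / trueα κ δ o.1 * (trueα κ δ o.1 / α δ o.1) := by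
    field_simp
  have h2 : tiltWeight κ (expTilt δ) o = expTilt δ o.2 / trueα κ δ o.1 := rfl
  have h3 : tiltReg κ (expTilt δ) t o.1 = trueγ κ t δ o.1 := rfl
  simp only [linErr, prodErr, h2, h3]
  rw [h1]
  ring

theorem measurable_trueα (δ : ℝ) : Measurable (trueα κ δ) :=
  measurable_integral_kernel (measurable_expTilt δ)

theorem measurable_trueγ (ht : Measurable t) (δ : ℝ) : Measurable (trueγ κ t δ) :=
  measurable_tiltReg (measurable_expTilt δ) ht

theorem measurable_contrast {T : Type*} [MeasurableSpace T] (ht : Measurable t)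
    {α γ : T → ℝ → (Fin d → ℝ) → ℝ}
    (hα : ∀ δ, Measurable fun p : T × (Fin d → ℝ) => α p.1 δ p.2)
    (hγ : ∀ δ, Measurable fun p : T × (Fin d → ℝ) => γ p.1 δ p.2) (δ : ℝ) :
    Measurable fun p : T × Obs d => contrast t (α p.1) (γ p.1) δ p.2 := by
  have hpair : Measurable fun p : T × Obs d => (p.1, p.2.1) := by fun_prop
  have hα' : ∀ δ, Measurable fun p : T × Obs d => α p.1 δ p.2.1 := fun δ => (hα δ).comp hpair
  have hγ' : ∀ δ, Measurable fun p : T × Obs d => γ p.1 δ p.2.1 := fun δ => (hγ δ).comp hpair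
  have ht' : Measurable fun p : T × Obs d => t p.2.2 :=
    ht.comp (measurable_snd.comp measurable_snd)
  have hw : ∀ δ, Measurable fun p : T × Obs d => Real.exp (δ * p.2.2.1) / α p.1 δ p.2.1 :=
    fun δ => Measurable.div (by fun_prop) (hα' δ)
  unfold contrast
  exact ((ht'.mul (hw δ)).add ((hγ' δ).mul (measurable_const.sub (hw δ)))).sub
    ((ht'.mul (hw 0)).add ((hγ' 0).mul (measurable_const.sub (hw 0))))

variable {Ω : Type*} [MeasurableSpace Ω] {μ : Measure Ω} [IsProbabilityMeasure μ]
  {O : ℕ → Ω → Obs d} {T : ℕ → Type*} [∀ n, MeasurableSpace (T n)] {S : (n : ℕ) → Ω → T n}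
  {ρ : Measure (Fin d → ℝ)} [IsProbabilityMeasure ρ] [IsMarkovKernel κ]

theorem ofReal_lt_of_lt_mul {a : ℝ≥0∞} {c ε : ℝ} (hc : 0 < c)
    (h : ENNReal.ofReal ε < ENNReal.ofReal c * a) : ENNReal.ofReal (ε / c) < a := by
  rw [ENNReal.ofReal_div_of_pos hc]
  exact ENNReal.div_lt_of_lt_mul' h

theorem lintegral_empMean_enorm_le (hOmeas : ∀ i, Measurable (O i)) {P : Measure (Obs d)}
    (hOlaw : ∀ i, μ.map (O i) = P) (n : ℕ) {f : Obs d → ℝ} (hf : Measurable f) :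
    ∫⁻ ω, ‖empMean O n ω f‖ₑ ∂μ ≤ ∫⁻ o, ‖f o‖ₑ ∂P := by
  rcases Nat.eq_zero_or_pos n with rfl | hn
  · simp [empMean]
  have hi : ∀ i, ∫⁻ ω, ‖f (O i ω)‖ₑ ∂μ = ∫⁻ o, ‖f o‖ₑ ∂P := fun i => by
    rw [← hOlaw i, lintegral_map hf.enorm (hOmeas i)]
  calc ∫⁻ ω, ‖empMean O n ω f‖ₑ ∂μ
      ≤ ∫⁻ ω, ‖(n : ℝ)⁻¹‖ₑ * ∑ i ∈ Finset.range n, ‖f (O i ω)‖ₑ ∂μ := by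
        refine lintegral_mono fun ω => ?_
        rw [empMean, enorm_mul]
        gcongr
        exact enorm_sum_le _ _
    _ = ‖(n : ℝ)⁻¹‖ₑ * (n * ∫⁻ o, ‖f o‖ₑ ∂P) := by
        rw [lintegral_const_mul' _ _ (by finiteness),
          lintegral_finsetSum (f := fun i ω => ‖f (O i ω)‖ₑ) _
            fun i _ => (hf.comp (hOmeas i)).enorm]
        simp [hi]
    _ = ∫⁻ o, ‖f o‖ₑ ∂P := by
        have h1 : ‖(n : ℝ)⁻¹‖ₑ * (n : ℝ≥0∞) = 1 := by
          rw [Real.enorm_eq_ofReal (by positivity), ← ENNReal.ofReal_natCast n,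
            ← ENNReal.ofReal_mul (by positivity), inv_mul_cancel₀ (by positivity)]
          simp
        rw [← mul_assoc, h1, one_mul]

/-- Pointwise in the tilt, the plug-in error is negligible: its linear part by Chebyshev's
inequality and consistency, its bilinear part by Markov's inequality and the product rate. -/
theorem vanishing_contrast (hOmeas : ∀ i, Measurable (O i)) (hOindep : iIndepFun O μ)
    (hOlaw : ∀ i, μ.map (O i) = ρ ⊗ₘ κ) (hS : ∀ n, Measurable (S n))
    (hSO : ∀ n, IndepFun (S n) (fun ω (i : Fin n) => O i ω) μ)
    (ht : Measurable t) {α γ : (n : ℕ) → T n → ℝ → (Fin d → ℝ) → ℝ}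
    (hα : ∀ n δ, Measurable fun p : T n × (Fin d → ℝ) => α n p.1 δ p.2)
    (hγ : ∀ n δ, Measurable fun p : T n × (Fin d → ℝ) => γ n p.1 δ p.2)
    (hα0 : ∀ n s x, α n s 0 x = 1) {δ C : ℝ}
    (hB : ∀ᵐ x ∂ρ, TiltBounds (κ x) (expTilt δ) t C)
    (hcons : ∀ ε : ℝ, 0 < ε → Vanishing μ fun n => {ω | ENNReal.ofReal ε <
      eLpNorm (fun x => γ n (S n ω) δ x - trueγ κ t δ x) 2 ρ +
        eLpNorm (fun x => 1 - trueα κ δ x / α n (S n ω) δ x) 2 ρ})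
    (hrate : ∀ ε : ℝ, 0 < ε → Vanishing μ fun n => {ω | ENNReal.ofReal (ε * (1 / Real.sqrt n)) <
      eLpNorm (fun x => γ n (S n ω) δ x - trueγ κ t δ x) 2 ρ *
        eLpNorm (fun x => 1 - trueα κ δ x / α n (S n ω) δ x) 2 ρ})
    {τ : ℝ} (hτ : 0 < τ) :
    Vanishing μ fun n => {ω | τ < |Real.sqrt n * empMean O n ω (fun o =>
      contrast t (α n (S n ω)) (γ n (S n ω)) δ o - contrast t (trueα κ) (trueγ κ t) δ o)|} := by
  set u : (n : ℕ) → T n → (Fin d → ℝ) → ℝ := fun n s x => γ n s δ x - trueγ κ t δ x with hu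
  set v : (n : ℕ) → T n → (Fin d → ℝ) → ℝ := fun n s x => 1 - trueα κ δ x / α n s δ x with hv
  have hum2 : ∀ n, Measurable fun p : T n × (Fin d → ℝ) => u n p.1 p.2 := fun n =>
    (hγ n δ).sub ((measurable_trueγ ht δ).comp measurable_snd)
  have hvm2 : ∀ n, Measurable fun p : T n × (Fin d → ℝ) => v n p.1 p.2 := fun n =>
    measurable_const.sub (((measurable_trueα δ).comp measurable_snd).div (hα n δ))
  have hum : ∀ n s, Measurable (u n s) := fun n s => (hum2 n).comp measurable_prodMk_left
  have hvm : ∀ n s, Measurable (v n s) := fun n s => (hvm2 n).comp measurable_prodMk_left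
  have hpair : ∀ n, Measurable fun p : T n × Obs d => (p.1, p.2.1) := fun n => by fun_prop
  have he := measurable_expTilt δ
  have hwm : ∀ n, Measurable fun p : T n × Obs d => tiltWeight κ (expTilt δ) p.2 := fun n =>
    (measurable_tiltWeight he).comp measurable_snd
  have hlm : ∀ n, Measurable fun p : T n × Obs d =>
      linErr κ (expTilt δ) t (u n p.1) (v n p.1) p.2 := fun n =>
    (((hum2 n).comp (hpair n)).mul (measurable_const.sub (hwm n))).sub
      ((((ht.comp (measurable_snd.comp measurable_snd)).sub
        ((measurable_tiltReg he ht).comp (measurable_fst.comp measurable_snd))).mul (hwm n)).mul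
          ((hvm2 n).comp (hpair n)))
  have hpm : ∀ n, Measurable fun p : T n × Obs d =>
      prodErr κ (expTilt δ) (u n p.1) (v n p.1) p.2 := fun n =>
    (((hum2 n).comp (hpair n)).mul ((hvm2 n).comp (hpair n))).mul (hwm n)
  have hl0 : ∀ n s, ∫ o, linErr κ (expTilt δ) t (u n s) (v n s) o ∂(ρ ⊗ₘ κ) = 0 := by
    intro n s
    by_cases hi : Integrable (linErr κ (expTilt δ) t (u n s) (v n s)) (ρ ⊗ₘ κ)
    · exact integral_linErr hB hi
    · exact integral_undef hi
  -- the linear part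
  have hlin : Vanishing μ fun n => {ω | ENNReal.ofReal (τ / 2) ^ 2 ≤
      ‖Real.sqrt n * empMean O n ω (linErr κ (expTilt δ) t (u n (S n ω)) (v n (S n ω)))‖ₑ ^ 2} := by
    have h := tendsto_measure_indep (μ := μ) hS (measurable_sample hOmeas) hSO
      (F := fun n p => ‖Real.sqrt n * ((n : ℝ)⁻¹ *
        ∑ i, linErr κ (expTilt δ) t (u n p.1) (v n p.1) (p.2 i) -
          ∫ o, linErr κ (expTilt δ) t (u n p.1) (v n p.1) o ∂(ρ ⊗ₘ κ))‖ₑ ^ 2)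
      (fun n => ((measurable_empProc_param n (hlm n)).enorm.pow_const 2))
      (c := fun n s => 2 * ENNReal.ofReal (2 + 2 * C) * eLpNorm (u n s) 2 ρ ^ 2 +
        2 * ENNReal.ofReal (2 * C + 2 * C * C) * eLpNorm (v n s) 2 ρ ^ 2) ?_ ?_
      (t := ENNReal.ofReal (τ / 2) ^ 2) (by simpa using hτ) (by finiteness)
    · refine Vanishing.mono h fun n ω hω => ?_
      simp only [Set.mem_ofPred_eq] at hω ⊢
      rw [hl0, sub_zero, ← empMean_eq_fin]
      exact hω
    · intro n s
      simp only [← empMean_eq_fin]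
      exact (lintegral_empProc_sq_le hOmeas hOindep hOlaw n
        ((hlm n).comp measurable_prodMk_left)).trans
        (lintegral_linErr_sq_le he ht hB (hum n s) (hvm n s))
    · intro η hη
      set c := 2 * ENNReal.ofReal (2 + 2 * C) + 2 * ENNReal.ofReal (2 * C + 2 * C * C) with hc
      have hctop : c ≠ ∞ := by finiteness
      -- a radius `ε` at which the bound of the second moment is below `η`
      obtain ⟨ε, hε, hεη⟩ : ∃ ε : ℝ, 0 < ε ∧ c * ENNReal.ofReal ε ^ 2 ≤ η := by
        have h1 : Tendsto (fun ε : ℝ => c * ENNReal.ofReal ε ^ 2) (𝓝[>] 0) (𝓝 0) := by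
          have h2 : Tendsto (fun ε : ℝ => ENNReal.ofReal ε ^ 2) (𝓝[>] 0) (𝓝 0) := by
            have : Tendsto (fun ε : ℝ => ENNReal.ofReal ε ^ 2) (𝓝 0)
                (𝓝 (ENNReal.ofReal 0 ^ 2)) :=
              ENNReal.Tendsto.pow ((ENNReal.continuous_ofReal).tendsto 0)
            simp only [ENNReal.ofReal_zero, ne_eq, OfNat.ofNat_ne_zero, not_false_eq_true,
              zero_pow] at this
            exact this.mono_left nhdsWithin_le_nhds
          simpa using ENNReal.Tendsto.const_mul h2 (Or.inr hctop)
        obtain ⟨ε, h3, h4⟩ :=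
          ((ENNReal.tendsto_nhds_zero.1 h1 η hη).and self_mem_nhdsWithin).exists
        exact ⟨ε, h4, h3⟩
      refine Vanishing.mono (hcons ε hε) fun n ω hω => ?_
      by_contra hcon
      simp only [Set.mem_ofPred_eq, not_lt] at hcon hω
      refine absurd hω (not_lt.2 (le_trans ?_ hεη))
      have h1 : eLpNorm (u n (S n ω)) 2 ρ ≤ ENNReal.ofReal ε := le_self_add.trans hcon
      have h2 : eLpNorm (v n (S n ω)) 2 ρ ≤ ENNReal.ofReal ε := le_add_self.trans hcon
      rw [hc, add_mul]
      gcongr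
  -- the bilinear part
  have hprod : Vanishing μ fun n => {ω | ENNReal.ofReal (τ / 2) ≤
      ‖Real.sqrt n * empMean O n ω (prodErr κ (expTilt δ) (u n (S n ω)) (v n (S n ω)))‖ₑ} := by
    have h := tendsto_measure_indep (μ := μ) hS (measurable_sample hOmeas) hSO
      (F := fun n p => ‖Real.sqrt n * ((n : ℝ)⁻¹ *
        ∑ i, prodErr κ (expTilt δ) (u n p.1) (v n p.1) (p.2 i))‖ₑ) ?_
      (c := fun n s => ENNReal.ofReal (Real.sqrt n) *
        (eLpNorm (u n s) 2 ρ * eLpNorm (v n s) 2 ρ)) ?_ ?_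
      (t := ENNReal.ofReal (τ / 2)) (by simpa using hτ) (by finiteness)
    · refine Vanishing.mono h fun n ω hω => ?_
      simp only [Set.mem_ofPred_eq] at hω ⊢
      rw [← empMean_eq_fin]
      exact hω
    · intro n
      refine (((Finset.measurable_sum _ fun i _ => ?_).const_mul _).const_mul _).enorm
      exact (hpm n).comp
        (measurable_fst.prodMk ((measurable_pi_apply i).comp measurable_snd))
    · intro n s
      simp only [← empMean_eq_fin, enorm_mul]
      rw [lintegral_const_mul' _ _ (by finiteness), Real.enorm_eq_ofReal (Real.sqrt_nonneg _)]
      gcongr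
      exact (lintegral_empMean_enorm_le hOmeas hOlaw n
        ((hpm n).comp measurable_prodMk_left)).trans
        (lintegral_prodErr_le he (expTilt_pos δ) hB (hum n s) (hvm n s))
    · intro η hη
      obtain ⟨ε, -, hε, hεη⟩ := ENNReal.lt_iff_exists_real_btwn.1 hη
      have hε0 : 0 < ε := by simpa using hε
      refine (hrate ε hε0).mono_ae ?_
      filter_upwards [eventually_gt_atTop 0] with n hn
      refine ae_of_all _ fun ω hω => ?_
      have hsq : 0 < Real.sqrt n := Real.sqrt_pos.2 (by exact_mod_cast hn)
      change ENNReal.ofReal (ε * (1 / Real.sqrt n)) < _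
      rw [mul_one_div]
      exact ofReal_lt_of_lt_mul hsq (hεη.trans hω)
  have hpos : ∀ᵐ ω ∂μ, ∀ i, 0 < trueα κ δ (O i ω).1 := by
    rw [ae_all_iff]
    intro i
    have h1 : ∀ᵐ o ∂(ρ ⊗ₘ κ), 0 < trueα κ δ o.1 := by
      have h2 : ∀ᵐ x ∂((ρ ⊗ₘ κ).map Prod.fst), 0 < trueα κ δ x := by
        change ∀ᵐ x ∂(ρ ⊗ₘ κ).fst, 0 < trueα κ δ x
        rw [Measure.fst_compProd]
        exact hB.mono fun x hx => hx.pos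
      exact ae_of_ae_map measurable_fst.aemeasurable h2
    rw [← hOlaw i] at h1
    exact ae_of_ae_map (hOmeas i).aemeasurable h1
  refine (hlin.union hprod).mono_ae (Eventually.of_forall fun n => ?_)
  filter_upwards [hpos] with ω hω hlt
  have hsplit : empMean O n ω (fun o =>
      contrast t (α n (S n ω)) (γ n (S n ω)) δ o - contrast t (trueα κ) (trueγ κ t) δ o) =
      empMean O n ω (linErr κ (expTilt δ) t (u n (S n ω)) (v n (S n ω))) +
        empMean O n ω (prodErr κ (expTilt δ) (u n (S n ω)) (v n (S n ω))) := by
    rw [← empMean_add]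
    unfold empMean
    congr 1
    exact Finset.sum_congr rfl fun i _ => contrast_sub_eq (hα0 n (S n ω)) (hω i)
  rw [hsplit, mul_add] at hlt
  by_contra hcon
  simp only [Set.mem_union, Set.mem_ofPred_eq, not_or, not_le] at hcon
  obtain ⟨h1, h2⟩ := hcon
  rw [ENNReal.pow_lt_pow_left_iff (by norm_num), Real.enorm_eq_ofReal_abs,
    ENNReal.ofReal_lt_ofReal_iff (by linarith)] at h1
  rw [Real.enorm_eq_ofReal_abs, ENNReal.ofReal_lt_ofReal_iff (by linarith)] at h2
  have h3 := abs_add_le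
    (Real.sqrt n * empMean O n ω (linErr κ (expTilt δ) t (u n (S n ω)) (v n (S n ω))))
    (Real.sqrt n * empMean O n ω (prodErr κ (expTilt δ) (u n (S n ω)) (v n (S n ω))))
  linarith

end Contrast

/-! ### The plug-in contrast and the studentized ratio, uniformly in the tilt -/

section ContrastUniform

variable {d : ℕ} {κ : Kernel (Fin d → ℝ) (ℝ × Bool × ℝ)} {t : ℝ × Bool × ℝ → ℝ}
  {ρ : Measure (Fin d → ℝ)} [IsProbabilityMeasure ρ] [IsMarkovKernel κ]

theorem ae_contrast_sub_eq {α γ : ℝ → (Fin d → ℝ) → ℝ} (hα0 : ∀ x, α 0 x = 1) {δ C : ℝ}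
    (hB : ∀ᵐ x ∂ρ, TiltBounds (κ x) (expTilt δ) t C) :
    ∀ᵐ o ∂(ρ ⊗ₘ κ), contrast t α γ δ o - contrast t (trueα κ) (trueγ κ t) δ o =
      linErr κ (expTilt δ) t (fun x => γ δ x - trueγ κ t δ x)
          (fun x => 1 - trueα κ δ x / α δ x) o +
        prodErr κ (expTilt δ) (fun x => γ δ x - trueγ κ t δ x)
          (fun x => 1 - trueα κ δ x / α δ x) o := by
  have h2 : ∀ᵐ x ∂((ρ ⊗ₘ κ).map Prod.fst), 0 < trueα κ δ x := by
    change ∀ᵐ x ∂(ρ ⊗ₘ κ).fst, 0 < trueα κ δ x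
    rw [Measure.fst_compProd]
    exact hB.mono fun x hx => hx.pos
  filter_upwards [ae_of_ae_map measurable_fst.aemeasurable h2] with o ho
  exact contrast_sub_eq hα0 ho

theorem ofReal_abs_integral_contrast_sub_le (ht : Measurable t) {α γ : ℝ → (Fin d → ℝ) → ℝ}
    (hα0 : ∀ x, α 0 x = 1) {δ C : ℝ} (hα : Measurable (α δ)) (hγ : Measurable (γ δ))
    (hB : ∀ᵐ x ∂ρ, TiltBounds (κ x) (expTilt δ) t C) :
    ENNReal.ofReal |∫ o, (contrast t α γ δ o -
        contrast t (trueα κ) (trueγ κ t) δ o) ∂(ρ ⊗ₘ κ)| ≤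
      eLpNorm (fun x => γ δ x - trueγ κ t δ x) 2 ρ *
        eLpNorm (fun x => 1 - trueα κ δ x / α δ x) 2 ρ := by
  rw [integral_congr_ae (ae_contrast_sub_eq hα0 hB)]
  exact ofReal_abs_integral_err_le hB (hγ.sub (measurable_trueγ ht δ))
    (measurable_const.sub ((measurable_trueα δ).div hα))

theorem integrable_contrast_sub (ht : Measurable t) {α γ : ℝ → (Fin d → ℝ) → ℝ}
    (hα0 : ∀ x, α 0 x = 1) {δ C : ℝ} (hα : Measurable (α δ)) (hγ : Measurable (γ δ))
    (hB : ∀ᵐ x ∂ρ, TiltBounds (κ x) (expTilt δ) t C)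
    (hu : eLpNorm (fun x => γ δ x - trueγ κ t δ x) 2 ρ ≠ ∞)
    (hv : eLpNorm (fun x => 1 - trueα κ δ x / α δ x) 2 ρ ≠ ∞) :
    Integrable (fun o => contrast t α γ δ o - contrast t (trueα κ) (trueγ κ t) δ o)
      (ρ ⊗ₘ κ) := by
  have hum : Measurable fun x => γ δ x - trueγ κ t δ x := hγ.sub (measurable_trueγ ht δ)
  have hvm : Measurable fun x => 1 - trueα κ δ x / α δ x :=
    measurable_const.sub ((measurable_trueα δ).div hα)
  have he := measurable_expTilt δ
  refine Integrable.congr ?_ ((ae_contrast_sub_eq hα0 hB).mono fun o ho => ho.symm)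
  refine Integrable.add ?_ ?_
  · exact (memLp_two_of_lintegral (measurable_linErr he ht hum hvm) (by finiteness)
      (lintegral_linErr_sq_le he ht hB hum hvm)).integrable (by norm_num)
  · refine ⟨(measurable_prodErr he hum hvm).aestronglyMeasurable, ?_⟩
    exact (lintegral_prodErr_le he (expTilt_pos δ) hB hum hvm).trans_lt (by finiteness)

variable {Ω : Type*} [MeasurableSpace Ω] {μ : Measure Ω} [IsProbabilityMeasure μ]
  {O : ℕ → Ω → Obs d} {T : ℕ → Type*} [∀ n, MeasurableSpace (T n)] {S : (n : ℕ) → Ω → T n}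

/-- The normalized plug-in error is negligible uniformly over the tilts. -/
theorem vanishing_contrast_uniform (hOmeas : ∀ i, Measurable (O i)) (hOindep : iIndepFun O μ)
    (hOlaw : ∀ i, μ.map (O i) = ρ ⊗ₘ κ) (hS : ∀ n, Measurable (S n))
    (hSO : ∀ n, IndepFun (S n) (fun ω (i : Fin n) => O i ω) μ)
    (ht : Measurable t) {α γ : (n : ℕ) → T n → ℝ → (Fin d → ℝ) → ℝ}
    (hα : ∀ n δ, Measurable fun p : T n × (Fin d → ℝ) => α n p.1 δ p.2)
    (hγ : ∀ n δ, Measurable fun p : T n × (Fin d → ℝ) => γ n p.1 δ p.2)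
    (hα0 : ∀ n s x, α n s 0 x = 1) {D : Set ℝ} {a b : ℝ} (hab : a < b) (hD : D ⊆ Set.Icc a b)
    (hB : ∀ δ ∈ D, ∃ C, ∀ᵐ x ∂ρ, TiltBounds (κ x) (expTilt δ) t C)
    (hcons : ∀ δ ∈ D, ∀ ε : ℝ, 0 < ε → Vanishing μ fun n => {ω | ENNReal.ofReal ε <
      eLpNorm (fun x => γ n (S n ω) δ x - trueγ κ t δ x) 2 ρ +
        eLpNorm (fun x => 1 - trueα κ δ x / α n (S n ω) δ x) 2 ρ})
    (hrate : ∀ ε : ℝ, 0 < ε → Vanishing μ fun n => {ω | ENNReal.ofReal (ε * (1 / Real.sqrt n)) <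
      ⨆ δ ∈ D, eLpNorm (fun x => γ n (S n ω) δ x - trueγ κ t δ x) 2 ρ *
        eLpNorm (fun x => 1 - trueα κ δ x / α n (S n ω) δ x) 2 ρ})
    {c : ℝ → ℝ} {c₀ : ℝ} (hc₀ : 0 < c₀) (hc : ∀ δ ∈ D, c₀ ≤ |c δ|)
    {L : Obs d → ℝ} (hL : MemLp L 2 (ρ ⊗ₘ κ))
    (hLip : ∀ n, ∀ᵐ so ∂((μ.map (S n)).prod (ρ ⊗ₘ κ)), ∀ δ ∈ D, ∀ δ' ∈ D,
      |(contrast t (α n so.1) (γ n so.1) δ so.2 - contrast t (trueα κ) (trueγ κ t) δ so.2) / c δ -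
        (contrast t (α n so.1) (γ n so.1) δ' so.2 -
          contrast t (trueα κ) (trueγ κ t) δ' so.2) / c δ'| ≤ L so.2 * |δ - δ'|)
    {τ : ℝ} (hτ : 0 < τ) :
    Vanishing μ fun n => {ω | ∃ δ ∈ D, τ < |Real.sqrt n * empMean O n ω (fun o =>
      (contrast t (α n (S n ω)) (γ n (S n ω)) δ o -
        contrast t (trueα κ) (trueγ κ t) δ o) / c δ)|} := by
  rcases D.eq_empty_or_nonempty with rfl | ⟨δ₀, hδ₀⟩
  · simp [Vanishing]
  have hprob : ∀ n, IsProbabilityMeasure (μ.map (S n)) := fun n =>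
    Measure.isProbabilityMeasure_map (hS n).aemeasurable
  set h : (n : ℕ) → T n → ℝ → Obs d → ℝ := fun n s δ o =>
    (contrast t (α n s) (γ n s) δ o - contrast t (trueα κ) (trueγ κ t) δ o) / c δ with hh
  have hmeas : ∀ n δ, Measurable fun p : T n × Obs d => h n p.1 δ p.2 := fun n δ =>
    ((measurable_contrast ht (hα n) (hγ n) δ).sub
      (measurable_contrast (T := T n) (α := fun _ => trueα κ) (γ := fun _ => trueγ κ t) ht
        (fun δ => (measurable_trueα δ).comp measurable_snd)
        (fun δ => (measurable_trueγ ht δ).comp measurable_snd) δ)).div_const _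
  have hrate' : ∀ δ ∈ D, ∀ ε : ℝ, 0 < ε →
      Vanishing μ fun n => {ω | ENNReal.ofReal (ε * (1 / Real.sqrt n)) <
        eLpNorm (fun x => γ n (S n ω) δ x - trueγ κ t δ x) 2 ρ *
          eLpNorm (fun x => 1 - trueα κ δ x / α n (S n ω) δ x) 2 ρ} := fun δ hδ ε hε =>
    (hrate ε hε).mono fun n ω hω =>
      lt_of_lt_of_le (b := eLpNorm (fun x => γ n (S n ω) δ x - trueγ κ t δ x) 2 ρ *
        eLpNorm (fun x => 1 - trueα κ δ x / α n (S n ω) δ x) 2 ρ) hω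
        (le_iSup₂_of_le (f := fun δ (_ : δ ∈ D) =>
          eLpNorm (fun x => γ n (S n ω) δ x - trueγ κ t δ x) 2 ρ *
            eLpNorm (fun x => 1 - trueα κ δ x / α n (S n ω) δ x) 2 ρ) δ hδ le_rfl)
  refine vanishing_empMean_uniform hOmeas hOindep hOlaw hS hSO hab hD
    (fun n δ _ => hmeas n δ) hL hLip hδ₀ ?_ ?_ hτ
  · intro δ hδ s hs
    obtain ⟨C, hC⟩ := hB δ hδ
    have hcpos : 0 < |c δ| := hc₀.trans_le (hc δ hδ)
    have h1 := vanishing_contrast hOmeas hOindep hOlaw hS hSO ht hα hγ hα0 hC (hcons δ hδ)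
      (hrate' δ hδ) (mul_pos hs hcpos)
    refine h1.mono fun n ω hω => ?_
    simp only [Set.mem_ofPred_eq, hh] at hω ⊢
    simp only [div_eq_inv_mul, empMean_const_mul] at hω
    rw [mul_left_comm, abs_mul, abs_inv, ← div_eq_inv_mul, lt_div_iff₀ hcpos] at hω
    exact hω
  · intro s hs
    -- with an integrable error at one tilt and the Lipschitz condition, all are integrable
    have hint0 : Vanishing μ fun n => {ω | ¬ Integrable (h n (S n ω) δ₀) (ρ ⊗ₘ κ)} := by
      obtain ⟨C, hC⟩ := hB δ₀ hδ₀
      refine (hcons δ₀ hδ₀ 1 one_pos).mono fun n ω hω => ?_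
      by_contra hcon
      simp only [Set.mem_ofPred_eq, not_lt] at hcon hω
      refine hω (Integrable.div_const (integrable_contrast_sub ht (hα0 n _)
        ((hα n δ₀).comp measurable_prodMk_left) ((hγ n δ₀).comp measurable_prodMk_left) hC
        ?_ ?_) _)
      · exact ((le_self_add.trans hcon).trans_lt ENNReal.ofReal_lt_top).ne
      · exact ((le_add_self.trans hcon).trans_lt ENNReal.ofReal_lt_top).ne
    have hε : 0 < s * c₀ / 2 := by positivity
    refine (hint0.union (hrate _ hε)).mono_ae (Eventually.of_forall fun n => ?_)
    filter_upwards [ae_of_ae_map (hS n).aemeasurable (Measure.ae_ae_of_ae_prod (hLip n))]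
      with ω hlip hω
    by_contra hcon
    simp only [Set.mem_union, Set.mem_ofPred_eq, not_or, not_lt, not_not] at hcon
    obtain ⟨hi0, hsup⟩ := hcon
    refine hω fun δ hδ => ?_
    rcases Nat.eq_zero_or_pos n with rfl | hn
    · simpa using hs.le
    have hsq : 0 < Real.sqrt n := Real.sqrt_pos.2 (by exact_mod_cast hn)
    have hk : Integrable (fun o => h n (S n ω) δ o - h n (S n ω) δ₀ o) (ρ ⊗ₘ κ) := by
      refine Integrable.mono' ((hL.integrable (by norm_num)).mul_const |δ - δ₀|)
        (((hmeas n δ).comp measurable_prodMk_left).sub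
          ((hmeas n δ₀).comp measurable_prodMk_left)).aestronglyMeasurable ?_
      filter_upwards [hlip] with o ho
      exact ho δ hδ δ₀ hδ₀
    have hiδ : Integrable (h n (S n ω) δ) (ρ ⊗ₘ κ) := by
      refine (hk.add hi0).congr (ae_of_all _ fun o => ?_)
      simp
    have hbound : ∀ δ ∈ D, |∫ o, h n (S n ω) δ o ∂(ρ ⊗ₘ κ)| ≤ s / 2 / Real.sqrt n := by
      intro δ hδ
      obtain ⟨C, hC⟩ := hB δ hδ
      have hcpos : 0 < |c δ| := hc₀.trans_le (hc δ hδ)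
      have h1 := ofReal_abs_integral_contrast_sub_le (ρ := ρ) (κ := κ) (α := α n (S n ω))
        (γ := γ n (S n ω)) (δ := δ) ht (hα0 n (S n ω))
        ((hα n δ).comp measurable_prodMk_left) ((hγ n δ).comp measurable_prodMk_left) hC
      have h2 := h1.trans ((le_iSup₂_of_le δ hδ le_rfl).trans hsup)
      rw [ENNReal.ofReal_le_ofReal_iff (by positivity)] at h2
      simp only [hh, integral_div, abs_div]
      rw [div_le_iff₀ hcpos]
      refine h2.trans ?_
      calc s * c₀ / 2 * (1 / Real.sqrt n) = s / 2 / Real.sqrt n * c₀ := by ring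
        _ ≤ _ := by gcongr; exact hc δ hδ
    rw [integral_sub hiδ hi0]
    have h3 := hbound δ hδ
    have h4 := hbound δ₀ hδ₀
    have h5 := abs_sub (∫ o, h n (S n ω) δ o ∂(ρ ⊗ₘ κ)) (∫ o, h n (S n ω) δ₀ o ∂(ρ ⊗ₘ κ))
    calc Real.sqrt n * |∫ o, h n (S n ω) δ o ∂(ρ ⊗ₘ κ) - ∫ o, h n (S n ω) δ₀ o ∂(ρ ⊗ₘ κ)|
        ≤ Real.sqrt n * (s / 2 / Real.sqrt n + s / 2 / Real.sqrt n) := by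
          gcongr; linarith
      _ = s := by field_simp; ring

end ContrastUniform

section Ratio

/-- The deterministic core of the expansion of a studentized ratio estimator: `y` and `x` are
the empirical numerator and denominator, `sh` is the estimate of `σ`, and `G` is the limit
of the linearized error. -/
theorem abs_studentized_sub_le {r x y ψ σ₀ σ sh G Ψ B θ : ℝ} (hΨ : 0 ≤ Ψ) (hB : 0 ≤ B)
    (hσ₀ : 0 < σ₀) (hσ : σ₀ ≤ σ) (hθ0 : 0 ≤ θ) (hθ : θ ≤ 1 / 2) (hx : |x - 1| ≤ θ)
    (hs : |sh / σ - 1| ≤ θ) (hN : |r * (y - ψ * x) - G| ≤ θ * (1 + Ψ))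
    (hG : |G| ≤ B * (1 + Ψ)) :
    |r * (y / x - ψ) / sh - G / σ| ≤ 4 * θ * (1 + Ψ) * (1 + 3 * B) / σ₀ := by
  have hσpos : 0 < σ := hσ₀.trans_le hσ
  obtain ⟨hx1, hx2⟩ := abs_le.1 hx
  obtain ⟨hs1, hs2⟩ := abs_le.1 hs
  have hxpos : 1 / 2 ≤ x := by linarith
  set s := sh / σ with hsdef
  have hspos : 1 / 2 ≤ s := by linarith
  have hsh : sh = s * σ := by rw [hsdef]; field_simp
  set N := r * (y - ψ * x) with hNdef
  have hxs : 1 / 4 ≤ x * s := by nlinarith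
  have hx0 : x ≠ 0 := by linarith
  have hs0 : s ≠ 0 := by linarith
  have heq : r * (y / x - ψ) / sh - G / σ = (N - G * (x * s)) / (x * s) / σ := by
    rw [hsh, hNdef]; field_simp
  have hxs1 : |x * s - 1| ≤ 3 * θ := by
    have : x * s - 1 = x * (s - 1) + (x - 1) := by ring
    rw [this]
    refine (abs_add_le _ _).trans ?_
    rw [abs_mul, abs_of_pos (by linarith : (0 : ℝ) < x)]
    nlinarith [abs_nonneg (s - 1)]
  have hnum : |N - G * (x * s)| ≤ θ * (1 + Ψ) * (1 + 3 * B) := by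
    have : N - G * (x * s) = (N - G) - G * (x * s - 1) := by ring
    rw [this]
    refine (abs_sub _ _).trans ?_
    rw [abs_mul]
    have h1 : |G| * |x * s - 1| ≤ B * (1 + Ψ) * (3 * θ) := by gcongr
    linarith
  rw [heq, abs_div, abs_div, abs_of_pos hσpos, abs_of_pos (by linarith : 0 < x * s)]
  have hM : 0 ≤ θ * (1 + Ψ) * (1 + 3 * B) := by positivity
  calc |N - G * (x * s)| / (x * s) / σ
      ≤ θ * (1 + Ψ) * (1 + 3 * B) / (1 / 4) / σ₀ := by gcongr
    _ = _ := by ring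

variable {d : ℕ} {Ω : Type*} [MeasurableSpace Ω] {μ : Measure Ω} {P : Measure (Obs d)}
  {O : ℕ → Ω → Obs d}

/-- The expansion of a studentized quotient, uniformly over `D`: `fh` and `gh` are estimates of `f`
and `g`, normalized so that `g` has mean one and `f` has mean `ψ`. Off an event of small probability the
errors are below a small `θ` and the limiting processes are bounded, and the deterministic expansion
applies. -/
theorem vanishing_studentized {D : Set ℝ} {f g : ℝ → Obs d → ℝ}
    {fh gh : ℕ → Ω → ℝ → Obs d → ℝ} {ψ σ : ℝ → ℝ} {σhat : ℕ → Ω → ℝ → ℝ} {Ψ σ₀ : ℝ}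
    (hf : ∀ τ : ℝ, 0 < τ → Vanishing μ fun n => {ω | ∃ δ ∈ D, τ < |Real.sqrt n *
      empMean O n ω (fun o => fh n ω δ o - f δ o)|})
    (hg : ∀ τ : ℝ, 0 < τ → Vanishing μ fun n => {ω | ∃ δ ∈ D, τ < |Real.sqrt n *
      empMean O n ω (fun o => gh n ω δ o - g δ o)|})
    (hft : ∀ ε : ℝ≥0∞, 0 < ε → ∃ B : ℝ, 0 < B ∧
      ∀ n, μ {ω | ∃ δ ∈ D, B < |empProc P O n ω (f δ)|} ≤ ε)
    (hgt : ∀ ε : ℝ≥0∞, 0 < ε → ∃ B : ℝ, 0 < B ∧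
      ∀ n, μ {ω | ∃ δ ∈ D, B < |empProc P O n ω (g δ)|} ≤ ε)
    (hfi : ∀ δ ∈ D, Integrable (f δ) P) (hgi : ∀ δ ∈ D, Integrable (g δ) P)
    (hf1 : ∀ δ ∈ D, ∫ o, f δ o ∂P = ψ δ) (hg1 : ∀ δ ∈ D, ∫ o, g δ o ∂P = 1)
    (hψ : ∀ δ ∈ D, |ψ δ| ≤ Ψ) (hσ₀ : 0 < σ₀) (hσ : ∀ δ ∈ D, σ₀ ≤ σ δ)
    (hσhat : ∀ τ : ℝ, 0 < τ → Vanishing μ fun n => {ω | ∃ δ ∈ D, τ < |σhat n ω δ / σ δ - 1|})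
    {τ : ℝ} (hτ : 0 < τ) :
    Vanishing μ fun n => {ω | ∃ δ ∈ D, τ <
      |Real.sqrt n * (empMean O n ω (fh n ω δ) / empMean O n ω (gh n ω δ) - ψ δ) / σhat n ω δ -
        Real.sqrt n * (empMean O n ω (fun o => (f δ o - ψ δ * g δ o) / σ δ) -
          ∫ o, (f δ o - ψ δ * g δ o) / σ δ ∂P)|} := by
  rcases D.eq_empty_or_nonempty with rfl | ⟨δ₀, hδ₀⟩
  · simp [Vanishing]
  have hΨ : 0 ≤ Ψ := (abs_nonneg _).trans (hψ δ₀ hδ₀)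
  rw [Vanishing, ENNReal.tendsto_nhds_zero]
  intro ε hε
  have hε4 : 0 < ε / 2 / 2 := by simpa using hε.ne'
  obtain ⟨B₁, hB₁, hB₁'⟩ := hft _ hε4
  obtain ⟨B₂, hB₂, hB₂'⟩ := hgt _ hε4
  set B := max B₁ B₂ with hBdef
  have hB : 0 < B := lt_max_of_lt_left hB₁
  set c := 4 * (1 + Ψ) * (1 + 3 * B) / σ₀ with hc
  have hcpos : 0 < c := by positivity
  -- the deterministic bound is `c θ`, so this `θ` makes it at most `τ`
  set θ := min (1 / 2) (τ / c) with hθ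
  have hθpos : 0 < θ := by positivity
  have hV := ((hf θ hθpos).union (hg θ hθpos)).union (hσhat θ hθpos)
  -- for such `n` the mean of `gh` is within `θ` of one
  have hlarge : ∀ᶠ n : ℕ in atTop, (θ + B) / θ ≤ Real.sqrt n :=
    (Real.tendsto_sqrt_atTop.comp tendsto_natCast_atTop_atTop).eventually_ge_atTop _
  filter_upwards [ENNReal.tendsto_nhds_zero.1 hV (ε / 2) (by simpa using hε.ne'), hlarge]
    with n hn hsqn
  have hsq : 0 < Real.sqrt n := lt_of_lt_of_le (by positivity) hsqn
  refine (measure_mono (t := ({ω | ∃ δ ∈ D, B₁ < |empProc P O n ω (f δ)|} ∪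
    {ω | ∃ δ ∈ D, B₂ < |empProc P O n ω (g δ)|}) ∪ _) ?_).trans ((measure_union_le _ _).trans
      ((add_le_add ((measure_union_le _ _).trans (add_le_add (hB₁' n) (hB₂' n))) hn).trans_eq ?_))
  swap
  · rw [ENNReal.add_halves, ENNReal.add_halves]
  rintro ω ⟨δ, hδ, hlt⟩
  by_contra hcon
  simp only [Set.mem_union, Set.mem_ofPred_eq, not_or, not_exists, not_and, not_lt] at hcon
  obtain ⟨⟨h1, h2⟩, ⟨h3, h4⟩, h5⟩ := hcon
  replace h1 := h1 δ hδ
  replace h2 := h2 δ hδ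
  replace h3 := h3 δ hδ
  replace h4 := h4 δ hδ
  replace h5 := h5 δ hδ
  set G := empProc P O n ω (f δ) - ψ δ * empProc P O n ω (g δ) with hGdef
  have hGrep : Real.sqrt n * (empMean O n ω (fun o => (f δ o - ψ δ * g δ o) / σ δ) -
      ∫ o, (f δ o - ψ δ * g δ o) / σ δ ∂P) = G / σ δ := by
    have he : empMean O n ω (fun o => (f δ o - ψ δ * g δ o) / σ δ) =
        (σ δ)⁻¹ * (empMean O n ω (f δ) - ψ δ * empMean O n ω (g δ)) := by
      simp only [div_eq_inv_mul, empMean_const_mul, empMean_sub]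
    rw [he, integral_div, integral_sub (hfi δ hδ) ((hgi δ hδ).const_mul _), integral_const_mul,
      hGdef, empProc, empProc]
    ring
  rw [hGrep] at hlt
  rw [empMean_sub] at h3 h4
  have hgB : |empProc P O n ω (g δ)| ≤ B := h2.trans (le_max_right _ _)
  have hfB : |empProc P O n ω (f δ)| ≤ B := h1.trans (le_max_left _ _)
  have hx : |empMean O n ω (gh n ω δ) - 1| ≤ θ := by
    have : Real.sqrt n * (empMean O n ω (gh n ω δ) - 1) =
        Real.sqrt n * (empMean O n ω (gh n ω δ) - empMean O n ω (g δ)) +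
          empProc P O n ω (g δ) := by
      rw [empProc, hg1 δ hδ]; ring
    have h6 : Real.sqrt n * |empMean O n ω (gh n ω δ) - 1| ≤ θ + B := by
      rw [← abs_of_pos hsq, ← abs_mul, this]
      exact (abs_add_le _ _).trans (add_le_add h4 hgB)
    rw [div_le_iff₀ hθpos] at hsqn
    exact le_of_mul_le_mul_left (h6.trans hsqn) hsq
  have hN : |Real.sqrt n * (empMean O n ω (fh n ω δ) - ψ δ * empMean O n ω (gh n ω δ)) - G| ≤
      θ * (1 + Ψ) := by
    have : Real.sqrt n * (empMean O n ω (fh n ω δ) - ψ δ * empMean O n ω (gh n ω δ)) - G =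
        Real.sqrt n * (empMean O n ω (fh n ω δ) - empMean O n ω (f δ)) -
          ψ δ * (Real.sqrt n * (empMean O n ω (gh n ω δ) - empMean O n ω (g δ))) := by
      rw [hGdef, empProc, empProc, hf1 δ hδ, hg1 δ hδ]; ring
    rw [this]
    refine (abs_sub _ _).trans ?_
    rw [abs_mul (ψ δ)]
    have : |ψ δ| * |Real.sqrt n * (empMean O n ω (gh n ω δ) - empMean O n ω (g δ))| ≤ Ψ * θ := by
      gcongr; exact hψ δ hδ
    linarith
  have hG : |G| ≤ B * (1 + Ψ) := by
    refine (abs_sub _ _).trans ?_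
    rw [abs_mul]
    have : |ψ δ| * |empProc P O n ω (g δ)| ≤ Ψ * B := by gcongr; exact hψ δ hδ
    linarith
  have hfin := abs_studentized_sub_le hΨ hB.le hσ₀ (hσ δ hδ) hθpos.le (min_le_left _ _) hx h5 hN hG
  have hle : 4 * θ * (1 + Ψ) * (1 + 3 * B) / σ₀ ≤ τ := by
    have h6 : θ * c ≤ τ := by
      have := min_le_right (1 / 2) (τ / c)
      rwa [← hθ, le_div_iff₀ hcpos] at this
    calc 4 * θ * (1 + Ψ) * (1 + 3 * B) / σ₀ = θ * c := by rw [hc]; ring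
      _ ≤ τ := h6
  linarith

end Ratio

/-! ### The quantile transform of an atomless law to its tilt -/

/-- The quantile function is the lower adjoint of the distribution function. The levels `0` and `1`
are excluded because there the infimum may be a junk value. -/
theorem sInf_cdf_le_iff {Q : Measure ℝ} {p : ℝ} (h0 : 0 < p) (h1 : p < 1) (s : ℝ) :
    sInf {z | p ≤ cdf Q z} ≤ s ↔ p ≤ cdf Q s := by
  have hne : {z | p ≤ cdf Q z}.Nonempty := by
    obtain ⟨z, hz⟩ := ((tendsto_cdf_atTop Q).eventually (lt_mem_nhds h1)).exists
    exact ⟨z, hz.le⟩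
  have hbdd : BddBelow {z | p ≤ cdf Q z} := by
    obtain ⟨z, hz⟩ := ((tendsto_cdf_atBot Q).eventually (gt_mem_nhds h0)).exists
    refine ⟨z, fun w hw => ?_⟩
    by_contra hcon
    exact absurd ((monotone_cdf Q (not_le.1 hcon).le).trans_lt hz) (not_lt.2 hw)
  constructor
  · intro hs
    by_contra hcon
    have hev : ∀ᶠ z in 𝓝[>] s, cdf Q z < p :=
      ((cdf Q).right_continuous s).eventually (gt_mem_nhds (not_le.1 hcon)) |>.filter_mono
        (nhdsWithin_mono _ Set.Ioi_subset_Ici_self)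
    obtain ⟨z, hz, hz'⟩ := (hev.and self_mem_nhdsWithin).exists
    obtain ⟨w, hw, hwz⟩ := exists_lt_of_csInf_lt hne (hs.trans_lt hz')
    exact absurd ((monotone_cdf Q hwz.le).trans_lt hz) (not_lt.2 hw)
  · intro hs
    exact csInf_le hbdd hs

theorem exp_split {ν : Measure ℝ} {δ : ℝ} (hi : Integrable (fun z => Real.exp (δ * z)) ν) (s : ℝ) :
    ∫ z, Real.exp (δ * z) ∂ν = (∫ z in Set.Iic s, Real.exp (δ * z) ∂ν) +
      ∫ z in Set.Ioi s, Real.exp (δ * z) ∂ν := by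
  rw [← Set.compl_Iic, integral_add_compl measurableSet_Iic hi]

section Quantile

variable {ν Q : Measure ℝ} [IsProbabilityMeasure ν]

theorem continuous_cdf [NullSingletonClass ν] : Continuous (cdf ν) := by
  rw [continuous_iff_continuousAt]
  intro a
  rw [(cdf ν).mono.continuousAt_iff_leftLim_eq_rightLim]
  have h1 : (cdf ν).measure {a} = 0 := by rw [measure_cdf]; exact measure_singleton a
  rw [StieltjesFunction.measure_singleton, ENNReal.ofReal_eq_zero] at h1
  have h2 := (cdf ν).mono.leftLim_le (le_refl a)
  rw [StieltjesFunction.rightLim_eq]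
  linarith

/-- The probability integral transform: `F (Z)` is uniform when the law of `Z` is continuous. -/
theorem measure_cdf_le [NullSingletonClass ν] {u : ℝ} (h0 : 0 ≤ u) (h1 : u ≤ 1) :
    ν {z | cdf ν z ≤ u} = ENNReal.ofReal u := by
  have hmid : ∀ u : ℝ, 0 < u → u < 1 → ν {z | cdf ν z ≤ u} = ENNReal.ofReal u := by
    intro u h0 h1
    set A := {z | cdf ν z ≤ u} with hA
    have hcl : IsClosed A := isClosed_le continuous_cdf continuous_const
    have hne : A.Nonempty := by
      obtain ⟨z, hz⟩ := ((tendsto_cdf_atBot ν).eventually (gt_mem_nhds h0)).exists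
      exact ⟨z, hz.le⟩
    have hbdd : BddAbove A := by
      obtain ⟨z, hz⟩ := ((tendsto_cdf_atTop ν).eventually (lt_mem_nhds h1)).exists
      refine ⟨z, fun w hw => ?_⟩
      by_contra hcon
      exact absurd (hz.trans_le (monotone_cdf ν (not_le.1 hcon).le)) (not_lt.2 hw)
    have hb : sSup A ∈ A := hcl.csSup_mem hne hbdd
    have hAeq : A = Set.Iic (sSup A) := by
      ext z
      exact ⟨fun hz => le_csSup hbdd hz, fun hz => (monotone_cdf ν hz).trans hb⟩
    have hFb : cdf ν (sSup A) = u := by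
      refine le_antisymm hb (not_lt.1 fun hlt => ?_)
      have hev : ∀ᶠ z in 𝓝[>] (sSup A), cdf ν z < u :=
        ((continuous_cdf (ν := ν)).continuousAt.eventually (gt_mem_nhds hlt)).filter_mono
          nhdsWithin_le_nhds
      obtain ⟨z, hz, hz'⟩ := (hev.and self_mem_nhdsWithin).exists
      exact absurd (le_csSup hbdd (a := z) hz.le) (not_le.2 hz')
    rw [hAeq, ← ofReal_cdf, hFb]
  rcases h0.eq_or_lt with rfl | h0
  · rw [ENNReal.ofReal_zero]
    refine le_antisymm (ENNReal.le_of_forall_pos_le_add fun ε hε _ => ?_) zero_le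
    have hε' : (0 : ℝ) < min (ε : ℝ) (1 / 2) := lt_min (by exact_mod_cast hε) (by norm_num)
    rw [zero_add]
    calc ν {z | cdf ν z ≤ 0} ≤ ν {z | cdf ν z ≤ min (ε : ℝ) (1 / 2)} :=
          measure_mono fun z hz => le_trans hz hε'.le
      _ = ENNReal.ofReal (min (ε : ℝ) (1 / 2)) :=
          hmid _ hε' ((min_le_right _ _).trans_lt (by norm_num))
      _ ≤ ENNReal.ofReal ε := ENNReal.ofReal_le_ofReal (min_le_left _ _)
      _ = ε := ENNReal.ofReal_coe_nnreal
  · rcases h1.eq_or_lt with rfl | h1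
    · have : {z | cdf ν z ≤ 1} = Set.univ := by ext z; simp [cdf_le_one]
      simp [this]
    · exact hmid u h0 h1

theorem ae_cdf_pos [NullSingletonClass ν] : ∀ᵐ z ∂ν, 0 < cdf ν z := by
  rw [ae_iff]
  simpa only [not_lt, ENNReal.ofReal_zero] using measure_cdf_le (ν := ν) le_rfl zero_le_one

theorem ae_cdf_lt_one [NullSingletonClass ν] : ∀ᵐ z ∂ν, cdf ν z < 1 := by
  rw [ae_iff]
  refine le_antisymm (ENNReal.le_of_forall_pos_le_add fun ε hε _ => ?_) zero_le
  have hε' : (0 : ℝ) < min (ε : ℝ) (1 / 2) := lt_min (by exact_mod_cast hε) (by norm_num)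
  have h2 : min (ε : ℝ) (1 / 2) ≤ 1 / 2 := min_le_right _ _
  have hm : MeasurableSet {z | cdf ν z ≤ 1 - min (ε : ℝ) (1 / 2)} :=
    (isClosed_le continuous_cdf continuous_const).measurableSet
  rw [zero_add]
  calc ν {z | ¬ cdf ν z < 1} ≤ ν {z | cdf ν z ≤ 1 - min (ε : ℝ) (1 / 2)}ᶜ := by
        refine measure_mono fun z hz => ?_
        simp only [Set.mem_compl_iff, Set.mem_ofPred_eq, not_lt, not_le] at hz ⊢
        linarith
    _ = ENNReal.ofReal (min (ε : ℝ) (1 / 2)) := by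
        rw [prob_compl_eq_one_sub hm, measure_cdf_le (by linarith) (by linarith),
          ← ENNReal.ofReal_one, ← ENNReal.ofReal_sub _ (by linarith)]
        congr 1; ring
    _ ≤ ENNReal.ofReal ε := ENNReal.ofReal_le_ofReal (min_le_left _ _)
    _ = ε := ENNReal.ofReal_coe_nnreal

/-- Almost no point lies at the end of a flat piece of the distribution function. -/
theorem ae_forall_cdf_lt [NullSingletonClass ν] : ∀ᵐ z ∂ν, ∀ s < z, cdf ν s < cdf ν z := by
  have hrat : ∀ᵐ z ∂ν, ∀ r : ℚ, (r : ℝ) < z → cdf ν r < cdf ν z := by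
    rw [ae_all_iff]
    intro r
    rw [ae_iff]
    have hsub : {z | ¬ ((r : ℝ) < z → cdf ν r < cdf ν z)} =
        {z | cdf ν z ≤ cdf ν r} \ Set.Iic (r : ℝ) := by
      ext z
      simp only [Set.mem_ofPred_eq, Classical.not_imp, not_lt, Set.mem_sdiff, Set.mem_Iic, not_le]
      exact and_comm
    have hincl : Set.Iic (r : ℝ) ⊆ {z | cdf ν z ≤ cdf ν r} := fun z hz => monotone_cdf ν hz
    rw [hsub, measure_sdiff hincl measurableSet_Iic.nullMeasurableSet
      (measure_ne_top _ _), measure_cdf_le (cdf_nonneg _ _) (cdf_le_one _ _), ofReal_cdf,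
      tsub_self]
  filter_upwards [hrat] with z hz s hs
  obtain ⟨r, hr1, hr2⟩ := exists_rat_btwn hs
  exact (monotone_cdf ν hr1.le).trans_lt (hz r hr2)

/-- The quantile transform of `F (Z)` has law `Q`. -/
theorem measure_quantile_le [IsProbabilityMeasure Q] [NullSingletonClass ν] (s : ℝ) :
    ν {z | sInf {w | cdf ν z ≤ cdf Q w} ≤ s} = Q (Set.Iic s) := by
  rw [← ofReal_cdf, ← measure_cdf_le (ν := ν) (cdf_nonneg Q s) (cdf_le_one Q s)]
  refine measure_congr ?_
  filter_upwards [ae_cdf_pos (ν := ν), ae_cdf_lt_one (ν := ν)] with z h0 h1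
  exact propext (sInf_cdf_le_iff h0 h1 s)

/-- If `Q` is stochastically larger than `ν`, the quantile transform moves almost every point up. -/
theorem ae_le_quantile [NullSingletonClass ν] (hdom : ∀ s, cdf Q s ≤ cdf ν s) :
    ∀ᵐ z ∂ν, z ≤ sInf {w | cdf ν z ≤ cdf Q w} := by
  filter_upwards [ae_cdf_pos (ν := ν), ae_cdf_lt_one (ν := ν), ae_forall_cdf_lt (ν := ν)]
    with z h0 h1 h2
  by_contra hcon
  have h3 := (sInf_cdf_le_iff (Q := Q) h0 h1 _).1 le_rfl
  exact absurd (h3.trans (hdom _)) (not_le.2 (h2 _ (not_le.1 hcon)))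

/-- If `Q` is stochastically smaller than `ν`, the quantile transform moves almost every point
down. -/
theorem ae_quantile_le [NullSingletonClass ν] (hdom : ∀ s, cdf ν s ≤ cdf Q s) :
    ∀ᵐ z ∂ν, sInf {w | cdf ν z ≤ cdf Q w} ≤ z := by
  filter_upwards [ae_cdf_pos (ν := ν), ae_cdf_lt_one (ν := ν)] with z h0 h1
  exact (sInf_cdf_le_iff (Q := Q) h0 h1 _).2 (hdom z)

variable {δ : ℝ}

theorem cdf_tilted_eq (hi : Integrable (fun z => Real.exp (δ * z)) ν) (s : ℝ) :
    haveI := isProbabilityMeasure_tilted hi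
    cdf (ν.tilted fun z => δ * z) s =
      (∫ z in Set.Iic s, Real.exp (δ * z) ∂ν) / ∫ z, Real.exp (δ * z) ∂ν := by
  have := isProbabilityMeasure_tilted hi
  rw [cdf_eq_real, measureReal_def, tilted_apply_eq_ofReal_integral, ENNReal.toReal_ofReal
    (by positivity), integral_div]

/-- An upward tilt makes a law stochastically larger. -/
theorem cdf_tilted_le (hi : Integrable (fun z => Real.exp (δ * z)) ν) (hδ : 0 ≤ δ) (s : ℝ) :
    haveI := isProbabilityMeasure_tilted hi
    cdf (ν.tilted fun z => δ * z) s ≤ cdf ν s := by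
  have := isProbabilityMeasure_tilted hi
  rw [cdf_tilted_eq hi, div_le_iff₀ (integral_exp_pos hi), exp_split hi s, cdf_eq_real]
  have hc : ν.real (Set.Ioi s) = 1 - ν.real (Set.Iic s) := by
    rw [← Set.compl_Iic, probReal_compl_eq_one_sub measurableSet_Iic]
  have h1 : ∫ z in Set.Iic s, Real.exp (δ * z) ∂ν ≤ Real.exp (δ * s) * ν.real (Set.Iic s) := by
    have := setIntegral_mono_on hi.integrableOn (integrable_const (Real.exp (δ * s))).integrableOn
      (measurableSet_Iic (a := s)) fun z hz => Real.exp_le_exp.2 (mul_le_mul_of_nonneg_left hz hδ)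
    simpa [mul_comm] using this
  have h2 : Real.exp (δ * s) * ν.real (Set.Ioi s) ≤ ∫ z in Set.Ioi s, Real.exp (δ * z) ∂ν := by
    have := setIntegral_mono_on (integrable_const (Real.exp (δ * s))).integrableOn hi.integrableOn
      (measurableSet_Ioi (a := s))
      fun z hz => Real.exp_le_exp.2 (mul_le_mul_of_nonneg_left (le_of_lt hz) hδ)
    simpa [mul_comm] using this
  rw [hc] at h2
  have hF0 : 0 ≤ ν.real (Set.Iic s) := measureReal_nonneg
  have hF1 : ν.real (Set.Iic s) ≤ 1 := measureReal_le_one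
  nlinarith [mul_le_mul_of_nonneg_left h2 hF0,
    mul_le_mul_of_nonneg_right h1 (sub_nonneg.2 hF1)]

/-- A downward tilt makes a law stochastically smaller. -/
theorem le_cdf_tilted (hi : Integrable (fun z => Real.exp (δ * z)) ν) (hδ : δ ≤ 0) (s : ℝ) :
    haveI := isProbabilityMeasure_tilted hi
    cdf ν s ≤ cdf (ν.tilted fun z => δ * z) s := by
  have := isProbabilityMeasure_tilted hi
  rw [cdf_tilted_eq hi, le_div_iff₀ (integral_exp_pos hi), exp_split hi s, cdf_eq_real]
  have hc : ν.real (Set.Ioi s) = 1 - ν.real (Set.Iic s) := by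
    rw [← Set.compl_Iic, probReal_compl_eq_one_sub measurableSet_Iic]
  have h1 : Real.exp (δ * s) * ν.real (Set.Iic s) ≤ ∫ z in Set.Iic s, Real.exp (δ * z) ∂ν := by
    have := setIntegral_mono_on (integrable_const (Real.exp (δ * s))).integrableOn hi.integrableOn
      (measurableSet_Iic (a := s))
      fun z hz => Real.exp_le_exp.2 (mul_le_mul_of_nonpos_left hz hδ)
    simpa [mul_comm] using this
  have h2 : ∫ z in Set.Ioi s, Real.exp (δ * z) ∂ν ≤ Real.exp (δ * s) * ν.real (Set.Ioi s) := by
    have := setIntegral_mono_on hi.integrableOn (integrable_const (Real.exp (δ * s))).integrableOn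
      (measurableSet_Ioi (a := s))
      fun z hz => Real.exp_le_exp.2 (mul_le_mul_of_nonpos_left (le_of_lt hz) hδ)
    simpa [mul_comm] using this
  rw [hc] at h2
  have hF0 : 0 ≤ ν.real (Set.Iic s) := measureReal_nonneg
  have hF1 : ν.real (Set.Iic s) ≤ 1 := measureReal_le_one
  nlinarith [mul_le_mul_of_nonneg_left h2 hF0,
    mul_le_mul_of_nonneg_right h1 (sub_nonneg.2 hF1)]

end Quantile

/-! ### From a fixed to a random value of the instrument -/

section GridApproximation

/-- The least point of the grid of mesh `1 / (n + 1)` strictly above `z`. -/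
def gridAbove (n : ℕ) (z : ℝ) : ℝ := ((⌊((n : ℝ) + 1) * z⌋ : ℝ) + 1) / ((n : ℝ) + 1)

/-- The greatest point of the grid of mesh `1 / (n + 1)` strictly below `z`. -/
def gridBelow (n : ℕ) (z : ℝ) : ℝ := ((⌈((n : ℝ) + 1) * z⌉ : ℝ) - 1) / ((n : ℝ) + 1)

theorem lt_gridAbove (n : ℕ) (z : ℝ) : z < gridAbove n z := by
  have hn : (0 : ℝ) < n + 1 := by positivity
  rw [gridAbove, lt_div_iff₀ hn, mul_comm]
  exact Int.lt_floor_add_one _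

theorem gridAbove_le (n : ℕ) (z : ℝ) : gridAbove n z ≤ z + 1 / ((n : ℝ) + 1) := by
  have hn : (0 : ℝ) < n + 1 := by positivity
  have := Int.floor_le (((n : ℝ) + 1) * z)
  have h : (z + 1 / ((n : ℝ) + 1)) * ((n : ℝ) + 1) = ((n : ℝ) + 1) * z + 1 := by field_simp
  rw [gridAbove, div_le_iff₀ hn, h]
  linarith

theorem gridBelow_lt (n : ℕ) (z : ℝ) : gridBelow n z < z := by
  have hn : (0 : ℝ) < n + 1 := by positivity
  rw [gridBelow, div_lt_iff₀ hn]
  linarith [Int.ceil_lt_add_one (((n : ℝ) + 1) * z)]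

theorem le_gridBelow (n : ℕ) (z : ℝ) : z - 1 / ((n : ℝ) + 1) ≤ gridBelow n z := by
  have hn : (0 : ℝ) < n + 1 := by positivity
  have := Int.le_ceil (((n : ℝ) + 1) * z)
  have h : (z - 1 / ((n : ℝ) + 1)) * ((n : ℝ) + 1) = ((n : ℝ) + 1) * z - 1 := by field_simp
  rw [gridBelow, le_div_iff₀ hn, h]
  linarith

theorem tendsto_gridAbove (z : ℝ) : Tendsto (fun n => gridAbove n z) atTop (𝓝 z) := by
  refine tendsto_of_tendsto_of_tendsto_of_le_of_le tendsto_const_nhds ?_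
    (fun n => (lt_gridAbove n z).le) fun n => gridAbove_le n z
  simpa using (tendsto_one_div_add_atTop_nhds_zero_nat (𝕜 := ℝ)).const_add z

theorem tendsto_gridBelow (z : ℝ) : Tendsto (fun n => gridBelow n z) atTop (𝓝 z) := by
  refine tendsto_of_tendsto_of_tendsto_of_le_of_le ?_ tendsto_const_nhds
    (fun n => le_gridBelow n z) fun n => (gridBelow_lt n z).le
  simpa using (tendsto_one_div_add_atTop_nhds_zero_nat (𝕜 := ℝ)).const_sub z

theorem measurable_gridAbove (n : ℕ) : Measurable (gridAbove n) := by
  unfold gridAbove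
  have : Measurable fun z : ℝ => ((⌊((n : ℝ) + 1) * z⌋ : ℤ) : ℝ) :=
    (measurable_from_top (f := fun k : ℤ => (k : ℝ))).comp
      (Int.measurable_floor.comp (measurable_id.const_mul _))
  exact (this.add_const _).div_const _

theorem measurable_gridBelow (n : ℕ) : Measurable (gridBelow n) := by
  unfold gridBelow
  have : Measurable fun z : ℝ => ((⌈((n : ℝ) + 1) * z⌉ : ℤ) : ℝ) :=
    (measurable_from_top (f := fun k : ℤ => (k : ℝ))).comp
      (Int.measurable_ceil.comp (measurable_id.const_mul _))
  exact (this.sub_const _).div_const _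

end GridApproximation

section JumpPoint

variable {Ω₀ : Type*} {A : ℝ → Ω₀ → Bool}

variable (A) in
/-- `z` separates the values of `A` on the grids: the unit changes its exposure exactly at `z`. -/
def JumpAt (ω : Ω₀) (z : ℝ) : Prop :=
  ∀ n, A (gridBelow n z) ω = false ∧ A (gridAbove n z) ω = true

/-- A monotone exposure switches at most once. -/
theorem JumpAt.eq {ω : Ω₀} (hmono : ∀ z z' : ℝ, z < z' → A z ω ≤ A z' ω) {z z' : ℝ}
    (h : JumpAt A ω z) (h' : JumpAt A ω z') : z = z' := by
  have key : ∀ z z', JumpAt A ω z → JumpAt A ω z' → ¬ z < z' := by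
    intro z z' h h' hlt
    obtain ⟨m, hm⟩ := exists_between hlt
    obtain ⟨n, hn1, hn2⟩ := (((tendsto_gridAbove z).eventually (gt_mem_nhds hm.1)).and
      ((tendsto_gridBelow z').eventually (lt_mem_nhds hm.2))).exists
    have := hmono _ _ (hn1.trans hn2)
    rw [(h n).2, (h' n).1] at this
    exact absurd this (by decide)
  exact le_antisymm (not_lt.1 (key z' z h' h)) (not_lt.1 (key z z' h h'))

theorem eventually_const_of_not_jumpAt {ω : Ω₀} (hmono : ∀ z z' : ℝ, z < z' → A z ω ≤ A z' ω)
    {z : ℝ} (h : ¬ JumpAt A ω z) :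
    ∀ᶠ n in atTop, A (gridBelow n z) ω = A z ω ∧ A (gridAbove n z) ω = A z ω := by
  simp only [JumpAt, not_forall, not_and_or, Bool.not_eq_false, Bool.not_eq_true] at h
  have htrue : ∀ {a b : ℝ}, a < b → A a ω = true → A b ω = true := fun hab ha => by
    have := hmono _ _ hab
    rw [ha] at this
    exact Bool.eq_true_of_true_le this
  have hfalse : ∀ {a b : ℝ}, a < b → A b ω = false → A a ω = false := fun hab hb => by
    have := hmono _ _ hab
    rw [hb] at this
    exact Bool.eq_false_of_le_false this
  obtain ⟨m, hm | hm⟩ := h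
  · filter_upwards [(tendsto_gridBelow z).eventually (lt_mem_nhds (gridBelow_lt m z))] with n hn
    have hz := htrue (gridBelow_lt m z) hm
    exact ⟨(htrue hn hm).trans hz.symm, (htrue (lt_gridAbove n z) hz).trans hz.symm⟩
  · filter_upwards [(tendsto_gridAbove z).eventually (gt_mem_nhds (lt_gridAbove m z))] with n hn
    have hz := hfalse (lt_gridAbove m z) hm
    exact ⟨(hfalse (gridBelow_lt n z) hz).trans hz.symm, (hfalse hn hm).trans hz.symm⟩

end JumpPoint

section FreshCopy

variable {Ω₀ 𝒳 : Type*} [MeasurableSpace Ω₀] [MeasurableSpace 𝒳] {P₀ : Measure Ω₀}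
  {X : Ω₀ → 𝒳} {Z : Ω₀ → ℝ} {π : Kernel 𝒳 ℝ}

variable (P₀ Z) in
/-- The joint law of the unit and its own instrument. -/
def ownPair : Measure (Ω₀ × ℝ) := P₀.map fun ω => (ω, Z ω)

variable (P₀ π) in
/-- The joint law of the unit and an instrument drawn afresh from its conditional law. -/
def freshPair (hX : Measurable X) : Measure (Ω₀ × ℝ) := P₀ ⊗ₘ (π.comap X hX)

variable [IsMarkovKernel π] {B : Type*} [MeasurableSpace B]
  {V : ℝ → Ω₀ → B} {A : ℝ → Ω₀ → Bool}

theorem lintegral_ownPair (hZ : Measurable Z) {F : Ω₀ × ℝ → ℝ≥0∞} (hF : Measurable F) :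
    ∫⁻ p, F p ∂(ownPair P₀ Z) = ∫⁻ ω, F (ω, Z ω) ∂P₀ :=
  lintegral_map hF (measurable_id.prodMk hZ)

theorem lintegral_freshPair [SFinite P₀] (hX : Measurable X) {F : Ω₀ × ℝ → ℝ≥0∞}
    (hF : Measurable F) :
    ∫⁻ p, F p ∂(freshPair P₀ π hX) = ∫⁻ ω, ∫⁻ z, F (ω, z) ∂(π (X ω)) ∂P₀ := by
  rw [freshPair, Measure.lintegral_compProd hF]
  rfl

/-- Independence of each single `V r` extends to a random index with values in a countable set. -/
theorem lintegral_own_eq_fresh_of_countable (hX : Measurable X) (hZ : Measurable Z)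
    (hV : ∀ r, Measurable (V r))
    (hU : ∀ r, ∀ G : (𝒳 × B) × ℝ → ℝ≥0∞, Measurable G →
      ∫⁻ ω, G ((X ω, V r ω), Z ω) ∂P₀ = ∫⁻ ω, ∫⁻ z, G ((X ω, V r ω), z) ∂(π (X ω)) ∂P₀)
    {k : 𝒳 × ℝ → ℤ} (hk : Measurable k) (g : ℤ → ℝ) {G : (𝒳 × B) × ℝ → ℝ≥0∞}
    (hG : Measurable G) :
    ∫⁻ ω, G ((X ω, V (g (k (X ω, Z ω))) ω), Z ω) ∂P₀ =
      ∫⁻ ω, ∫⁻ z, G ((X ω, V (g (k (X ω, z))) ω), z) ∂(π (X ω)) ∂P₀ := by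
  set Gj : ℤ → (𝒳 × B) × ℝ → ℝ≥0∞ := fun j p =>
    ({p : (𝒳 × B) × ℝ | k (p.1.1, p.2) = j}).indicator G p with hGj
  have hGm : ∀ j, Measurable (Gj j) := fun j =>
    hG.indicator ((measurableSet_singleton j).preimage (hk.comp (by fun_prop)))
  have hsum : ∀ ω z, G ((X ω, V (g (k (X ω, z))) ω), z) =
      ∑' j, Gj j ((X ω, V (g j) ω), z) := by
    intro ω z
    rw [tsum_eq_single (k (X ω, z))]
    · simp [hGj]
    · intro j hj
      simp only [hGj]
      exact Set.indicator_of_notMem (fun h => hj h.symm) _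
  simp only [hsum]
  have hXV : ∀ j, Measurable fun p : Ω₀ × ℝ => ((X p.1, V (g j) p.1), p.2) := fun j =>
    ((hX.comp measurable_fst).prodMk ((hV (g j)).comp measurable_fst)).prodMk measurable_snd
  rw [lintegral_tsum (f := fun j ω => Gj j ((X ω, V (g j) ω), Z ω)) fun j =>
    ((hGm j).comp ((hX.prodMk (hV (g j))).prodMk hZ)).aemeasurable]
  have h2 : ∀ ω, ∫⁻ z, ∑' j, Gj j ((X ω, V (g j) ω), z) ∂(π (X ω)) =
      ∑' j, ∫⁻ z, Gj j ((X ω, V (g j) ω), z) ∂(π (X ω)) := fun ω =>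
    lintegral_tsum fun j => ((hGm j).comp measurable_prodMk_left).aemeasurable
  simp only [h2]
  rw [lintegral_tsum (f := fun j ω => ∫⁻ z, Gj j ((X ω, V (g j) ω), z) ∂(π (X ω))) fun j => ?_]
  · exact tsum_congr fun j => hU (g j) (Gj j) (hGm j)
  · have := Measurable.lintegral_kernel_prod_right' (κ := π.comap X hX) ((hGm j).comp (hXV j))
    exact this.aemeasurable

/-- With `A` monotone in the instrument, unconfoundedness at each fixed value of the instrument
extends to a random value `q (X, Z)` with continuous conditional law: `Z` may be replaced by a
fresh draw from its conditional law. Monotonicity is needed: it makes the exposure at `q` a limit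
of exposures on countable grids, off the null event that the unit switches exactly at `q`. -/
theorem lintegral_own_eq_fresh [IsProbabilityMeasure P₀] (hX : Measurable X) (hZ : Measurable Z)
    (hA : Measurable (Function.uncurry A)) {φ : Bool → Ω₀ → B} (hφ : ∀ a, Measurable (φ a))
    (hU : ∀ r, ∀ G : (𝒳 × B) × ℝ → ℝ≥0∞, Measurable G →
      ∫⁻ ω, G ((X ω, φ (A r ω) ω), Z ω) ∂P₀ =
        ∫⁻ ω, ∫⁻ z, G ((X ω, φ (A r ω) ω), z) ∂(π (X ω)) ∂P₀)
    {τ : B → Bool} (hτ : Measurable τ) (hτφ : ∀ a ω, τ (φ a ω) = a)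
    (hmono : ∀ᵐ ω ∂P₀, ∀ z z' : ℝ, z < z' → A z ω ≤ A z' ω)
    {q : 𝒳 × ℝ → ℝ} (hq : Measurable q)
    (hatom : ∀ᵐ ω ∂P₀, ∀ c, π (X ω) {z | q (X ω, z) = c} = 0)
    {f : 𝒳 × ℝ → ℝ≥0∞} (hf : Measurable f) (hfi : ∫⁻ ω, f (X ω, Z ω) ∂P₀ ≠ ∞)
    {E : Set B} (hE : MeasurableSet E) :
    ∫⁻ ω, E.indicator 1 (φ (A (q (X ω, Z ω)) ω) ω) * f (X ω, Z ω) ∂P₀ =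
      ∫⁻ ω, ∫⁻ z, E.indicator 1 (φ (A (q (X ω, z)) ω) ω) * f (X ω, z) ∂(π (X ω)) ∂P₀ := by
  set m0 := ownPair P₀ Z with hm0
  set m1 := freshPair P₀ π hX with hm1
  have : IsProbabilityMeasure m0 := Measure.isProbabilityMeasure_map (by fun_prop)
  have : IsProbabilityMeasure m1 := by rw [hm1, freshPair]; infer_instance
  have hφ' : Measurable fun p : Bool × Ω₀ => φ p.1 p.2 := measurable_from_prod_countable_right hφ
  have hAr : ∀ r, Measurable (A r) := fun r => hA.comp measurable_prodMk_left
  have hV : ∀ r, Measurable fun ω => φ (A r ω) ω := fun r =>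
    hφ'.comp ((hAr r).prodMk measurable_id)
  have hqX : Measurable fun p : Ω₀ × ℝ => q (X p.1, p.2) :=
    hq.comp ((hX.comp measurable_fst).prodMk measurable_snd)
  have hAq : ∀ g : ℝ → ℝ, Measurable g →
      Measurable fun p : Ω₀ × ℝ => A (g (q (X p.1, p.2))) p.1 := fun g hg =>
    hA.comp ((hg.comp hqX).prodMk measurable_fst)
  have hVq : ∀ g : ℝ → ℝ, Measurable g →
      Measurable fun p : Ω₀ × ℝ => φ (A (g (q (X p.1, p.2))) p.1) p.1 := fun g hg =>
    hφ'.comp ((hAq g hg).prodMk measurable_fst)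
  have hfX : Measurable fun p : Ω₀ × ℝ => f (X p.1, p.2) :=
    hf.comp ((hX.comp measurable_fst).prodMk measurable_snd)
  -- both joint laws see the same values at the points of a grid
  have hgrid : ∀ g : ℝ → ℝ, Measurable g → (∃ k : 𝒳 × ℝ → ℤ, Measurable k ∧ ∃ l : ℤ → ℝ,
      ∀ p, g (q p) = l (k p)) → ∀ G : (𝒳 × B) × ℝ → ℝ≥0∞, Measurable G →
      ∫⁻ p, G ((X p.1, φ (A (g (q (X p.1, p.2))) p.1) p.1), p.2) ∂m0 =
        ∫⁻ p, G ((X p.1, φ (A (g (q (X p.1, p.2))) p.1) p.1), p.2) ∂m1 := by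
    rintro g hg ⟨k, hk, l, hl⟩ G hG
    have hGm : Measurable fun p : Ω₀ × ℝ =>
        G ((X p.1, φ (A (g (q (X p.1, p.2))) p.1) p.1), p.2) :=
      hG.comp (((hX.comp measurable_fst).prodMk (hVq g hg)).prodMk measurable_snd)
    rw [hm0, hm1, lintegral_ownPair hZ hGm, lintegral_freshPair hX hGm]
    simp only [hl]
    exact lintegral_own_eq_fresh_of_countable hX hZ hV hU hk l hG
  have habove : ∀ n, ∃ k : 𝒳 × ℝ → ℤ, Measurable k ∧ ∃ l : ℤ → ℝ,
      ∀ p, gridAbove n (q p) = l (k p) := fun n =>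
    ⟨fun p => ⌊((n : ℝ) + 1) * q p⌋, Int.measurable_floor.comp (hq.const_mul _),
      fun j => ((j : ℝ) + 1) / ((n : ℝ) + 1), fun p => rfl⟩
  have hbelow : ∀ n, ∃ k : 𝒳 × ℝ → ℤ, Measurable k ∧ ∃ l : ℤ → ℝ,
      ∀ p, gridBelow n (q p) = l (k p) := fun n =>
    ⟨fun p => ⌈((n : ℝ) + 1) * q p⌉, Int.measurable_ceil.comp (hq.const_mul _),
      fun j => ((j : ℝ) - 1) / ((n : ℝ) + 1), fun p => rfl⟩
  have hA01 : ∀ g : ℝ → ℝ, Measurable g → (∃ k : 𝒳 × ℝ → ℤ, Measurable k ∧ ∃ l : ℤ → ℝ,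
      ∀ p, g (q p) = l (k p)) →
      m0 {p | A (g (q (X p.1, p.2))) p.1 = true} =
        m1 {p | A (g (q (X p.1, p.2))) p.1 = true} := by
    intro g hg hk
    have hm : MeasurableSet {p : Ω₀ × ℝ | A (g (q (X p.1, p.2))) p.1 = true} :=
      (hAq g hg) (measurableSet_singleton true)
    have h := hgrid g hg hk (({p : (𝒳 × B) × ℝ | τ p.1.2 = true}).indicator 1)
      (measurable_one.indicator
        ((hτ.comp (measurable_snd.comp measurable_fst)) (measurableSet_singleton true)))
    rw [← lintegral_indicator_one hm, ← lintegral_indicator_one hm]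
    simpa only [Set.indicator_apply, Set.mem_ofPred_eq, hτφ, Pi.one_apply] using h
  have hmono0 : ∀ᵐ p ∂m0, ∀ z z' : ℝ, z < z' → A z p.1 ≤ A z' p.1 := by
    have h : m0.map Prod.fst = P₀ := by
      rw [hm0, ownPair, Measure.map_map measurable_fst (by fun_prop)]
      exact Measure.map_id
    have h' := hmono
    rw [← h] at h'
    exact ae_of_ae_map measurable_fst.aemeasurable h'
  have hmono1 : ∀ᵐ p ∂m1, ∀ z z' : ℝ, z < z' → A z p.1 ≤ A z' p.1 := by
    have h : m1.map Prod.fst = P₀ := Measure.fst_compProd P₀ (π.comap X hX)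
    have h' := hmono
    rw [← h] at h'
    exact ae_of_ae_map measurable_fst.aemeasurable h'
  -- the events that the exposure changes across the grid interval around `q`
  set S : ℕ → Set (Ω₀ × ℝ) := fun n => {p | A (gridBelow n (q (X p.1, p.2))) p.1 = false ∧
    A (gridAbove n (q (X p.1, p.2))) p.1 = true} with hS
  have hSm : ∀ n, MeasurableSet (S n) := fun n =>
    ((hAq _ (measurable_gridBelow n)) (measurableSet_singleton false)).inter
      ((hAq _ (measurable_gridAbove n)) (measurableSet_singleton true))
  have hSeq : ∀ m : Measure (Ω₀ × ℝ), IsProbabilityMeasure m →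
      (∀ᵐ p ∂m, ∀ z z' : ℝ, z < z' → A z p.1 ≤ A z' p.1) → ∀ n,
      m (S n) = m {p | A (gridAbove n (q (X p.1, p.2))) p.1 = true} -
        m {p | A (gridBelow n (q (X p.1, p.2))) p.1 = true} := by
    intro m _ hm n
    have hb : MeasurableSet {p : Ω₀ × ℝ | A (gridBelow n (q (X p.1, p.2))) p.1 = true} :=
      (hAq _ (measurable_gridBelow n)) (measurableSet_singleton true)
    have hsub : {p : Ω₀ × ℝ | A (gridBelow n (q (X p.1, p.2))) p.1 = true} ≤ᵐ[m]
        {p | A (gridAbove n (q (X p.1, p.2))) p.1 = true} := by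
      filter_upwards [hm] with p hp h1
      have := hp _ _ ((gridBelow_lt n (q (X p.1, p.2))).trans (lt_gridAbove n _))
      rw [show A (gridBelow n (q (X p.1, p.2))) p.1 = true from h1] at this
      exact Bool.eq_true_of_true_le this
    have hab : ({p : Ω₀ × ℝ | A (gridAbove n (q (X p.1, p.2))) p.1 = true} ∩
        {p | A (gridBelow n (q (X p.1, p.2))) p.1 = true} : Set (Ω₀ × ℝ)) =ᵐ[m]
        {p | A (gridBelow n (q (X p.1, p.2))) p.1 = true} := by
      filter_upwards [hsub] with p hp
      exact propext ⟨fun h => h.2, fun h => ⟨hp h, h⟩⟩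
    have hSd : S n = {p : Ω₀ × ℝ | A (gridAbove n (q (X p.1, p.2))) p.1 = true} \
        {p | A (gridBelow n (q (X p.1, p.2))) p.1 = true} := by
      ext p
      simp only [hS, Set.mem_ofPred_eq, Set.mem_sdiff, Bool.not_eq_true]
      exact and_comm
    have h := measure_inter_add_sdiff (μ := m)
      {p : Ω₀ × ℝ | A (gridAbove n (q (X p.1, p.2))) p.1 = true} hb
    rw [measure_congr hab] at h
    rw [hSd]
    exact ENNReal.eq_sub_of_add_eq' (measure_ne_top _ _) (by rw [add_comm]; exact h)
  have hS01 : ∀ n, m0 (S n) = m1 (S n) := fun n => by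
    rw [hSeq m0 inferInstance hmono0, hSeq m1 inferInstance hmono1,
      hA01 _ (measurable_gridAbove n) (habove n), hA01 _ (measurable_gridBelow n) (hbelow n)]
  -- a fresh draw puts `q` at the switching point of the unit with probability zero
  have hjump1 : ∀ᵐ p ∂m1, ¬ JumpAt A p.1 (q (X p.1, p.2)) := by
    have hm : MeasurableSet {p : Ω₀ × ℝ | JumpAt A p.1 (q (X p.1, p.2))} := by
      have : {p : Ω₀ × ℝ | JumpAt A p.1 (q (X p.1, p.2))} = ⋂ n, S n := by
        ext p
        simp [JumpAt, hS]
      rw [this]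
      exact MeasurableSet.iInter hSm
    rw [ae_iff]
    simp only [not_not]
    rw [hm1, freshPair, Measure.compProd_apply hm, lintegral_eq_zero_iff
      (Kernel.measurable_kernel_prodMk_left hm)]
    filter_upwards [hmono, hatom] with ω hω hat
    rw [Pi.zero_apply, Kernel.comap_apply]
    by_cases hex : ∃ c, JumpAt A ω c
    · obtain ⟨c, hc⟩ := hex
      exact measure_mono_null (fun z hz => JumpAt.eq hω hz hc) (hat c)
    · refine measure_mono_null (fun z hz => (hex ⟨_, hz⟩).elim) (measure_empty)
  have hS0 : Tendsto (fun n => m1 (S n)) atTop (𝓝 0) := by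
    have h := tendsto_measure_of_ae_tendsto_indicator_of_isFiniteMeasure (μ := m1) (L := atTop)
      (A := ∅) (As := S) MeasurableSet.empty hSm ?_
    · simpa using h
    filter_upwards [hmono1, hjump1] with p hp hj
    filter_upwards [eventually_const_of_not_jumpAt hp hj] with n hn
    simp only [hS, Set.mem_ofPred_eq, hn.1, hn.2, Set.mem_empty_iff_false, iff_false]
    simp
  -- so does the unit's own instrument, as both laws give the events `S n` the same probability
  have hjump0 : ∀ᵐ p ∂m0, ¬ JumpAt A p.1 (q (X p.1, p.2)) := by
    rw [ae_iff]
    simp only [not_not]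
    refine le_antisymm (ge_of_tendsto' hS0 fun n => ?_) (zero_le)
    rw [← hS01]
    exact measure_mono fun p hp => hp n
  -- the exposure at `q` is the limit of the exposures on the grids, under both laws
  have hlim : ∀ m : Measure (Ω₀ × ℝ),
      (∀ᵐ p ∂m, ∀ z z' : ℝ, z < z' → A z p.1 ≤ A z' p.1) →
      (∀ᵐ p ∂m, ¬ JumpAt A p.1 (q (X p.1, p.2))) → ∫⁻ p, f (X p.1, p.2) ∂m ≠ ∞ →
      Tendsto (fun n => ∫⁻ p, E.indicator 1
        (φ (A (gridAbove n (q (X p.1, p.2))) p.1) p.1) * f (X p.1, p.2) ∂m) atTop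
        (𝓝 (∫⁻ p, E.indicator 1 (φ (A (q (X p.1, p.2)) p.1) p.1) * f (X p.1, p.2) ∂m)) := by
    intro m hm hj hfin
    refine tendsto_lintegral_of_dominated_convergence (fun p => f (X p.1, p.2))
      (fun n => ((measurable_one.indicator hE).comp (hVq _ (measurable_gridAbove n))).mul hfX)
      (fun n => ae_of_all _ fun p => ?_) hfin ?_
    · refine mul_le_of_le_one_left zero_le ?_
      exact Set.indicator_le_self' (fun _ _ => zero_le) _
    · filter_upwards [hm, hj] with p hp hjp
      refine tendsto_const_nhds.congr' ?_
      filter_upwards [eventually_const_of_not_jumpAt hp hjp] with n hn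
      rw [hn.2]
  have hown : ∫⁻ p, f (X p.1, p.2) ∂m0 = ∫⁻ ω, f (X ω, Z ω) ∂P₀ := lintegral_ownPair hZ hfX
  have hf01 : ∫⁻ p, f (X p.1, p.2) ∂m0 = ∫⁻ p, f (X p.1, p.2) ∂m1 :=
    hgrid _ (measurable_gridAbove 0) (habove 0) (fun p => f (p.1.1, p.2)) (by fun_prop)
  have hg01 : ∀ n, ∫⁻ p, E.indicator 1
        (φ (A (gridAbove n (q (X p.1, p.2))) p.1) p.1) * f (X p.1, p.2) ∂m0 = ∫⁻ p, E.indicator 1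
        (φ (A (gridAbove n (q (X p.1, p.2))) p.1) p.1) * f (X p.1, p.2) ∂m1 := fun n =>
    hgrid _ (measurable_gridAbove n) (habove n) (fun p => E.indicator 1 p.1.2 * f (p.1.1, p.2))
      (((measurable_one.indicator hE).comp (by fun_prop)).mul (by fun_prop))
  have hFm : Measurable fun p : Ω₀ × ℝ => E.indicator (1 : B → ℝ≥0∞)
      (φ (A (q (X p.1, p.2)) p.1) p.1) * f (X p.1, p.2) :=
    ((measurable_one.indicator hE).comp (hVq id measurable_id)).mul hfX
  have h0 := hlim m0 hmono0 hjump0 (by rwa [hown])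
  simp only [hg01] at h0
  have h := tendsto_nhds_unique h0 (hlim m1 hmono1 hjump1 (by rwa [← hf01, hown]))
  rwa [hm0, hm1, lintegral_ownPair hZ hFm, lintegral_freshPair hX hFm] at h

end FreshCopy

/-! ### Conditional laws in the instrumental variable model -/

section TiltedQuantile

variable {𝒳 : Type*} [MeasurableSpace 𝒳] {π : Kernel 𝒳 ℝ} [IsMarkovKernel π]

theorem measurable_kernel_Iic : Measurable fun p : 𝒳 × ℝ => (π p.1).real (Set.Iic p.2) := by
  have hs : MeasurableSet {w : (𝒳 × ℝ) × ℝ | w.2 ≤ w.1.2} :=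
    measurableSet_le measurable_snd (measurable_snd.comp measurable_fst)
  have h := Kernel.measurable_kernel_prodMk_left (κ := π.comap Prod.fst measurable_fst) hs
  exact h.ennreal_toReal

theorem measurable_tilted_apply (δ : ℝ) {s : Set ℝ} (hs : MeasurableSet s) :
    Measurable fun x => ((π x).tilted fun z => δ * z) s := by
  simp only [tilted_apply' _ _ hs]
  have hα : Measurable fun x => ∫ z, Real.exp (δ * z) ∂(π x) :=
    measurable_integral_kernel (by fun_prop)
  have h := Measurable.lintegral_kernel_prod_right' (κ := π)
    (f := fun p : 𝒳 × ℝ => s.indicator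
      (fun z => ENNReal.ofReal (Real.exp (δ * z) / ∫ z, Real.exp (δ * z) ∂(π p.1))) p.2) ?_
  · simpa only [lintegral_indicator hs] using h
  · have h2 : Measurable fun p : 𝒳 × ℝ =>
        ENNReal.ofReal (Real.exp (δ * p.2) / ∫ z, Real.exp (δ * z) ∂(π p.1)) :=
      ((by fun_prop : Measurable fun p : 𝒳 × ℝ => Real.exp (δ * p.2)).div
        (hα.comp measurable_fst)).ennreal_ofReal
    exact h2.indicator (measurable_snd hs)

/-- The tilted quantile transform `(x, z) ↦ Q⁻¹ (Π (z | x) | x)` has a measurable version, equal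
to it on a measurable set which has full measure for every well-behaved `x`. -/
theorem exists_measurable_tiltedQuantile (π : Kernel 𝒳 ℝ) [IsMarkovKernel π] (δ : ℝ) :
    ∃ q : 𝒳 × ℝ → ℝ, Measurable q ∧ ∃ G : Set (𝒳 × ℝ), MeasurableSet G ∧
      (∀ p ∈ G, q p = sInf {w | cdf (π p.1) p.2 ≤ cdf ((π p.1).tilted fun z => δ * z) w}) ∧
      ∀ x, Integrable (fun z => Real.exp (δ * z)) (π x) → NullSingletonClass (π x) →
        ∀ᵐ z ∂(π x), (x, z) ∈ G := by
  classical
  set G : Set (𝒳 × ℝ) := {p | Integrable (fun z => Real.exp (δ * z)) (π p.1)} ∩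
    {p | 0 < cdf (π p.1) p.2 ∧ cdf (π p.1) p.2 < 1} with hG
  have hF : Measurable fun p : 𝒳 × ℝ => cdf (π p.1) p.2 := by
    simpa only [cdf_eq_real] using measurable_kernel_Iic (π := π)
  have hGm : MeasurableSet G := by
    refine MeasurableSet.inter ?_ (MeasurableSet.inter
      (measurableSet_lt measurable_const hF) (measurableSet_lt hF measurable_const))
    have h := measurableSet_kernel_integrable (κ := π) (f := fun _ z => Real.exp (δ * z))
      (Measurable.stronglyMeasurable (by unfold Function.uncurry; fun_prop))
    exact measurable_fst h
  refine ⟨fun p => if p ∈ G then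
    sInf {w | cdf (π p.1) p.2 ≤ cdf ((π p.1).tilted fun z => δ * z) w} else 0, ?_, G, hGm,
    fun p hp => if_pos hp, fun x hx _ => ?_⟩
  · refine measurable_of_Iic fun s => ?_
    have : (fun p => if p ∈ G then
        sInf {w | cdf (π p.1) p.2 ≤ cdf ((π p.1).tilted fun z => δ * z) w} else 0) ⁻¹' Set.Iic s =
        (G ∩ {p | cdf (π p.1) p.2 ≤ ((π p.1).tilted fun z => δ * z).real (Set.Iic s)}) ∪
          (Gᶜ ∩ {_p | (0 : ℝ) ≤ s}) := by
      ext p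
      by_cases hp : p ∈ G
      · have := isProbabilityMeasure_tilted hp.1
        have hiff := sInf_cdf_le_iff (Q := (π p.1).tilted fun z => δ * z) hp.2.1 hp.2.2 s
        rw [cdf_eq_real (_ : Measure ℝ) s] at hiff
        simp only [Set.mem_preimage, hp, if_true, Set.mem_Iic, hiff, Set.mem_union, Set.mem_inter_iff,
          Set.mem_ofPred_eq, true_and, Set.mem_compl_iff,
          not_true_eq_false, false_and, or_false]
      · simp [hp]
    rw [this]
    refine (hGm.inter (measurableSet_le hF ?_)).union (hGm.compl.inter (MeasurableSet.const _))
    exact ((measurable_tilted_apply δ measurableSet_Iic).comp measurable_fst).ennreal_toReal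
  · filter_upwards [ae_cdf_pos (ν := π x), ae_cdf_lt_one (ν := π x)] with z h0 h1
    exact ⟨hx, h0, h1⟩

/-- The quantile transform carries the law of the instrument to its tilt. -/
theorem map_eq_tilted {ν : Measure ℝ} [IsProbabilityMeasure ν] [NullSingletonClass ν] {δ : ℝ}
    (hi : Integrable (fun z => Real.exp (δ * z)) ν) {q : ℝ → ℝ} (hq : Measurable q)
    (hqe : ∀ᵐ z ∂ν, q z = sInf {w | cdf ν z ≤ cdf (ν.tilted fun z => δ * z) w}) :
    ν.map q = ν.tilted fun z => δ * z := by
  have := isProbabilityMeasure_tilted hi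
  have : IsProbabilityMeasure (ν.map q) := Measure.isProbabilityMeasure_map hq.aemeasurable
  refine Measure.ext_of_Iic _ _ fun s => ?_
  rw [Measure.map_apply hq measurableSet_Iic, ← measure_quantile_le (ν := ν)]
  refine measure_congr ?_
  filter_upwards [hqe] with z hz
  refine propext ?_
  change q z ≤ s ↔ _
  rw [hz]
  rfl

end TiltedQuantile

namespace IVModel

variable {d : ℕ} {Ω₀ : Type*} [MeasurableSpace Ω₀]
  (M : IVModel d Ω₀) (P₀ : Measure Ω₀)

theorem ae_X {p : (Fin d → ℝ) → Prop} (h : ∀ᵐ x ∂(M.lawX P₀), p x) : ∀ᵐ ω ∂P₀, p (M.X ω) :=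
  ae_of_ae_map M.measurable_X.aemeasurable h

variable [IsProbabilityMeasure P₀]

/-- The conditional law of `(Z, A, Y)` given `X`, as a kernel. -/
def condKernel : Kernel (Fin d → ℝ) (ℝ × Bool × ℝ) :=
  condDistrib (fun ω => (M.Z ω, M.A ω, M.Y ω)) M.X P₀

instance : IsMarkovKernel (M.condKernel P₀) := by unfold condKernel; infer_instance

/-- The conditional law of the instrument given `X`, as a kernel. -/
def instrKernel : Kernel (Fin d → ℝ) ℝ := (M.condKernel P₀).map Prod.fst

instance : IsMarkovKernel (M.instrKernel P₀) := by
  unfold instrKernel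
  exact Kernel.IsMarkovKernel.map _ measurable_fst

theorem instrKernel_apply (x : Fin d → ℝ) : M.instrKernel P₀ x = M.instrLaw P₀ x :=
  Kernel.map_apply _ measurable_fst _

theorem measurable_obs : Measurable M.obs :=
  M.measurable_X.prodMk (M.measurable_Z.prodMk (M.measurable_A.prodMk M.measurable_Y))

theorem law_eq_compProd : M.law P₀ = M.lawX P₀ ⊗ₘ M.condKernel P₀ :=
  (compProd_map_condDistrib (by
    exact (M.measurable_Z.prodMk (M.measurable_A.prodMk M.measurable_Y)).aemeasurable)).symm

instance : IsProbabilityMeasure (M.lawX P₀) :=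
  Measure.isProbabilityMeasure_map M.measurable_X.aemeasurable

instance : IsProbabilityMeasure (M.law P₀) :=
  Measure.isProbabilityMeasure_map M.measurable_obs.aemeasurable

instance (x : Fin d → ℝ) : IsProbabilityMeasure (M.condLaw P₀ x) :=
  inferInstanceAs (IsProbabilityMeasure (M.condKernel P₀ x))

instance (x : Fin d → ℝ) : IsProbabilityMeasure (M.instrLaw P₀ x) :=
  Measure.isProbabilityMeasure_map measurable_fst.aemeasurable

theorem condDistrib_Z_ae_eq : condDistrib M.Z M.X P₀ =ᵐ[M.lawX P₀] M.instrKernel P₀ :=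
  condDistrib_comp (Y := fun ω => (M.Z ω, M.A ω, M.Y ω)) M.X
    (M.measurable_Z.prodMk (M.measurable_A.prodMk M.measurable_Y)).aemeasurable measurable_fst

theorem map_XZ_eq_compProd :
    P₀.map (fun ω => (M.X ω, M.Z ω)) = M.lawX P₀ ⊗ₘ M.instrKernel P₀ := by
  rw [← compProd_map_condDistrib M.measurable_Z.aemeasurable]
  exact Measure.compProd_congr (M.condDistrib_Z_ae_eq P₀)

theorem lintegral_XZ {G : (Fin d → ℝ) × ℝ → ℝ≥0∞} (hG : Measurable G) :
    ∫⁻ ω, G (M.X ω, M.Z ω) ∂P₀ = ∫⁻ ω, ∫⁻ z, G (M.X ω, z) ∂(M.instrLaw P₀ (M.X ω)) ∂P₀ := by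
  rw [← lintegral_map hG (M.measurable_X.prodMk M.measurable_Z), M.map_XZ_eq_compProd,
    Measure.lintegral_compProd hG, lawX,
    lintegral_map (Measurable.lintegral_kernel_prod_right' hG) M.measurable_X]
  simp only [instrKernel_apply]

theorem ae_XZ {p : (Fin d → ℝ) × ℝ → Prop} (hp : MeasurableSet {w | p w})
    (h : ∀ᵐ x ∂(M.lawX P₀), ∀ᵐ z ∂(M.instrLaw P₀ x), p (x, z)) :
    ∀ᵐ ω ∂P₀, p (M.X ω, M.Z ω) := by
  have h2 : ∀ᵐ w ∂(P₀.map fun ω => (M.X ω, M.Z ω)), p w := by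
    rw [M.map_XZ_eq_compProd]
    refine Measure.ae_compProd_of_ae_ae hp ?_
    simpa only [instrKernel_apply] using h
  exact ae_of_ae_map (M.measurable_X.prodMk M.measurable_Z).aemeasurable h2

/-- The exposure `a` together with the outcome it produces. -/
def exposureOutcome (a : Bool) (ω : Ω₀) : Bool × ℝ := (a, M.Ya a ω)

theorem measurable_exposureOutcome (a : Bool) : Measurable (M.exposureOutcome a) :=
  measurable_const.prodMk (M.measurable_Ya a)

theorem measurable_Apot_apply (r : ℝ) : Measurable (M.Apot r) :=
  M.measurable_Apot.comp measurable_prodMk_left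

theorem measurable_Yz (r : ℝ) : Measurable (M.Yz r) := by
  have h : Measurable fun p : Bool × Ω₀ => M.Yza r p.1 p.2 :=
    measurable_from_prod_countable_right (M.measurable_Yza r)
  exact h.comp ((M.measurable_Apot_apply r).prodMk measurable_id)

variable {M P₀} [StandardBorelSpace Ω₀]

/-- Unconfoundedness in integral form: given `X`, the instrument may be replaced by a fresh draw
from its conditional law. -/
theorem CausalAssumptions.lintegral_fresh (h : M.CausalAssumptions P₀) (r : ℝ)
    (G : ((Fin d → ℝ) × (Bool × ℝ)) × ℝ → ℝ≥0∞) (hG : Measurable G) :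
    ∫⁻ ω, G ((M.X ω, M.exposureOutcome (M.Apot r ω) ω), M.Z ω) ∂P₀ =
      ∫⁻ ω, ∫⁻ z, G ((M.X ω, M.exposureOutcome (M.Apot r ω) ω), z)
        ∂(M.instrKernel P₀ (M.X ω)) ∂P₀ := by
  have hVm : Measurable fun ω => (M.Apot r ω, M.Yz r ω) :=
    (M.measurable_Apot_apply r).prodMk (M.measurable_Yz r)
  have hXV : Measurable fun ω => (M.X ω, (M.Apot r ω, M.Yz r ω)) := M.measurable_X.prodMk hVm
  have hV : ∀ᵐ ω ∂P₀, M.exposureOutcome (M.Apot r ω) ω = (M.Apot r ω, M.Yz r ω) := by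
    filter_upwards [h.exclusion] with ω hω
    rw [exposureOutcome, Yz, hω]
  have h1 := (condIndepFun_iff_condDistrib_prod_ae_eq_prodMkRight M.measurable_Z hVm
    M.measurable_X).1 (h.unconfoundedness r).symm
  have h2 : condDistrib M.Z (fun ω => (M.X ω, (M.Apot r ω, M.Yz r ω))) P₀
      =ᵐ[P₀.map fun ω => (M.X ω, (M.Apot r ω, M.Yz r ω))]
      (M.instrKernel P₀).prodMkRight (Bool × ℝ) := by
    filter_upwards [h1, ae_of_ae_map (f := Prod.fst) (p := fun x =>
      condDistrib M.Z M.X P₀ x = M.instrKernel P₀ x) measurable_fst.aemeasurable (by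
        rw [Measure.map_map measurable_fst hXV]
        exact M.condDistrib_Z_ae_eq P₀)] with p hp1 hp2
    rw [hp1, Kernel.prodMkRight_apply, Kernel.prodMkRight_apply, hp2]
  have h3 : P₀.map (fun ω => ((M.X ω, (M.Apot r ω, M.Yz r ω)), M.Z ω)) =
      (P₀.map fun ω => (M.X ω, (M.Apot r ω, M.Yz r ω))) ⊗ₘ
        (M.instrKernel P₀).prodMkRight (Bool × ℝ) := by
    rw [← Measure.compProd_congr h2, compProd_map_condDistrib M.measurable_Z.aemeasurable]
  calc _ = ∫⁻ ω, G ((M.X ω, (M.Apot r ω, M.Yz r ω)), M.Z ω) ∂P₀ :=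
        lintegral_congr_ae (by filter_upwards [hV] with ω hω; rw [hω])
    _ = ∫⁻ ω, ∫⁻ z, G ((M.X ω, (M.Apot r ω, M.Yz r ω)), z)
          ∂(M.instrKernel P₀ (M.X ω)) ∂P₀ := by
        rw [← lintegral_map (f := G) hG (hXV.prodMk M.measurable_Z), h3,
          Measure.lintegral_compProd hG,
          lintegral_map (Measurable.lintegral_kernel_prod_right' hG) hXV]
        simp only [Kernel.prodMkRight_apply]
    _ = _ := lintegral_congr_ae (by filter_upwards [hV] with ω hω; simp only [hω])

end IVModel

/-! ### Population moments of the contrast -/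

section PopulationContrast

variable {d : ℕ} {κ : Kernel (Fin d → ℝ) (ℝ × Bool × ℝ)} [IsMarkovKernel κ]
  {ρ : Measure (Fin d → ℝ)} [IsProbabilityMeasure ρ] {t : ℝ × Bool × ℝ → ℝ} {δ C : ℝ}

theorem memLp_mul_tiltWeight (ht : Measurable t)
    (hB : ∀ᵐ x ∂ρ, TiltBounds (κ x) (expTilt δ) t C) :
    MemLp (fun o : Obs d => t o.2 * tiltWeight κ (expTilt δ) o) 2 (ρ ⊗ₘ κ) := by
  have hm : Measurable fun o : Obs d => t o.2 * tiltWeight κ (expTilt δ) o :=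
    (ht.comp measurable_snd).mul (measurable_tiltWeight (measurable_expTilt δ))
  refine memLp_two_of_lintegral hm (ENNReal.ofReal_ne_top (r := C)) ?_
  rw [Measure.lintegral_compProd (hm.enorm.pow_const 2)]
  calc _ ≤ ∫⁻ _x, ENNReal.ofReal C ∂ρ := lintegral_mono_ae (hB.mono fun x hx => hx.sq_mul)
    _ = ENNReal.ofReal C := by simp

theorem memLp_trueγ_mul (ht : Measurable t)
    (hB : ∀ᵐ x ∂ρ, TiltBounds (κ x) (expTilt δ) t C) :
    MemLp (fun o : Obs d => trueγ κ t δ o.1 * (1 - tiltWeight κ (expTilt δ) o)) 2 (ρ ⊗ₘ κ) := by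
  have hm : Measurable fun o : Obs d =>
      trueγ κ t δ o.1 * (1 - tiltWeight κ (expTilt δ) o) :=
    ((measurable_trueγ ht δ).comp measurable_fst).mul
      (measurable_const.sub (measurable_tiltWeight (measurable_expTilt δ)))
  refine memLp_two_of_lintegral hm
    (c := ENNReal.ofReal C * ENNReal.ofReal (2 + 2 * C)) (by finiteness) ?_
  rw [Measure.lintegral_compProd (hm.enorm.pow_const 2)]
  calc _ ≤ ∫⁻ _x, ENNReal.ofReal C * ENNReal.ofReal (2 + 2 * C) ∂ρ := by
        refine lintegral_mono_ae (hB.mono fun x hx => ?_)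
        simp only [enorm_mul, mul_pow]
        rw [lintegral_const_mul' _ _ (by finiteness)]
        refine mul_le_mul' ?_ hx.sq_one_sub
        rw [enorm_sq_eq_ofReal]
        exact ENNReal.ofReal_le_ofReal hx.sq_reg
    _ = _ := by simp

theorem contrast_true_eq (o : Obs d) : contrast t (trueα κ) (trueγ κ t) δ o =
    t o.2 * tiltWeight κ (expTilt δ) o +
      trueγ κ t δ o.1 * (1 - tiltWeight κ (expTilt δ) o) - t o.2 :=
  contrast_eq trueα_zero δ o

theorem memLp_contrast (ht : Measurable t) (ht2 : MemLp (fun o : Obs d => t o.2) 2 (ρ ⊗ₘ κ))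
    (hB : ∀ᵐ x ∂ρ, TiltBounds (κ x) (expTilt δ) t C) :
    MemLp (contrast t (trueα κ) (trueγ κ t) δ) 2 (ρ ⊗ₘ κ) := by
  have := ((memLp_mul_tiltWeight ht hB).add (memLp_trueγ_mul ht hB)).sub ht2
  exact this.ae_eq (ae_of_all _ fun o => (contrast_true_eq o).symm)

/-- At the true nuisance functions the augmentation terms are centered, and the contrast has the
mean of the difference between the reweighted and the plain variable. -/
theorem integral_contrast (ht : Measurable t)
    (ht2 : MemLp (fun o : Obs d => t o.2) 2 (ρ ⊗ₘ κ))
    (hB : ∀ᵐ x ∂ρ, TiltBounds (κ x) (expTilt δ) t C) :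
    ∫ o, contrast t (trueα κ) (trueγ κ t) δ o ∂(ρ ⊗ₘ κ) =
      (∫ o : Obs d, t o.2 * tiltWeight κ (expTilt δ) o ∂(ρ ⊗ₘ κ)) -
        ∫ o : Obs d, t o.2 ∂(ρ ⊗ₘ κ) := by
  have h1 := (memLp_mul_tiltWeight ht hB).integrable (by norm_num)
  have h2 := (memLp_trueγ_mul ht hB).integrable (by norm_num)
  have h12 : Integrable (fun o : Obs d => t o.2 * tiltWeight κ (expTilt δ) o +
      trueγ κ t δ o.1 * (1 - tiltWeight κ (expTilt δ) o)) (ρ ⊗ₘ κ) := h1.add h2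
  simp only [contrast_true_eq]
  rw [integral_sub h12 (ht2.integrable (by norm_num)), integral_add h1 h2]
  have h0 : ∫ o : Obs d, trueγ κ t δ o.1 * (1 - tiltWeight κ (expTilt δ) o) ∂(ρ ⊗ₘ κ) = 0 := by
    rw [Measure.integral_compProd h2]
    refine integral_eq_zero_of_ae (hB.mono fun x hx => ?_)
    simp only [integral_const_mul, Pi.zero_apply]
    have : ∫ w, (1 - tiltWeight κ (expTilt δ) (x, w)) ∂(κ x) = 0 := by
      simp only [tiltWeight]
      rw [integral_sub (integrable_const _) hx.integrable_weight, hx.integral_weight]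
      simp
    rw [this, mul_zero]
  rw [h0, add_zero]

theorem integral_trueγ (ht : Measurable t)
    (hB : ∀ᵐ x ∂ρ, TiltBounds (κ x) (expTilt δ) t C) :
    Integrable (trueγ κ t δ) ρ ∧ ∫ x, trueγ κ t δ x ∂ρ =
      ∫ o : Obs d, t o.2 * tiltWeight κ (expTilt δ) o ∂(ρ ⊗ₘ κ) := by
  have h1 := (memLp_mul_tiltWeight ht hB).integrable (by norm_num)
  have heq : ∀ᵐ x ∂ρ, trueγ κ t δ x =
      ∫ w, t w * tiltWeight κ (expTilt δ) (x, w) ∂(κ x) :=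
    hB.mono fun x hx => hx.integral_mul.symm
  refine ⟨?_, ?_⟩
  · refine Integrable.congr h1.integral_compProd (heq.mono fun x hx => hx.symm)
  · rw [Measure.integral_compProd h1]
    exact integral_congr_ae heq

end PopulationContrast

/-! ### The law of exposure and outcome under the tilted instrument -/

namespace IVModel

variable {d : ℕ} {Ω₀ : Type*} [MeasurableSpace Ω₀]
  (M : IVModel d Ω₀) (P₀ : Measure Ω₀) [IsProbabilityMeasure P₀]

/-- The density `exp (δ Z) / E (exp (δ Z) | X)` of the tilt. -/
def weight (δ : ℝ) (ω : Ω₀) : ℝ := tiltWeight (M.condKernel P₀) (expTilt δ) (M.obs ω)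

theorem trueα_eq (δ : ℝ) (x : Fin d → ℝ) :
    trueα (M.condKernel P₀) δ x = ∫ z, Real.exp (δ * z) ∂(M.instrLaw P₀ x) := by
  rw [instrLaw, integral_map measurable_fst.aemeasurable
    (Measurable.aestronglyMeasurable (by fun_prop))]
  rfl

theorem weight_eq (δ : ℝ) (ω : Ω₀) : M.weight P₀ δ ω =
    Real.exp (δ * M.Z ω) / ∫ z, Real.exp (δ * z) ∂(M.instrLaw P₀ (M.X ω)) := by
  rw [← M.trueα_eq]
  rfl

theorem measurable_weight (δ : ℝ) : Measurable (M.weight P₀ δ) :=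
  (measurable_tiltWeight (measurable_expTilt δ)).comp M.measurable_obs

theorem weight_nonneg (δ : ℝ) (ω : Ω₀) : 0 ≤ M.weight P₀ δ ω := by
  rw [weight_eq]
  positivity

variable {M P₀}

theorem integrable_exp_of_pos {δ : ℝ} {x : Fin d → ℝ} (h : 0 < trueα (M.condKernel P₀) δ x) :
    Integrable (fun z => Real.exp (δ * z)) (M.instrLaw P₀ x) := by
  rw [trueα_eq] at h
  by_contra hi
  rw [integral_undef hi] at h
  exact lt_irrefl _ h

/-- The modified instrument is a.s. a measurable function of `(X, Z)` whose conditional law is the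
tilt, and it lies on the side of `Z` determined by the sign of the tilt. -/
theorem exists_measurable_Ztilt {δ : ℝ}
    (hcont : ∀ᵐ x ∂(M.lawX P₀), ∀ z : ℝ, M.instrLaw P₀ x {z} = 0)
    (hα : ∀ᵐ x ∂(M.lawX P₀), 0 < trueα (M.condKernel P₀) δ x) :
    ∃ q : (Fin d → ℝ) × ℝ → ℝ, Measurable q ∧
      (∀ᵐ ω ∂P₀, M.Ztilt P₀ δ ω = q (M.X ω, M.Z ω)) ∧
      (∀ᵐ x ∂(M.lawX P₀), (M.instrLaw P₀ x).map (fun z => q (x, z)) = M.tiltLaw P₀ δ x) ∧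
      (0 ≤ δ → ∀ᵐ ω ∂P₀, M.Z ω ≤ M.Ztilt P₀ δ ω) ∧
      (δ ≤ 0 → ∀ᵐ ω ∂P₀, M.Ztilt P₀ δ ω ≤ M.Z ω) := by
  obtain ⟨q, hq, G, hG, hqG, hGae⟩ := exists_measurable_tiltedQuantile (M.instrKernel P₀) δ
  simp only [instrKernel_apply] at hqG hGae
  have hgood : ∀ᵐ x ∂(M.lawX P₀), Integrable (fun z => Real.exp (δ * z)) (M.instrLaw P₀ x) ∧
      NullSingletonClass (M.instrLaw P₀ x) := by
    filter_upwards [hcont, hα] with x h1 h2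
    exact ⟨integrable_exp_of_pos h2, ⟨h1⟩⟩
  have hqZ : ∀ᵐ ω ∂P₀, M.Ztilt P₀ δ ω = q (M.X ω, M.Z ω) := by
    filter_upwards [M.ae_XZ P₀ (p := fun p => p ∈ G) hG
      (hgood.mono fun x hx => hGae x hx.1 hx.2), ae_X M P₀ hgood] with ω h1 h2
    have := isProbabilityMeasure_tilted h2.1
    rw [hqG _ h1]
    simp only [cdf_eq_real]
    rfl
  refine ⟨q, hq, hqZ, ?_, fun hδ => ?_, fun hδ => ?_⟩
  · filter_upwards [hgood] with x hx
    have := hx.2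
    refine map_eq_tilted hx.1 (hq.comp measurable_prodMk_left) ?_
    filter_upwards [hGae x hx.1 hx.2] with z hz
    exact hqG _ hz
  · have h := M.ae_XZ P₀ (p := fun p => p.2 ≤ q p) (measurableSet_le measurable_snd hq) (by
      filter_upwards [hgood] with x hx
      have := hx.2
      filter_upwards [hGae x hx.1 hx.2, ae_le_quantile (cdf_tilted_le hx.1 hδ)] with z hz hz2
      rwa [hqG _ hz])
    filter_upwards [h, hqZ] with ω h1 h2
    rwa [h2]
  · have h := M.ae_XZ P₀ (p := fun p => q p ≤ p.2) (measurableSet_le hq measurable_snd) (by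
      filter_upwards [hgood] with x hx
      have := hx.2
      filter_upwards [hGae x hx.1 hx.2, ae_quantile_le (le_cdf_tilted hx.1 hδ)] with z hz hz2
      rwa [hqG _ hz])
    filter_upwards [h, hqZ] with ω h1 h2
    rwa [h2]

variable [StandardBorelSpace Ω₀]

/-- The exposure and outcome under the modified instrument have the law of the observed exposure
and outcome, reweighted by the density of the tilt. -/
theorem CausalAssumptions.map_tilt_eq (h : M.CausalAssumptions P₀) {δ : ℝ}
    (hcont : ∀ᵐ x ∂(M.lawX P₀), ∀ z : ℝ, M.instrLaw P₀ x {z} = 0)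
    (hα : ∀ᵐ x ∂(M.lawX P₀), 0 < trueα (M.condKernel P₀) δ x) :
    AEMeasurable (fun ω => M.exposureOutcome (M.Atilt P₀ δ ω) ω) P₀ ∧
    P₀.map (fun ω => M.exposureOutcome (M.Atilt P₀ δ ω) ω) =
      (P₀.withDensity fun ω => ENNReal.ofReal (M.weight P₀ δ ω)).map
        fun ω => (M.A ω, M.Y ω) := by
  obtain ⟨q, hq, hqZ, hqmap, -, -⟩ := exists_measurable_Ztilt hcont hα
  have hφ : Measurable fun p : Bool × Ω₀ => M.exposureOutcome p.1 p.2 :=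
    measurable_from_prod_countable_right M.measurable_exposureOutcome
  have hVs : Measurable fun p : ℝ × Ω₀ => M.exposureOutcome (M.Apot p.1 p.2) p.2 :=
    hφ.comp (M.measurable_Apot.prodMk measurable_snd)
  have hVq : Measurable fun ω => M.exposureOutcome (M.Apot (q (M.X ω, M.Z ω)) ω) ω :=
    hVs.comp ((hq.comp (M.measurable_X.prodMk M.measurable_Z)).prodMk measurable_id)
  have hVae : (fun ω => M.exposureOutcome (M.Atilt P₀ δ ω) ω) =ᵐ[P₀]
      fun ω => M.exposureOutcome (M.Apot (q (M.X ω, M.Z ω)) ω) ω := by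
    filter_upwards [hqZ] with ω hω
    rw [Atilt, hω]
  refine ⟨⟨_, hVq, hVae⟩, ?_⟩
  have hAY : Measurable fun ω => (M.A ω, M.Y ω) := M.measurable_A.prodMk M.measurable_Y
  rw [Measure.map_congr hVae]
  ext E hE
  rw [Measure.map_apply hVq hE, Measure.map_apply hAY hE, withDensity_apply _ (hAY hE),
    ← lintegral_indicator_one (hVq hE), ← lintegral_indicator (hAY hE)]
  set α : (Fin d → ℝ) → ℝ := fun x => ∫ z, Real.exp (δ * z) ∂(M.instrLaw P₀ x) with hαdef
  have hαm : Measurable α := by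
    have := measurable_trueα (κ := M.condKernel P₀) δ
    simpa only [funext (M.trueα_eq P₀ δ)] using this
  set f : (Fin d → ℝ) × ℝ → ℝ≥0∞ := fun p => ENNReal.ofReal (Real.exp (δ * p.2) / α p.1) with hf
  have hfm : Measurable f :=
    ((by fun_prop : Measurable fun p : (Fin d → ℝ) × ℝ => Real.exp (δ * p.2)).div
      (hαm.comp measurable_fst)).ennreal_ofReal
  have hatom : ∀ᵐ ω ∂P₀, ∀ c, M.instrKernel P₀ (M.X ω) {z | q (M.X ω, z) = c} = 0 := by
    filter_upwards [ae_X M P₀ hcont, ae_X M P₀ hqmap] with ω h1 h2 c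
    rw [instrKernel_apply]
    have h3 : M.tiltLaw P₀ δ (M.X ω) {c} = 0 := tilted_absolutelyContinuous _ _ (h1 c)
    have hqx : Measurable fun z => q (M.X ω, z) := hq.comp measurable_prodMk_left
    rwa [← h2, Measure.map_apply hqx (measurableSet_singleton c)] at h3
  have hatom2 : ∀ᵐ ω ∂P₀, ∀ c : ℝ, M.instrKernel P₀ (M.X ω) {z | z = c} = 0 := by
    filter_upwards [ae_X M P₀ hcont] with ω h1 c
    rw [instrKernel_apply]
    exact h1 c
  have hfi : ∫⁻ ω, f (M.X ω, M.Z ω) ∂P₀ ≠ ∞ := by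
    rw [M.lintegral_XZ P₀ hfm]
    refine ne_top_of_le_ne_top ENNReal.one_ne_top ?_
    calc _ ≤ ∫⁻ _ω, 1 ∂P₀ := by
          refine lintegral_mono_ae ((ae_X M P₀ hα).mono fun ω hω => ?_)
          have := isProbabilityMeasure_tilted (integrable_exp_of_pos hω)
          have h1 := lintegral_tilted (μ := M.instrLaw P₀ (M.X ω)) (fun z => δ * z) fun _ => 1
          simp only [lintegral_one, measure_univ, mul_one] at h1
          exact h1.symm.le
      _ = 1 := by simp
  -- the exchange is applied at `Z_δ`, and at `Z` itself with the density of the tilt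
  have e1 := lintegral_own_eq_fresh M.measurable_X M.measurable_Z M.measurable_Apot
    M.measurable_exposureOutcome h.lintegral_fresh measurable_fst (fun _ _ => rfl)
    h.monotonicity hq hatom (f := fun _ => 1) measurable_const (by simp) hE
  have e2 := lintegral_own_eq_fresh M.measurable_X M.measurable_Z M.measurable_Apot
    M.measurable_exposureOutcome h.lintegral_fresh measurable_fst (fun _ _ => rfl)
    h.monotonicity (q := Prod.snd) measurable_snd hatom2 hfm hfi hE
  simp only [mul_one] at e1
  calc _ = ∫⁻ ω, E.indicator 1 (M.exposureOutcome (M.Apot (q (M.X ω, M.Z ω)) ω) ω) ∂P₀ := rfl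
    _ = _ := e1
    _ = _ := by
        refine lintegral_congr_ae ?_
        filter_upwards [ae_X M P₀ hqmap] with ω hω
        have hm : Measurable fun z =>
            E.indicator (1 : Bool × ℝ → ℝ≥0∞) (M.exposureOutcome (M.Apot z ω) ω) :=
          (measurable_one.indicator hE).comp (hVs.comp measurable_prodMk_right)
        have hqx : Measurable fun z => q (M.X ω, z) := hq.comp measurable_prodMk_left
        rw [instrKernel_apply, ← lintegral_map hm hqx, hω, tiltLaw, lintegral_tilted]
        simp only [mul_comm]
        rfl
    _ = _ := e2.symm
    _ = _ := by
        refine lintegral_congr_ae ?_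
        filter_upwards [h.consistency] with ω hω
        simp only [hω.1, exposureOutcome, hω.2.2, hf, hαdef, weight_eq]
        by_cases hω' : (M.A ω, M.Y ω) ∈ E
        · rw [Set.indicator_of_mem hω', Set.indicator_of_mem
            (show ω ∈ (fun ω => (M.A ω, M.Y ω)) ⁻¹' E from hω'),
            Pi.one_apply, one_mul]
        · rw [Set.indicator_of_notMem hω', Set.indicator_of_notMem
            (show ω ∉ (fun ω => (M.A ω, M.Y ω)) ⁻¹' E from hω'),
            zero_mul]

end IVModel

/-! ### Identification of the tilted effect -/

theorem num_mem (a : Bool) : 0 ≤ num a ∧ num a ≤ 1 := by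
  cases a <;> simp [num]

theorem measurable_num : Measurable num := measurable_from_top

/-- The integral of `g` conditionally on `s`, as a ratio; both sides vanish when `s` is null. -/
theorem integral_cond_eq {Ω₀ : Type*} [MeasurableSpace Ω₀] (P : Measure Ω₀) (s : Set Ω₀)
    (g : Ω₀ → ℝ) : ∫ ω, g ω ∂(ProbabilityTheory.cond P s) = (∫ ω in s, g ω ∂P) / P.real s := by
  rw [ProbabilityTheory.cond, integral_smul_measure, ENNReal.toReal_inv, smul_eq_mul,
    inv_mul_eq_div]
  rfl

/-- If the exposure can only be switched on, from `f` to `g`, the mean effect among the switched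
units is the ratio of the mean changes in outcome and in exposure. -/
theorem integral_cond_switch {Ω₀ : Type*} [MeasurableSpace Ω₀] {P : Measure Ω₀}
    (Ya : Bool → Ω₀ → ℝ) {f g : Ω₀ → Bool} (hf : AEMeasurable f P) (hg : AEMeasurable g P)
    (hfg : ∀ᵐ ω ∂P, f ω ≤ g ω) :
    ∫ ω, (Ya true ω - Ya false ω) ∂(ProbabilityTheory.cond P {ω | f ω < g ω}) =
      (∫ ω, (Ya (g ω) ω - Ya (f ω) ω) ∂P) / ∫ ω, (num (g ω) - num (f ω)) ∂P := by
  have hC : NullMeasurableSet {ω | f ω < g ω} P := by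
    have : {ω | f ω < g ω} = f ⁻¹' {false} ∩ g ⁻¹' {true} := by
      ext ω
      simp [Bool.lt_iff]
    rw [this]
    exact (hf.nullMeasurableSet_preimage (measurableSet_singleton _)).inter
      (hg.nullMeasurableSet_preimage (measurableSet_singleton _))
  rw [integral_cond_eq]
  congr 1
  · rw [← integral_indicator₀ hC]
    refine integral_congr_ae ?_
    filter_upwards [hfg] with ω h
    simp only [Set.indicator, Set.mem_ofPred_eq]
    cases hA : f ω <;> cases hB : g ω <;> simp_all [Bool.lt_iff]
    exact absurd h (by decide)
  · rw [← setIntegral_one_eq_measureReal, ← integral_indicator₀ hC]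
    refine integral_congr_ae ?_
    filter_upwards [hfg] with ω h
    simp only [Set.indicator, Set.mem_ofPred_eq]
    cases hA : f ω <;> cases hB : g ω <;> simp_all [num, Bool.lt_iff]
    exact absurd h (by decide)

namespace IVModel

variable {d : ℕ} {Ω₀ : Type*} [MeasurableSpace Ω₀]
  {M : IVModel d Ω₀} {P₀ : Measure Ω₀} [IsProbabilityMeasure P₀]

theorem integrable_weight {δ : ℝ} (hα : ∀ᵐ x ∂(M.lawX P₀), 0 < trueα (M.condKernel P₀) δ x) :
    Integrable (M.weight P₀ δ) P₀ := by
  refine ⟨(M.measurable_weight P₀ δ).aestronglyMeasurable, ?_⟩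
  have hαm := measurable_trueα (κ := M.condKernel P₀) δ
  have hm : Measurable fun p : (Fin d → ℝ) × ℝ =>
      ENNReal.ofReal (Real.exp (δ * p.2) / trueα (M.condKernel P₀) δ p.1) :=
    ((by fun_prop : Measurable fun p : (Fin d → ℝ) × ℝ => Real.exp (δ * p.2)).div
      (hαm.comp measurable_fst)).ennreal_ofReal
  have h1 : ∫⁻ ω, ‖M.weight P₀ δ ω‖ₑ ∂P₀ = ∫⁻ ω, ENNReal.ofReal
      (Real.exp (δ * M.Z ω) / trueα (M.condKernel P₀) δ (M.X ω)) ∂P₀ :=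
    lintegral_congr fun ω => Real.enorm_eq_ofReal (M.weight_nonneg P₀ δ ω)
  rw [HasFiniteIntegral, h1, M.lintegral_XZ P₀ hm]
  calc _ ≤ ∫⁻ _ω, 1 ∂P₀ := by
        refine lintegral_mono_ae ((ae_X M P₀ hα).mono fun ω hω => ?_)
        have := isProbabilityMeasure_tilted (integrable_exp_of_pos hω)
        have h2 := lintegral_tilted (μ := M.instrLaw P₀ (M.X ω)) (fun z => δ * z) fun _ => 1
        simp only [lintegral_one, measure_univ, mul_one, ← trueα_eq] at h2
        exact h2.symm.le
    _ < ∞ := by simp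

theorem integrable_num_mul_weight {δ : ℝ}
    (hα : ∀ᵐ x ∂(M.lawX P₀), 0 < trueα (M.condKernel P₀) δ x) :
    Integrable (fun ω => num (M.A ω) * M.weight P₀ δ ω) P₀ := by
  refine (integrable_weight hα).bdd_mul (c := 1)
    (measurable_num.comp M.measurable_A).aestronglyMeasurable (ae_of_all _ fun ω => ?_)
  rw [Real.norm_eq_abs, abs_of_nonneg (num_mem _).1]
  exact (num_mem _).2

/-- The mean exposure in the relevance condition is the reweighted mean of the exposure. -/
theorem integral_treatReg {δ : ℝ} (hα : ∀ᵐ x ∂(M.lawX P₀), 0 < trueα (M.condKernel P₀) δ x) :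
    ∫ x, ∫ z, M.treatReg P₀ x z ∂(M.tiltLaw P₀ δ x) ∂(M.lawX P₀) =
      ∫ ω, num (M.A ω) * M.weight P₀ δ ω ∂P₀ := by
  have hXZ : Measurable fun ω => (M.X ω, M.Z ω) := M.measurable_X.prodMk M.measurable_Z
  have hαm := measurable_trueα (κ := M.condKernel P₀) δ
  set w : (Fin d → ℝ) × ℝ → ℝ := fun p => Real.exp (δ * p.2) / trueα (M.condKernel P₀) δ p.1
    with hw
  have hwm : Measurable w :=
    (by fun_prop : Measurable fun p : (Fin d → ℝ) × ℝ => Real.exp (δ * p.2)).div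
      (hαm.comp measurable_fst)
  set K := condDistrib M.A (fun ω => (M.X ω, M.Z ω)) P₀ with hK
  have hFm : Measurable fun p : ((Fin d → ℝ) × ℝ) × Bool => num p.2 * w p.1 :=
    (measurable_num.comp measurable_snd).mul (hwm.comp measurable_fst)
  have hF : Integrable (fun p : ((Fin d → ℝ) × ℝ) × Bool => num p.2 * w p.1)
      ((P₀.map fun ω => (M.X ω, M.Z ω)) ⊗ₘ K) := by
    rw [hK, compProd_map_condDistrib M.measurable_A.aemeasurable, integrable_map_measure
      hFm.aestronglyMeasurable (hXZ.prodMk M.measurable_A).aemeasurable]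
    exact integrable_num_mul_weight hα
  have h1 : ∫ ω, num (M.A ω) * M.weight P₀ δ ω ∂P₀ =
      ∫ p, num p.2 * w p.1 ∂((P₀.map fun ω => (M.X ω, M.Z ω)) ⊗ₘ K) := by
    rw [hK, compProd_map_condDistrib M.measurable_A.aemeasurable, integral_map
      (hXZ.prodMk M.measurable_A).aemeasurable hFm.aestronglyMeasurable]
    rfl
  rw [h1, Measure.integral_compProd hF]
  have h2 : ∀ p : (Fin d → ℝ) × ℝ, ∫ a, num a * w p ∂(K p) = w p * M.treatReg P₀ p.1 p.2 :=
    fun p => by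
      rw [integral_mul_const, mul_comm]
      rfl
  have hF2 : Integrable (fun p : (Fin d → ℝ) × ℝ => w p * M.treatReg P₀ p.1 p.2)
      (P₀.map fun ω => (M.X ω, M.Z ω)) :=
    hF.integral_compProd.congr (ae_of_all _ h2)
  simp only [h2]
  rw [M.map_XZ_eq_compProd] at hF2 ⊢
  rw [Measure.integral_compProd hF2]
  refine integral_congr_ae (ae_of_all _ fun x => ?_)
  simp only [instrKernel_apply, tiltLaw, integral_tilted, hw, trueα_eq, smul_eq_mul]

variable [StandardBorelSpace Ω₀]

theorem CausalAssumptions.ae_monotone (h : M.CausalAssumptions P₀) :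
    ∀ᵐ ω ∂P₀, ∀ z z' : ℝ, z ≤ z' → M.Apot z ω ≤ M.Apot z' ω := by
  filter_upwards [h.monotonicity] with ω hω z z' hz
  rcases hz.eq_or_lt with rfl | hlt
  · exact le_rfl
  · exact hω z z' hlt

/-- Identification of the numerator and the denominator of the tilted effect. -/
theorem CausalAssumptions.tiltedLATE_eq (h : M.CausalAssumptions P₀) {δ : ℝ}
    (hcont : ∀ᵐ x ∂(M.lawX P₀), ∀ z : ℝ, M.instrLaw P₀ x {z} = 0)
    (hα : ∀ᵐ x ∂(M.lawX P₀), 0 < trueα (M.condKernel P₀) δ x) (hY : Integrable M.Y P₀)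
    (hYw : Integrable (fun ω => M.Y ω * M.weight P₀ δ ω) P₀) :
    M.tiltedLATE P₀ δ =
      ((∫ ω, M.Y ω * M.weight P₀ δ ω ∂P₀) - ∫ ω, M.Y ω ∂P₀) /
        ((∫ ω, num (M.A ω) * M.weight P₀ δ ω ∂P₀) - ∫ ω, num (M.A ω) ∂P₀) := by
  obtain ⟨hVm, hmap⟩ := h.map_tilt_eq hcont hα
  obtain ⟨-, -, -, -, hle, hge⟩ := exists_measurable_Ztilt hcont hα
  set V : Ω₀ → Bool × ℝ := fun ω => M.exposureOutcome (M.Atilt P₀ δ ω) ω with hV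
  have hAY : Measurable fun ω => (M.A ω, M.Y ω) := M.measurable_A.prodMk M.measurable_Y
  have hwm : Measurable fun ω => (M.weight P₀ δ ω).toNNReal :=
    (M.measurable_weight P₀ δ).real_toNNReal
  have hdens : ∀ g : Ω₀ → ℝ, ∫ ω, g ω ∂(P₀.withDensity fun ω =>
      ENNReal.ofReal (M.weight P₀ δ ω)) = ∫ ω, g ω * M.weight P₀ δ ω ∂P₀ := fun g => by
    have := integral_withDensity_eq_integral_smul (μ := P₀) hwm g
    rw [show (fun ω => ENNReal.ofReal (M.weight P₀ δ ω)) =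
      fun ω => (((M.weight P₀ δ ω).toNNReal : NNReal) : ℝ≥0∞) from rfl, this]
    refine integral_congr_ae (ae_of_all _ fun ω => ?_)
    simp only [NNReal.smul_def, smul_eq_mul, Real.coe_toNNReal _ (M.weight_nonneg P₀ δ ω)]
    ring
  -- the law of exposure and outcome under the modified instrument
  have hint : ∀ g : Bool × ℝ → ℝ, Measurable g →
      ∫ ω, g (V ω) ∂P₀ = ∫ ω, g (M.A ω, M.Y ω) * M.weight P₀ δ ω ∂P₀ := fun g hg => by
    rw [← integral_map hVm hg.aestronglyMeasurable, hmap,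
      integral_map hAY.aemeasurable hg.aestronglyMeasurable, hdens]
  have hVY : Integrable (fun ω => (V ω).2) P₀ := by
    have h1 : Integrable (fun p : Bool × ℝ => p.2) (P₀.map V) := by
      rw [hmap, integrable_map_measure measurable_snd.aestronglyMeasurable hAY.aemeasurable]
      rw [show (fun ω => ENNReal.ofReal (M.weight P₀ δ ω)) =
        fun ω => (((M.weight P₀ δ ω).toNNReal : NNReal) : ℝ≥0∞) from rfl,
        integrable_withDensity_iff_integrable_smul hwm]
      refine hYw.congr (ae_of_all _ fun ω => ?_)
      simp only [NNReal.smul_def, smul_eq_mul, Real.coe_toNNReal _ (M.weight_nonneg P₀ δ ω),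
        Function.comp_apply]
      ring
    exact (integrable_map_measure measurable_snd.aestronglyMeasurable hVm).1 h1
  have hnumA : ∀ {f : Ω₀ → Bool}, AEMeasurable f P₀ → Integrable (fun ω => num (f ω)) P₀ :=
    fun hf => Integrable.of_bound (C := 1)
      (measurable_num.comp_aemeasurable hf).aestronglyMeasurable (ae_of_all _ fun ω => by
        rw [Real.norm_eq_abs, abs_of_nonneg (num_mem _).1]
        exact (num_mem _).2)
  have hAt : AEMeasurable (M.Atilt P₀ δ) P₀ := measurable_fst.comp_aemeasurable hVm
  have hYeq := hint _ measurable_snd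
  have hAeq := hint _ (measurable_num.comp measurable_fst)
  simp only [Function.comp_apply] at hAeq
  rw [← hYeq, ← hAeq, ← integral_sub hVY hY,
    ← integral_sub (hnumA (f := fun ω => (V ω).1) hAt) (hnumA M.measurable_A.aemeasurable)]
  have hmono := h.ae_monotone
  rw [tiltedLATE]
  split_ifs with hδ
  · rw [integral_cond_switch _ M.measurable_A.aemeasurable hAt (by
      filter_upwards [hmono, hle hδ.le, h.consistency] with ω h1 h2 h3
      rw [← h3.1]
      exact h1 _ _ h2)]
    congr 1
    refine integral_congr_ae ?_
    filter_upwards [h.consistency] with ω h2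
    rw [← h2.2.2]
    rfl
  · rw [integral_cond_switch _ hAt M.measurable_A.aemeasurable (by
      filter_upwards [hmono, hge (not_lt.1 hδ), h.consistency] with ω h1 h2 h3
      rw [← h3.1]
      exact h1 _ _ h2), ← neg_div_neg_eq, ← integral_neg, ← integral_neg]
    congr 1
    · refine integral_congr_ae ?_
      filter_upwards [h.consistency] with ω h2
      rw [neg_sub, ← h2.2.2]
      rfl
    · refine integral_congr_ae (ae_of_all _ fun ω => ?_)
      exact neg_sub _ _

end IVModel

/-! ### Normalizing constant, effect and variance as functions of the tilt -/

section LipschitzFamily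

variable {𝒪 : Type*} [MeasurableSpace 𝒪] {P : Measure 𝒪} {D : Set ℝ}
  {f g : ℝ → 𝒪 → ℝ} {L K : 𝒪 → ℝ}

theorem ae_continuousOn_of_lipschitz
    (hLip : ∀ᵐ o ∂P, ∀ δ ∈ D, ∀ δ' ∈ D, |f δ o - f δ' o| ≤ L o * |δ - δ'|) :
    ∀ᵐ o ∂P, ContinuousOn (fun δ => f δ o) D := by
  filter_upwards [hLip] with o ho
  have : LipschitzOnWith (Real.toNNReal (L o)) (fun δ => f δ o) D := by
    refine LipschitzOnWith.of_dist_le_mul fun x hx y hy => ?_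
    rw [Real.dist_eq, Real.dist_eq]
    refine (ho x hx y hy).trans ?_
    gcongr
    exact Real.le_coe_toNNReal _
  exact this.continuousOn

/-- A Lipschitz family over a bounded set of parameters has a square-integrable envelope. -/
theorem exists_envelope_of_lipschitz {a b : ℝ} (hD : D ⊆ Set.Icc a b)
    (hf : ∀ δ ∈ D, MemLp (f δ) 2 P) (hL : MemLp L 2 P)
    (hLip : ∀ᵐ o ∂P, ∀ δ ∈ D, ∀ δ' ∈ D, |f δ o - f δ' o| ≤ L o * |δ - δ'|) :
    ∃ F : 𝒪 → ℝ, MemLp F 2 P ∧ ∀ᵐ o ∂P, ∀ δ ∈ D, |f δ o| ≤ F o := by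
  rcases D.eq_empty_or_nonempty with rfl | ⟨δ₀, hδ₀⟩
  · exact ⟨0, MemLp.zero, ae_of_all _ fun o δ hδ => hδ.elim⟩
  refine ⟨fun o => |f δ₀ o| + (b - a) * |L o|, (hf δ₀ hδ₀).abs.add (hL.abs.const_mul _), ?_⟩
  filter_upwards [hLip] with o ho δ hδ
  have h1 := ho δ hδ δ₀ hδ₀
  have h2 : |δ - δ₀| ≤ b - a := by
    rw [abs_le]
    constructor <;> linarith [(hD hδ).1, (hD hδ).2, (hD hδ₀).1, (hD hδ₀).2]
  have h3 : L o * |δ - δ₀| ≤ (b - a) * |L o| := by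
    rw [mul_comm]
    exact (mul_le_mul_of_nonneg_left (le_abs_self _) (abs_nonneg _)).trans
      (mul_le_mul_of_nonneg_right h2 (abs_nonneg _))
  have h4 := abs_sub_abs_le_abs_sub (f δ o) (f δ₀ o)
  linarith

theorem continuousOn_integral_of_lipschitz [IsProbabilityMeasure P] {a b : ℝ} (hD : D ⊆ Set.Icc a b)
    (hf : ∀ δ ∈ D, MemLp (f δ) 2 P) (hL : MemLp L 2 P)
    (hLip : ∀ᵐ o ∂P, ∀ δ ∈ D, ∀ δ' ∈ D, |f δ o - f δ' o| ≤ L o * |δ - δ'|) :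
    ContinuousOn (fun δ => ∫ o, f δ o ∂P) D := by
  obtain ⟨F, hF, hfF⟩ := exists_envelope_of_lipschitz hD hf hL hLip
  refine continuousOn_of_dominated (bound := F) (fun δ hδ => (hf δ hδ).1) (fun δ hδ => ?_)
    (hF.integrable (by norm_num)) (ae_continuousOn_of_lipschitz hLip)
  filter_upwards [hfF] with o ho
  exact ho δ hδ

/-- The second moment of `f - ψ g` depends continuously on the parameter. -/
theorem continuousOn_integral_sq_of_lipschitz (hDc : IsCompact D) {a b : ℝ}
    (hD : D ⊆ Set.Icc a b) (hf : ∀ δ ∈ D, MemLp (f δ) 2 P) (hg : ∀ δ ∈ D, MemLp (g δ) 2 P)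
    (hL : MemLp L 2 P) (hK : MemLp K 2 P)
    (hfLip : ∀ᵐ o ∂P, ∀ δ ∈ D, ∀ δ' ∈ D, |f δ o - f δ' o| ≤ L o * |δ - δ'|)
    (hgLip : ∀ᵐ o ∂P, ∀ δ ∈ D, ∀ δ' ∈ D, |g δ o - g δ' o| ≤ K o * |δ - δ'|)
    {ψ : ℝ → ℝ} (hψ : ContinuousOn ψ D) :
    ContinuousOn (fun δ => ∫ o, (f δ o - ψ δ * g δ o) ^ 2 ∂P) D := by
  obtain ⟨F, hF, hfF⟩ := exists_envelope_of_lipschitz hD hf hL hfLip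
  obtain ⟨G, hG, hgG⟩ := exists_envelope_of_lipschitz hD hg hK hgLip
  obtain ⟨Ψ, hΨ⟩ := hDc.exists_bound_of_continuousOn hψ
  have hFG : MemLp (fun o => F o + Ψ * G o) 2 P := hF.add (hG.const_mul _)
  refine continuousOn_of_dominated (bound := fun o => (F o + Ψ * G o) ^ 2)
    (fun δ hδ => (((hf δ hδ).1.sub ((hg δ hδ).1.const_mul _)).pow 2)) (fun δ hδ => ?_)
    hFG.integrable_sq ?_
  · filter_upwards [hfF, hgG] with o h1 h2
    have h3 : |f δ o - ψ δ * g δ o| ≤ F o + Ψ * G o := by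
      refine (abs_sub _ _).trans (add_le_add (h1 δ hδ) ?_)
      rw [abs_mul]
      exact mul_le_mul (hΨ δ hδ) (h2 δ hδ) (abs_nonneg _) ((norm_nonneg _).trans (hΨ δ hδ))
    rw [Real.norm_eq_abs, abs_pow]
    gcongr
  · filter_upwards [ae_continuousOn_of_lipschitz hfLip, ae_continuousOn_of_lipschitz hgLip]
      with o h1 h2
    exact (h1.sub (hψ.mul h2)).pow 2

theorem exists_pos_le_of_continuousOn (hD : IsCompact D) {c : ℝ → ℝ} (hc : ContinuousOn c D)
    (hpos : ∀ δ ∈ D, 0 < c δ) : ∃ c₀, 0 < c₀ ∧ ∀ δ ∈ D, c₀ ≤ c δ := by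
  rcases D.eq_empty_or_nonempty with rfl | hne
  · exact ⟨1, one_pos, fun δ hδ => hδ.elim⟩
  obtain ⟨δ₀, hδ₀, hmin⟩ := hD.exists_isMinOn hne hc
  exact ⟨c δ₀, hpos δ₀ hδ₀, fun δ hδ => hmin hδ⟩

end LipschitzFamily

/-- The outcome as a function of `(Z, A, Y)`. -/
def outcomeVar (w : ℝ × Bool × ℝ) : ℝ := w.2.2

/-- The exposure as a function of `(Z, A, Y)`. -/
def exposureVar (w : ℝ × Bool × ℝ) : ℝ := num w.2.1

theorem measurable_outcomeVar : Measurable outcomeVar := measurable_snd.comp measurable_snd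

theorem measurable_exposureVar : Measurable exposureVar :=
  measurable_num.comp (measurable_fst.comp measurable_snd)

namespace IVModel

variable {d : ℕ} {Ω₀ : Type*} [MeasurableSpace Ω₀]
  {M : IVModel d Ω₀} {P₀ : Measure Ω₀} [IsProbabilityMeasure P₀] {δ : ℝ}

variable (M P₀) in
/-- The conditional moment condition at the tilt `δ`. -/
def TiltMoment (δ : ℝ) : Prop := ∃ C : ℝ, ∀ᵐ x ∂(M.lawX P₀),
  ∫⁻ w, ENNReal.ofReal ((1 + w.2.2 ^ 2) * Real.exp (δ * w.1) ^ 2) ∂(M.condLaw P₀ x) ≤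
    ENNReal.ofReal (C * (M.nuisance P₀).α δ x ^ 2)

theorem TiltMoment.tiltBounds (h : M.TiltMoment P₀ δ) : ∃ C, ∀ᵐ x ∂(M.lawX P₀),
    TiltBounds (M.condKernel P₀ x) (expTilt δ) outcomeVar C ∧
      TiltBounds (M.condKernel P₀ x) (expTilt δ) exposureVar C := by
  obtain ⟨C, hC⟩ := h
  refine ⟨max C 0, hC.mono fun x hx => ?_⟩
  have hx' : ∫⁻ w, ENNReal.ofReal ((1 + w.2.2 ^ 2) * expTilt δ w ^ 2) ∂(M.condKernel P₀ x) ≤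
      ENNReal.ofReal (max C 0 * (∫ w, expTilt δ w ∂(M.condKernel P₀ x)) ^ 2) :=
    hx.trans (ENNReal.ofReal_le_ofReal (mul_le_mul_of_nonneg_right (le_max_left _ _)
      (sq_nonneg _)))
  have hs : ∀ w : ℝ × Bool × ℝ, 1 ≤ 1 + w.2.2 ^ 2 := fun w => by nlinarith [sq_nonneg w.2.2]
  refine ⟨_root_.tiltBounds (measurable_expTilt δ) (expTilt_pos δ) hs measurable_outcomeVar
    (fun w => ?_) (le_max_right _ _) hx', _root_.tiltBounds (measurable_expTilt δ) (expTilt_pos δ)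
    hs measurable_exposureVar (fun w => ?_) (le_max_right _ _) hx'⟩
  · simp [outcomeVar]
  · have h1 := num_mem w.2.1
    simp only [exposureVar]
    nlinarith [sq_nonneg w.2.2]

theorem TiltMoment.tiltBounds_outcome (h : M.TiltMoment P₀ δ) : ∃ C, ∀ᵐ x ∂(M.lawX P₀),
    TiltBounds (M.condKernel P₀ x) (expTilt δ) outcomeVar C :=
  h.tiltBounds.imp fun _ hC => hC.mono fun _ hx => hx.1

theorem TiltMoment.tiltBounds_exposure (h : M.TiltMoment P₀ δ) : ∃ C, ∀ᵐ x ∂(M.lawX P₀),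
    TiltBounds (M.condKernel P₀ x) (expTilt δ) exposureVar C :=
  h.tiltBounds.imp fun _ hC => hC.mono fun _ hx => hx.2

theorem TiltMoment.ae_pos (h : M.TiltMoment P₀ δ) :
    ∀ᵐ x ∂(M.lawX P₀), 0 < trueα (M.condKernel P₀) δ x := by
  obtain ⟨C, hC⟩ := h.tiltBounds
  exact hC.mono fun x hx => hx.1.pos

theorem integral_law {f : Obs d → ℝ} (hf : Measurable f) :
    ∫ o, f o ∂(M.lawX P₀ ⊗ₘ M.condKernel P₀) = ∫ ω, f (M.obs ω) ∂P₀ := by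
  rw [← M.law_eq_compProd, law, integral_map M.measurable_obs.aemeasurable
    hf.aestronglyMeasurable]

theorem integral_law_var {t : ℝ × Bool × ℝ → ℝ} (ht : Measurable t) :
    ∫ o : Obs d, t o.2 ∂(M.lawX P₀ ⊗ₘ M.condKernel P₀) = ∫ ω, t (M.obs ω).2 ∂P₀ :=
  integral_law (f := fun o => t o.2) (ht.comp measurable_snd)

theorem integral_law_mul_weight {t : ℝ × Bool × ℝ → ℝ} (ht : Measurable t) :
    ∫ o : Obs d, t o.2 * tiltWeight (M.condKernel P₀) (expTilt δ) o
      ∂(M.lawX P₀ ⊗ₘ M.condKernel P₀) = ∫ ω, t (M.obs ω).2 * M.weight P₀ δ ω ∂P₀ :=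
  integral_law (f := fun o => t o.2 * tiltWeight (M.condKernel P₀) (expTilt δ) o)
    ((ht.comp measurable_snd).mul (measurable_tiltWeight (measurable_expTilt δ)))

theorem memLp_law {f : Obs d → ℝ} (hf : Measurable f) :
    MemLp f 2 (M.lawX P₀ ⊗ₘ M.condKernel P₀) ↔ MemLp (fun ω => f (M.obs ω)) 2 P₀ := by
  rw [← M.law_eq_compProd, law, memLp_map_measure_iff hf.aestronglyMeasurable
    M.measurable_obs.aemeasurable]
  rfl

theorem memLp_outcomeVar (hY : MemLp M.Y 2 P₀) :
    MemLp (fun o : Obs d => outcomeVar o.2) 2 (M.lawX P₀ ⊗ₘ M.condKernel P₀) :=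
  (memLp_law (measurable_outcomeVar.comp measurable_snd)).2 hY

theorem memLp_exposureVar :
    MemLp (fun o : Obs d => exposureVar o.2) 2 (M.lawX P₀ ⊗ₘ M.condKernel P₀) :=
  MemLp.of_bound (measurable_exposureVar.comp measurable_snd).aestronglyMeasurable 1
    (ae_of_all _ fun o => by
      rw [Real.norm_eq_abs, exposureVar, abs_of_nonneg (num_mem _).1]
      exact (num_mem _).2)

theorem TiltMoment.memLp_thetaY (h : M.TiltMoment P₀ δ) (hY : MemLp M.Y 2 P₀) :
    MemLp ((M.nuisance P₀).ThetaY δ) 2 (M.law P₀) := by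
  obtain ⟨C, hC⟩ := h.tiltBounds_outcome
  rw [M.law_eq_compProd]
  exact memLp_contrast measurable_outcomeVar (memLp_outcomeVar hY) hC

theorem TiltMoment.memLp_thetaA (h : M.TiltMoment P₀ δ) :
    MemLp ((M.nuisance P₀).ThetaA δ) 2 (M.law P₀) := by
  obtain ⟨C, hC⟩ := h.tiltBounds_exposure
  rw [M.law_eq_compProd]
  exact memLp_contrast measurable_exposureVar memLp_exposureVar hC

theorem TiltMoment.integral_thetaY (h : M.TiltMoment P₀ δ) (hY : MemLp M.Y 2 P₀) :
    ∫ o, (M.nuisance P₀).ThetaY δ o ∂(M.law P₀) =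
      (∫ ω, M.Y ω * M.weight P₀ δ ω ∂P₀) - ∫ ω, M.Y ω ∂P₀ := by
  obtain ⟨C, hC⟩ := h.tiltBounds_outcome
  have h1 := integral_contrast measurable_outcomeVar (memLp_outcomeVar hY) hC
  rw [integral_law_mul_weight measurable_outcomeVar, integral_law_var measurable_outcomeVar] at h1
  rw [M.law_eq_compProd]
  exact h1

theorem TiltMoment.integral_thetaA (h : M.TiltMoment P₀ δ) :
    ∫ o, (M.nuisance P₀).ThetaA δ o ∂(M.law P₀) =
      (∫ ω, num (M.A ω) * M.weight P₀ δ ω ∂P₀) - ∫ ω, num (M.A ω) ∂P₀ := by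
  obtain ⟨C, hC⟩ := h.tiltBounds_exposure
  have h1 := integral_contrast measurable_exposureVar memLp_exposureVar hC
  rw [integral_law_mul_weight measurable_exposureVar, integral_law_var measurable_exposureVar] at h1
  rw [M.law_eq_compProd]
  exact h1

theorem integrable_num_A : Integrable (fun ω => num (M.A ω)) P₀ :=
  Integrable.of_bound (C := 1) (measurable_num.comp M.measurable_A).aestronglyMeasurable
    (ae_of_all _ fun ω => by
      rw [Real.norm_eq_abs, abs_of_nonneg (num_mem _).1]
      exact (num_mem _).2)

/-- The normalizing constant is the change of the mean exposure under the reweighting. -/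
theorem TiltMoment.denom_eq (h : M.TiltMoment P₀ δ) :
    M.denom P₀ δ = (∫ ω, num (M.A ω) * M.weight P₀ δ ω ∂P₀) - ∫ ω, num (M.A ω) ∂P₀ := by
  obtain ⟨C, hC⟩ := h.tiltBounds_exposure
  obtain ⟨h1, h2⟩ := integral_trueγ measurable_exposureVar hC
  have hm := measurable_trueγ (κ := M.condKernel P₀) measurable_exposureVar δ
  rw [integral_law_mul_weight measurable_exposureVar] at h2
  have h3 : ∫ ω, (M.nuisance P₀).γA δ (M.X ω) ∂P₀ =
      ∫ ω, num (M.A ω) * M.weight P₀ δ ω ∂P₀ := by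
    rw [← integral_map (φ := M.X) M.measurable_X.aemeasurable (f := (M.nuisance P₀).γA δ)
      hm.aestronglyMeasurable]
    exact h2
  rw [denom, integral_sub ?_ integrable_num_A, h3]
  exact (integrable_map_measure hm.aestronglyMeasurable M.measurable_X.aemeasurable).1 h1

theorem TiltMoment.denom_ne_zero (h : M.TiltMoment P₀ δ) (hrel : M.Relevance P₀ δ) :
    M.denom P₀ δ ≠ 0 := by
  rw [h.denom_eq, sub_ne_zero, ← integral_treatReg h.ae_pos]
  exact hrel

theorem TiltMoment.integral_thetaA_div (h : M.TiltMoment P₀ δ) (hrel : M.Relevance P₀ δ) :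
    ∫ o, (M.nuisance P₀).ThetaA δ o / M.denom P₀ δ ∂(M.law P₀) = 1 := by
  rw [integral_div, h.integral_thetaA, ← h.denom_eq, div_self (h.denom_ne_zero hrel)]

theorem TiltMoment.integral_thetaY_div [StandardBorelSpace Ω₀] (h : M.TiltMoment P₀ δ)
    (hcausal : M.CausalAssumptions P₀)
    (hcont : ∀ᵐ x ∂(M.lawX P₀), ∀ z : ℝ, M.instrLaw P₀ x {z} = 0) (hY : MemLp M.Y 2 P₀) :
    ∫ o, (M.nuisance P₀).ThetaY δ o / M.denom P₀ δ ∂(M.law P₀) = M.tiltedLATE P₀ δ := by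
  obtain ⟨C, hC⟩ := h.tiltBounds_outcome
  have hYw : MemLp (fun ω => M.Y ω * M.weight P₀ δ ω) 2 P₀ :=
    (memLp_law ((measurable_outcomeVar.comp measurable_snd).mul
      (measurable_tiltWeight (measurable_expTilt δ)))).1
      (memLp_mul_tiltWeight measurable_outcomeVar hC)
  rw [integral_div, h.integral_thetaY hY, h.denom_eq, hcausal.tiltedLATE_eq hcont h.ae_pos
    (hY.integrable (by norm_num)) (hYw.integrable (by norm_num))]

theorem trueγ_exposure_mem (x : Fin d → ℝ) :
    0 ≤ trueγ (M.condKernel P₀) exposureVar δ x ∧ trueγ (M.condKernel P₀) exposureVar δ x ≤ 1 := by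
  have h0 : 0 ≤ ∫ w, exposureVar w * expTilt δ w ∂(M.condKernel P₀ x) :=
    integral_nonneg fun w => mul_nonneg (num_mem _).1 (expTilt_pos δ w).le
  have h1 : 0 ≤ ∫ w, expTilt δ w ∂(M.condKernel P₀ x) :=
    integral_nonneg fun w => (expTilt_pos δ w).le
  refine ⟨div_nonneg h0 h1, ?_⟩
  by_cases hi : Integrable (expTilt δ) (M.condKernel P₀ x)
  · refine div_le_one_of_le₀ (integral_mono_of_nonneg
      (ae_of_all _ fun w => mul_nonneg (num_mem _).1 (expTilt_pos δ w).le) hi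
      (ae_of_all _ fun w => ?_)) h1
    exact mul_le_of_le_one_left (expTilt_pos δ w).le (num_mem _).2
  · rw [trueγ, tiltReg, integral_undef hi, div_zero]
    exact zero_le_one

theorem integrable_expTilt_of_pos {x : Fin d → ℝ} (h : 0 < trueα (M.condKernel P₀) δ x) :
    Integrable (expTilt δ) (M.condKernel P₀ x) := by
  by_contra hi
  rw [trueα, integral_undef hi] at h
  exact lt_irrefl _ h

/-- On a compact set of tilts the weights are dominated by those at its extreme points, so the
normalizing constant is continuous. -/
theorem continuousOn_denom {D : Set ℝ} (hD : IsCompact D)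
    (hpos : ∀ δ ∈ D, ∀ᵐ x ∂(M.lawX P₀), 0 < trueα (M.condKernel P₀) δ x) :
    ContinuousOn (M.denom P₀) D := by
  rcases D.eq_empty_or_nonempty with rfl | hne
  · exact continuousOn_empty _
  obtain ⟨m, hm, hmin⟩ := hD.exists_isLeast hne
  obtain ⟨m', hm', hmax⟩ := hD.exists_isGreatest hne
  have hγm : ∀ δ, Measurable fun ω => (M.nuisance P₀).γA δ (M.X ω) := fun δ =>
    (measurable_trueγ (κ := M.condKernel P₀) measurable_exposureVar δ).comp M.measurable_X
  refine continuousOn_of_dominated (bound := fun _ => 1)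
    (fun δ _ => ((hγm δ).sub (measurable_num.comp M.measurable_A)).aestronglyMeasurable)
    (fun δ _ => ae_of_all _ fun ω => ?_) (integrable_const _) ?_
  · have h1 := trueγ_exposure_mem (M := M) (P₀ := P₀) (δ := δ) (M.X ω)
    have h2 := num_mem (M.A ω)
    change |trueγ (M.condKernel P₀) exposureVar δ (M.X ω) - num (M.A ω)| ≤ 1
    rw [abs_le]
    constructor <;> linarith [h1.1, h1.2, h2.1, h2.2]
  filter_upwards [ae_X M P₀ (hpos m hm), ae_X M P₀ (hpos m' hm')] with ω h1 h2
  have hdom : Integrable (fun w => expTilt m w + expTilt m' w) (M.condKernel P₀ (M.X ω)) :=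
    (integrable_expTilt_of_pos h1).add (integrable_expTilt_of_pos h2)
  have hle : ∀ δ ∈ D, ∀ w, expTilt δ w ≤ expTilt m w + expTilt m' w := by
    intro δ hδ w
    rcases le_total 0 w.1 with hw | hw
    · have : expTilt δ w ≤ expTilt m' w :=
        Real.exp_le_exp.2 (mul_le_mul_of_nonneg_right (hmax hδ) hw)
      linarith [expTilt_pos m w]
    · have : expTilt δ w ≤ expTilt m w :=
        Real.exp_le_exp.2 (mul_le_mul_of_nonpos_right (hmin hδ) hw)
      linarith [expTilt_pos m' w]
  have hcexp : ∀ w, Continuous fun δ => expTilt δ w := fun w => by unfold expTilt; fun_prop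
  have hα : ContinuousOn (fun δ => ∫ w, expTilt δ w ∂(M.condKernel P₀ (M.X ω))) D := by
    refine continuousOn_of_dominated
      (fun δ _ => (measurable_expTilt δ).aestronglyMeasurable) (fun δ hδ => ae_of_all _ fun w => ?_)
      hdom (ae_of_all _ fun w => (hcexp w).continuousOn)
    rw [Real.norm_of_nonneg (expTilt_pos δ w).le]
    exact hle δ hδ w
  have hβ : ContinuousOn
      (fun δ => ∫ w, exposureVar w * expTilt δ w ∂(M.condKernel P₀ (M.X ω))) D := by
    refine continuousOn_of_dominated
      (fun δ _ => (measurable_exposureVar.mul (measurable_expTilt δ)).aestronglyMeasurable)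
      (fun δ hδ => ae_of_all _ fun w => ?_)
      hdom (ae_of_all _ fun w => ((hcexp w).const_mul _).continuousOn)
    rw [exposureVar, Real.norm_of_nonneg (mul_nonneg (num_mem _).1 (expTilt_pos δ w).le)]
    exact (mul_le_of_le_one_left (expTilt_pos δ w).le (num_mem _).2).trans (hle δ hδ w)
  refine (hβ.div hα fun δ hδ => ?_).sub continuousOn_const
  have hi : Integrable (expTilt δ) (M.condKernel P₀ (M.X ω)) :=
    hdom.mono' (measurable_expTilt δ).aestronglyMeasurable (ae_of_all _ fun w => by
      rw [Real.norm_of_nonneg (expTilt_pos δ w).le]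
      exact hle δ hδ w)
  exact (integral_exp_pos hi).ne'

end IVModel

/-! ### Uniform asymptotic linearity -/

theorem ofReal_lt_iSup_iff {D : Set ℝ} {F : ℝ → ℝ} {τ : ℝ} (hτ : 0 < τ) :
    ENNReal.ofReal (τ * 1) < ⨆ δ ∈ D, ENNReal.ofReal |F δ| ↔ ∃ δ ∈ D, τ < |F δ| := by
  simp only [mul_one, lt_iSup_iff, exists_prop, ENNReal.ofReal_lt_ofReal_iff_of_nonneg hτ.le]

theorem empMean_div {d : ℕ} {Ω : Type*} (O : ℕ → Ω → Obs d) (n : ℕ) (ω : Ω) (f : Obs d → ℝ)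
    (c : ℝ) : empMean O n ω (fun o => f o / c) = empMean O n ω f / c := by
  simp only [empMean, div_eq_mul_inv, ← Finset.sum_mul, mul_assoc]

namespace IVModel

variable {d : ℕ} {Ω₀ : Type*} [MeasurableSpace Ω₀]
  {M : IVModel d Ω₀} {P₀ : Measure Ω₀} [IsProbabilityMeasure P₀]

theorem phi_zero (δ : ℝ) (η : Nuisance d) (o : Obs d) :
    M.phi P₀ δ η 0 o = η.ThetaY δ o / M.denom P₀ δ := by
  simp [phi]

theorem phi_zero_sub_phi_one (δ : ℝ) (η : Nuisance d) (o : Obs d) :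
    M.phi P₀ δ η 0 o - M.phi P₀ δ η 1 o = η.ThetaA δ o / M.denom P₀ δ := by
  simp only [phi]
  ring

theorem measurable_thetaY (δ : ℝ) : Measurable ((M.nuisance P₀).ThetaY δ) :=
  (measurable_contrast (T := Unit) measurable_outcomeVar
    (α := fun _ => trueα (M.condKernel P₀)) (γ := fun _ => trueγ (M.condKernel P₀) outcomeVar)
    (fun δ => (measurable_trueα δ).comp measurable_snd)
    (fun δ => (measurable_trueγ measurable_outcomeVar δ).comp measurable_snd) δ).comp
    (measurable_prodMk_left (x := ()))

theorem measurable_thetaA (δ : ℝ) : Measurable ((M.nuisance P₀).ThetaA δ) :=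
  (measurable_contrast (T := Unit) measurable_exposureVar
    (α := fun _ => trueα (M.condKernel P₀)) (γ := fun _ => trueγ (M.condKernel P₀) exposureVar)
    (fun δ => (measurable_trueα δ).comp measurable_snd)
    (fun δ => (measurable_trueγ measurable_exposureVar δ).comp measurable_snd) δ).comp
    (measurable_prodMk_left (x := ()))

end IVModel

end

theorem theorem3
    -- the population: observed variables, counterfactuals, and the causal conditions
    {d : ℕ} {Ω₀ : Type*} [MeasurableSpace Ω₀] [StandardBorelSpace Ω₀]
    (P₀ : Measure Ω₀) [IsProbabilityMeasure P₀] (M : IVModel d Ω₀)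
    (hcausal : M.CausalAssumptions P₀)
    -- the instrument is continuous given the covariates
    (hcont : ∀ᵐ x ∂(M.lawX P₀), ∀ z : ℝ, M.instrLaw P₀ x {z} = 0)
    -- the range of tilts
    (D : Set ℝ) (hD : IsCompact D)
    (hrel : ∀ δ ∈ D, M.Relevance P₀ δ)
    (hsigma : ∀ δ ∈ D, 0 < M.sigma P₀ δ)
    -- moments
    (hY : MemLp M.Y 2 P₀)
    (hmom : ∀ δ ∈ D, ∃ C : ℝ, ∀ᵐ x ∂(M.lawX P₀),
      ∫⁻ w, ENNReal.ofReal ((1 + w.2.2 ^ 2) * Real.exp (δ * w.1) ^ 2) ∂(M.condLaw P₀ x) ≤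
        ENNReal.ofReal (C * (M.nuisance P₀).α δ x ^ 2))
    -- the iid sample, and the separate sample from which the nuisance functions are estimated
    {Ω : Type*} [MeasurableSpace Ω] (μ : Measure Ω) [IsProbabilityMeasure μ]
    (O : ℕ → Ω → Obs d) (hOmeas : ∀ i, Measurable (O i)) (hOindep : iIndepFun O μ)
    (hOlaw : ∀ i, μ.map (O i) = M.law P₀)
    {T : ℕ → Type*} [∀ n, MeasurableSpace (T n)]
    (S : (n : ℕ) → Ω → T n) (hSmeas : ∀ n, Measurable (S n))
    (hSindep : ∀ n, IndepFun (S n) (fun ω (i : Fin n) => O i ω) μ)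
    (ηhat : (n : ℕ) → T n → Nuisance d)
    (hαmeas : ∀ n δ, Measurable fun p : T n × (Fin d → ℝ) => (ηhat n p.1).α δ p.2)
    (hγYmeas : ∀ n δ, Measurable fun p : T n × (Fin d → ℝ) => (ηhat n p.1).γY δ p.2)
    (hγAmeas : ∀ n δ, Measurable fun p : T n × (Fin d → ℝ) => (ηhat n p.1).γA δ p.2)
    (hα0 : ∀ n s x, (ηhat n s).α 0 x = 1)
    -- consistency of the nuisance estimators at each tilt
    (hcons : ∀ δ ∈ D, IsLittleOP μ (fun n ω => M.errα P₀ (ηhat n (S n ω)) δ +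
      M.errY P₀ (ηhat n (S n ω)) δ + M.errA P₀ (ηhat n (S n ω)) δ) (fun _ => 1))
    -- (i) the influence function is Lipschitz in the tilt, at the true and estimated nuisances
    (hLip : ∀ p : ℝ, ∃ L : Obs d → ℝ, MemLp L 2 (M.law P₀) ∧
      (∀ᵐ o ∂(M.law P₀), ∀ δ ∈ D, ∀ δ' ∈ D,
        |M.phi P₀ δ (M.nuisance P₀) p o - M.phi P₀ δ' (M.nuisance P₀) p o| ≤ L o * |δ - δ'|) ∧
      ∀ n, ∀ᵐ so ∂((μ.map (S n)).prod (M.law P₀)), ∀ δ ∈ D, ∀ δ' ∈ D,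
        |M.phi P₀ δ (ηhat n so.1) p so.2 - M.phi P₀ δ' (ηhat n so.1) p so.2| ≤
          L so.2 * |δ - δ'|)
    -- (ii) the variance estimator is uniformly consistent
    (σhat : ℕ → Ω → ℝ → ℝ)
    (hσhat : IsLittleOP μ
      (fun n ω => ⨆ δ ∈ D, ENNReal.ofReal |σhat n ω δ / M.sigma P₀ δ - 1|) (fun _ => 1))
    -- (iii), (iv) the products of the nuisance errors are of smaller order than `1 / √n`
    (hrateY : IsLittleOP μ
      (fun n ω => ⨆ δ ∈ D, M.errY P₀ (ηhat n (S n ω)) δ * M.errα P₀ (ηhat n (S n ω)) δ)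
      (fun n => 1 / Real.sqrt n))
    (hrateA : IsLittleOP μ
      (fun n ω => ⨆ δ ∈ D, M.errA P₀ (ηhat n (S n ω)) δ * M.errα P₀ (ηhat n (S n ω)) δ)
      (fun n => 1 / Real.sqrt n)) :
    IsLittleOP μ
      (fun n ω => ⨆ δ ∈ D, ENNReal.ofReal
        |Real.sqrt n * (psiIF O n ω (ηhat n (S n ω)) δ - M.tiltedLATE P₀ δ) / σhat n ω δ -
          Real.sqrt n * (empMean O n ω (fun o => M.eif P₀ δ o / M.sigma P₀ δ) -
            ∫ o, M.eif P₀ δ o / M.sigma P₀ δ ∂(M.law P₀))|)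
      (fun _ => 1) := by
  obtain ⟨a, b, hab, hDab⟩ : ∃ a b : ℝ, a < b ∧ D ⊆ Set.Icc a b := by
    obtain ⟨r, hr⟩ := hD.isBounded.subset_closedBall 0
    rw [Real.closedBall_eq_Icc] at hr
    exact ⟨0 - |r| - 1, 0 + |r| + 1, by linarith [abs_nonneg r], hr.trans (Set.Icc_subset_Icc
      (by linarith [le_abs_self r]) (by linarith [le_abs_self r]))⟩
  have hTM : ∀ δ ∈ D, M.TiltMoment P₀ δ := hmom
  have hOlaw' : ∀ i, μ.map (O i) = M.lawX P₀ ⊗ₘ M.condKernel P₀ := fun i => by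
    rw [hOlaw, M.law_eq_compProd]
  have hdne : ∀ δ ∈ D, M.denom P₀ δ ≠ 0 := fun δ hδ => (hTM δ hδ).denom_ne_zero (hrel δ hδ)
  obtain ⟨c₀, hc₀, hc⟩ := exists_pos_le_of_continuousOn hD
    (IVModel.continuousOn_denom hD fun δ hδ => (hTM δ hδ).ae_pos).abs
    fun δ hδ => abs_pos.2 (hdne δ hδ)
  -- Lipschitz envelopes of the two normalized contrasts, at `p = 0` and from the difference
  -- between `p = 0` and `p = 1`
  obtain ⟨L₀, hL₀, hL₀t, hL₀h⟩ := hLip 0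
  obtain ⟨L₁, hL₁, hL₁t, hL₁h⟩ := hLip 1
  simp only [IVModel.phi_zero] at hL₀t hL₀h
  have hfL : ∀ᵐ o ∂(M.law P₀), ∀ δ ∈ D, ∀ δ' ∈ D,
      |(M.nuisance P₀).ThetaY δ o / M.denom P₀ δ - (M.nuisance P₀).ThetaY δ' o / M.denom P₀ δ'| ≤
        L₀ o * |δ - δ'| := hL₀t
  have hsplit : ∀ (η : Nuisance d) (o : Obs d) (δ δ' : ℝ),
      |η.ThetaY δ o / M.denom P₀ δ - η.ThetaY δ' o / M.denom P₀ δ'| ≤ L₀ o * |δ - δ'| →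
      |M.phi P₀ δ η 1 o - M.phi P₀ δ' η 1 o| ≤ L₁ o * |δ - δ'| →
      |η.ThetaA δ o / M.denom P₀ δ - η.ThetaA δ' o / M.denom P₀ δ'| ≤
        (L₀ o + L₁ o) * |δ - δ'| := by
    intro η o δ δ' h0 h1
    rw [← IVModel.phi_zero_sub_phi_one, ← IVModel.phi_zero_sub_phi_one, IVModel.phi_zero,
      IVModel.phi_zero, sub_sub_sub_comm, add_mul]
    exact (abs_sub _ _).trans (add_le_add h0 h1)
  have hgL : ∀ᵐ o ∂(M.law P₀), ∀ δ ∈ D, ∀ δ' ∈ D,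
      |(M.nuisance P₀).ThetaA δ o / M.denom P₀ δ - (M.nuisance P₀).ThetaA δ' o / M.denom P₀ δ'| ≤
        (L₀ o + L₁ o) * |δ - δ'| := by
    filter_upwards [hL₀t, hL₁t] with o h0 h1 δ hδ δ' hδ'
    exact hsplit _ o δ δ' (h0 δ hδ δ' hδ') (h1 δ hδ δ' hδ')
  have hgL2 : MemLp (fun o => L₀ o + L₁ o) 2 (M.law P₀) := hL₀.add hL₁
  have hprob : ∀ n, IsProbabilityMeasure (μ.map (S n)) := fun n =>
    Measure.isProbabilityMeasure_map (hSmeas n).aemeasurable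
  have hsnd : ∀ n, ∀ {p : Obs d → Prop}, (∀ᵐ o ∂(M.law P₀), p o) →
      ∀ᵐ so ∂((μ.map (S n)).prod (M.law P₀)), p so.2 := fun n _ h =>
    Measure.quasiMeasurePreserving_snd.ae h
  -- the plug-in errors of the two normalized contrasts
  have hvanY : ∀ τ : ℝ, 0 < τ → Vanishing μ fun n => {ω | ∃ δ ∈ D, τ < |Real.sqrt n *
      empMean O n ω (fun o => (ηhat n (S n ω)).ThetaY δ o / M.denom P₀ δ -
        (M.nuisance P₀).ThetaY δ o / M.denom P₀ δ)|} := by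
    intro τ hτ
    have h := vanishing_contrast_uniform (κ := M.condKernel P₀) (ρ := M.lawX P₀)
      (t := outcomeVar) hOmeas hOindep hOlaw' hSmeas hSindep measurable_outcomeVar
      (α := fun n s => (ηhat n s).α) (γ := fun n s => (ηhat n s).γY) hαmeas hγYmeas hα0 hab hDab
      (fun δ hδ => (hTM δ hδ).tiltBounds_outcome) ?_ hrateY (c := M.denom P₀) hc₀ hc
      (L := fun o => L₀ o + L₀ o) ?_ ?_ hτ
    · simp only [sub_div] at h
      exact h
    · intro δ hδ ε hε
      refine Vanishing.mono (hcons δ hδ ε hε) fun n ω hω => ?_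
      change ENNReal.ofReal (ε * 1) < _
      rw [mul_one]
      refine lt_of_lt_of_le hω ?_
      rw [add_comm]
      exact le_self_add
    · rw [← M.law_eq_compProd]
      exact hL₀.add hL₀
    · intro n
      rw [← M.law_eq_compProd]
      filter_upwards [hL₀h n, hsnd n hL₀t] with so h1 h2 δ hδ δ' hδ'
      rw [sub_div, sub_div, sub_sub_sub_comm, add_mul]
      exact (abs_sub _ _).trans (add_le_add (h1 δ hδ δ' hδ') (h2 δ hδ δ' hδ'))
  have hvanA : ∀ τ : ℝ, 0 < τ → Vanishing μ fun n => {ω | ∃ δ ∈ D, τ < |Real.sqrt n *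
      empMean O n ω (fun o => (ηhat n (S n ω)).ThetaA δ o / M.denom P₀ δ -
        (M.nuisance P₀).ThetaA δ o / M.denom P₀ δ)|} := by
    intro τ hτ
    have h := vanishing_contrast_uniform (κ := M.condKernel P₀) (ρ := M.lawX P₀)
      (t := exposureVar) hOmeas hOindep hOlaw' hSmeas hSindep measurable_exposureVar
      (α := fun n s => (ηhat n s).α) (γ := fun n s => (ηhat n s).γA) hαmeas hγAmeas hα0 hab hDab
      (fun δ hδ => (hTM δ hδ).tiltBounds_exposure) ?_ hrateA (c := M.denom P₀) hc₀ hc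
      (L := fun o => (L₀ o + L₁ o) + (L₀ o + L₁ o)) ?_ ?_ hτ
    · simp only [sub_div] at h
      exact h
    · intro δ hδ ε hε
      refine Vanishing.mono (hcons δ hδ ε hε) fun n ω hω => ?_
      change ENNReal.ofReal (ε * 1) < _
      rw [mul_one]
      refine lt_of_lt_of_le hω ?_
      rw [add_comm]
      exact add_le_add_left le_self_add _
    · rw [← M.law_eq_compProd]
      exact hgL2.add hgL2
    · intro n
      rw [← M.law_eq_compProd]
      filter_upwards [hL₀h n, hL₁h n, hsnd n hgL] with so h0 h1 h2 δ hδ δ' hδ'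
      rw [sub_div, sub_div, sub_sub_sub_comm, add_mul (L₀ so.2 + L₁ so.2)]
      exact (abs_sub _ _).trans (add_le_add
        (hsplit _ so.2 δ δ' (h0 δ hδ δ' hδ') (h1 δ hδ δ' hδ')) (h2 δ hδ δ' hδ'))
  -- population facts about the normalized contrasts
  have hfm : ∀ δ, Measurable fun o => (M.nuisance P₀).ThetaY δ o / M.denom P₀ δ := fun δ =>
    (IVModel.measurable_thetaY δ).div_const _
  have hgm : ∀ δ, Measurable fun o => (M.nuisance P₀).ThetaA δ o / M.denom P₀ δ := fun δ =>
    (IVModel.measurable_thetaA δ).div_const _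
  have hf2 : ∀ δ ∈ D, MemLp (fun o => (M.nuisance P₀).ThetaY δ o / M.denom P₀ δ) 2 (M.law P₀) :=
    fun δ hδ => by
      simpa only [div_eq_inv_mul] using ((hTM δ hδ).memLp_thetaY hY).const_mul (M.denom P₀ δ)⁻¹
  have hg2 : ∀ δ ∈ D, MemLp (fun o => (M.nuisance P₀).ThetaA δ o / M.denom P₀ δ) 2 (M.law P₀) :=
    fun δ hδ => by
      simpa only [div_eq_inv_mul] using (hTM δ hδ).memLp_thetaA.const_mul (M.denom P₀ δ)⁻¹
  have hf1 : ∀ δ ∈ D, ∫ o, (M.nuisance P₀).ThetaY δ o / M.denom P₀ δ ∂(M.law P₀) =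
      M.tiltedLATE P₀ δ := fun δ hδ => (hTM δ hδ).integral_thetaY_div hcausal hcont hY
  have hψc : ContinuousOn (M.tiltedLATE P₀) D :=
    (continuousOn_integral_of_lipschitz hDab hf2 hL₀ hfL).congr fun δ hδ => (hf1 δ hδ).symm
  obtain ⟨Ψ, hΨ⟩ := hD.exists_bound_of_continuousOn hψc
  have heif : ∀ δ o, M.eif P₀ δ o = (M.nuisance P₀).ThetaY δ o / M.denom P₀ δ -
      M.tiltedLATE P₀ δ * ((M.nuisance P₀).ThetaA δ o / M.denom P₀ δ) := fun δ o => by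
    rw [IVModel.eif, IVModel.phi]
    ring
  have hσc : ContinuousOn (M.sigma P₀) D := by
    have h := continuousOn_integral_sq_of_lipschitz hD hDab hf2 hg2 hL₀ hgL2 hfL hgL hψc
    simp only [← heif] at h
    exact h.sqrt
  obtain ⟨σ₀, hσ₀, hσ⟩ := exists_pos_le_of_continuousOn hD hσc hsigma
  intro ε hε
  refine Vanishing.mono (vanishing_studentized
    (f := fun δ o => (M.nuisance P₀).ThetaY δ o / M.denom P₀ δ)
    (g := fun δ o => (M.nuisance P₀).ThetaA δ o / M.denom P₀ δ)
    (fh := fun n ω δ o => (ηhat n (S n ω)).ThetaY δ o / M.denom P₀ δ)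
    (gh := fun n ω δ o => (ηhat n (S n ω)).ThetaA δ o / M.denom P₀ δ) (σhat := σhat)
    hvanY hvanA
    (fun ε hε => exists_measure_empProc_le hOmeas hOindep hOlaw hDab (fun δ _ => hfm δ) hf2 hL₀ hfL
      hε)
    (fun ε hε => exists_measure_empProc_le hOmeas hOindep hOlaw hDab (fun δ _ => hgm δ) hg2 hgL2
      hgL hε)
    (fun δ hδ => (hf2 δ hδ).integrable (by norm_num))
    (fun δ hδ => (hg2 δ hδ).integrable (by norm_num)) hf1
    (fun δ hδ => (hTM δ hδ).integral_thetaA_div (hrel δ hδ)) hΨ hσ₀ hσ ?_ hε) fun n ω hω => ?_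
  · intro τ hτ
    refine Vanishing.mono (hσhat τ hτ) fun n ω hω => ?_
    exact (ofReal_lt_iSup_iff hτ).2 hω
  · obtain ⟨δ, hδ, hlt⟩ := (ofReal_lt_iSup_iff hε).1 hω
    refine ⟨δ, hδ, ?_⟩
    simp only [← heif]
    rw [empMean_div, empMean_div, div_div_div_cancel_right₀ (hdne δ hδ)]
    exact hlt
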